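/- Let $S$ be a smooth surface over $\mathbf C$ (smooth of relative dimension $2$; projectivity is not needed) with canonical line bundle $K_S=\wedge^2\Omega_{S/\mathbf C}$, let $\pi:X=\mathrm{Tot}(K_S)\to S$ be its total space, $\tau\in\Gamma(X,\pi^*K_S)$ the tautological section, and $\sigma:X\to X$ the map $-1$ on the fibres, i.e. $\pi\sigma=\pi$ and $\sigma^*\tau=-\tau$. For a $\mathbf C$-scheme $T$ the pullback of $K_S$ to $S\times T$ is again written $K_S$, that of $\tau$ to $X\times T$ is again written $\tau$, and $\pi$, $\sigma$ also stand for $\pi\times\mathrm{id}_T$, $\sigma\times\mathrm{id}_T$. A Higgs bundle on $S\times T$ is a pair $(E,\phi)$ of a locally free sheaf $E$ of finite rank and a morphism $\phi:E\to E\otimes K_S$. Its spectral sheaf is $$\mathcal E_\phi=\mathrm{coker}\big(\pi^*\phi-\tau\cdot\mathrm{id}:\ \pi^*E\otimes\pi^*K_S^{-1}\to\pi^*E\big)\quad\text{on } X\times T .$$ The transpose $\phi^*:E^*\to E^*\otimes K_S$ on $E^*=\mathcal Hom(E,\mathcal O)$ is characterised by $(\phi^*\lambda)(e)=\lambda(\phi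 e)\in K_S$ for local sections $\lambda$ of $E^*$ and $e$ of $E$. (1) For every Higgs bundle $(E,\phi)$ on $S$ the transpose $\phi^*$ exists and is unique, and the spectral sheaf of $(E^*,-\phi^*)$ is $$\mathcal E_{-\phi^*}\;\cong\;\mathcal Ext^1(\sigma^*\mathcal E_\phi,\pi^*K_S^{-1}).$$ Moreover $\big(\pi_*\mathcal Ext^1(\sigma^*\mathcal E_\phi,\pi^*K_S^{-1}),\ \pi_*(\tau\cdot\mathrm{id})\big)\cong(E^*,-\phi^*)$ as Higgs pairs. (2) The same holds for every family of Higgs bundles, i.e. for every $\mathbf C$-scheme $T$ and every Higgs bundle $(E,\phi)$ on $S\times T$, with $\mathcal E_\phi$ and $\mathcal Ext^1$ taken on $X\times T$. (3) Let $\mathcal M$ be any moduli problem of Higgs bundles on $S$: a class of Higgs bundles on the products $S\times T$, for $T$ locally of finite type over $\mathbf C$, closed under isomorphism and base change (for example families of stable Higgs bundles with fixed Chern character, all of them locally free). Let $\mathcal N$, locally of finite type over $\mathbf C$, be a moduli space for $\mathcal M$, i.e. a $\mathbf C$-scheme corepresenting the functor of isomorphism classes of families in $\mathcal M$ among schemes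 locally of finite type over $\mathbf C$. Thus each family in $\mathcal M$ over $T$ has a classifying map $T\to\mathcal N$; a family of spectral sheaves of $\mathcal M$ is a sheaf on $X\times T$ isomorphic to $\mathcal E_\phi$ for some $(E,\phi)$ in $\mathcal M$, and has the classifying map of $(E,\phi)$. Say that a $\mathbf C$-morphism $\iota:\mathcal N\to\mathcal N$ is * the involution on Higgs pairs, if for every family $(E,\phi)$ in $\mathcal M$ with classifying map $m$ the pair $(E^*,-\phi^*)$ is a family in $\mathcal M$ with classifying map $\iota\circ m$; * the involution on spectral sheaves, if for every family $\mathcal E$ of spectral sheaves of $\mathcal M$ with classifying map $m$ the sheaf $\mathcal Ext^1(\sigma^*\mathcal E,\pi^*K_S^{-1})$ is a family of spectral sheaves of $\mathcal M$ with classifying map $\iota\circ m$. Then $\iota$ is the involution on Higgs pairs if and only if it is the involution on spectral sheaves. If $\iota_1$ is the involution on Higgs pairs and $\iota_2$ is the involution on spectral sheaves, then $\iota_1=\iota_2$, and the square $$\begin{array}{ccc} X\times\mathcal N&\xrightarrow{\ \mathrm{id}\times\iota_2\ }&X\times\mathcal N\\ {\scriptstyle\pi\times\mathrm{id}}\downarrow&&\downarrow{\scriptstyle\pi\times\mathrm{id}}\\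 S\times\mathcal N&\xrightarrow{\ \mathrm{id}\times\iota_1\ }&S\times\mathcal N\end{array}$$ commutes. -/

import Mathlib

open CategoryTheory AlgebraicGeometry Limits TopologicalSpace Opposite

universe u

namespace AlgebraicGeometry.Scheme.Modules
variable {X : Scheme.{u}}

section
variable (X)

/-- Sheafification of presheaves of modules. -/
noncomputable abbrev shf : X.PresheafOfModules ⥤ X.Modules := PresheafOfModules.sheafification (𝟙 X.ringCatSheaf.obj)

/-- Sheafification is left adjoint to the forgetful functor. -/
noncomputable def shfAdj : shf X ⊣ toPresheafOfModules X :=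
  PresheafOfModules.sheafificationAdjunction (𝟙 X.ringCatSheaf.obj)

theorem ab5P (J : Type u) [SmallCategory J] [IsFiltered J] : HasExactColimitsOfShape J X.PresheafOfModules :=
   HasExactColimitsOfShape.domain_of_functor J (PresheafOfModules.toPresheaf X.ringCatSheaf.obj)

theorem ab5 (J : Type u) [SmallCategory J] [IsFiltered J] : HasExactColimitsOfShape J X.Modules := by
  have := ab5P X J
  have : PreservesFiniteLimits (shf X) := inferInstanceAs (PreservesFiniteLimits (PresheafOfModules.sheafification (𝟙 X.ringCatSheaf.obj)))
  exact (shfAdj X).hasExactColimitsOfShape J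

theorem sep : HasSeparator X.Modules := by
  have h : ObjectProperty.IsSeparating (.ofObj fun U : X.Opens => (shf X).obj ((PresheafOfModules.free X.ringCatSheaf.obj).obj (yoneda.obj U))) := by
    intro M N f g h
    apply (toPresheafOfModules X).map_injective
    apply PresheafOfModules.freeYoneda.isSeparating
    rintro _ ⟨U⟩ a
    obtain ⟨b, rfl⟩ := ((shfAdj X).homEquiv _ _).surjective a
    rw [← Adjunction.homEquiv_naturality_right, ← Adjunction.homEquiv_naturality_right]
    congr 1
    exact h _ ⟨U⟩ b
  have h2 := ObjectProperty.IsSeparating.isSeparator_coproduct h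
  exact ⟨_, h2⟩

instance : IsGrothendieckAbelian.{u} X.Modules where
  hasFilteredColimitsOfSize := ⟨fun _ => inferInstance⟩
  ab5OfSize := by
    have := ab5 X
    exact { ofShape := fun J _ _ => this J }
  hasSeparator := sep X

noncomputable instance : EnoughInjectives X.Modules := inferInstance
end

/-- Restriction of sections. -/
noncomputable def res (M : X.Modules) {U V : X.Opens} (h : V ≤ U) : Γ(M, U) →+ Γ(M, V) :=
  (M.presheaf.map (homOfLE h).op).hom

/-- Restriction of functions. -/
noncomputable def resO (X : Scheme.{u}) {U V : X.Opens} (h : V ≤ U) : Γ(X, U) →+* Γ(X, V) :=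
  (X.presheaf.map (homOfLE h).op).hom

lemma res_smul (M : X.Modules) {U V : X.Opens} (h : V ≤ U) (r : Γ(X, U)) (m : Γ(M, U)) :
    res M h (r • m) = resO X h r • res M h m := M.map_smul _ _ _

@[simp] lemma res_self (M : X.Modules) {U : X.Opens} (h : U ≤ U) (m : Γ(M, U)) :
    res M h m = m := by
  have : (homOfLE h).op = 𝟙 (op U) := rfl
  simp [res, this]

@[simp] lemma res_res (M : X.Modules) {U V W : X.Opens} (h : V ≤ U) (h' : W ≤ V) (m : Γ(M, U)) :
    res M h' (res M h m) = res M (h'.trans h) m := by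
  have : (homOfLE (h'.trans h)).op = (homOfLE h).op ≫ (homOfLE h').op := rfl
  simp [res, this]

@[simp] lemma resO_self {U : X.Opens} (h : U ≤ U) (m : Γ(X, U)) :
    resO X h m = m := by
  have : (homOfLE h).op = 𝟙 (op U) := rfl
  simp [resO, this]

@[simp] lemma resO_resO {U V W : X.Opens} (h : V ≤ U) (h' : W ≤ V) (m : Γ(X, U)) :
    resO X h' (resO X h m) = resO X (h'.trans h) m := by
  have : (homOfLE (h'.trans h)).op = (homOfLE h).op ≫ (homOfLE h').op := rfl
  simp [resO, this]

/-- The maps on sections of a morphism of modules. -/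
noncomputable def appLin {M N : X.Modules} (f : M ⟶ N) (U : X.Opens) :
    Γ(M, U) →ₗ[Γ(X, U)] Γ(N, U) where
  toFun m := f.app U m
  map_add' := map_add _
  map_smul' r m := Hom.app_smul f r m

lemma appLin_res {M N : X.Modules} (f : M ⟶ N) {U V : X.Opens} (h : V ≤ U) (m : Γ(M, U)) :
    appLin f V (res M h m) = res N h (appLin f U m) :=
  ConcreteCategory.congr_hom (f.mapPresheaf.naturality (homOfLE h).op) m

@[simp] lemma appLin_comp {M N P : X.Modules} (f : M ⟶ N) (g : N ⟶ P) (U : X.Opens) :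
    appLin (f ≫ g) U = appLin g U ∘ₗ appLin f U := rfl

@[simp] lemma appLin_id {M : X.Modules} (U : X.Opens) :
    appLin (𝟙 M) U = LinearMap.id := rfl

@[simp] lemma appLin_add {M N : X.Modules} (f g : M ⟶ N) (U : X.Opens) :
    appLin (f + g) U = appLin f U + appLin g U := rfl

lemma hom_ext_lin {M N : X.Modules} {f g : M ⟶ N} (h : ∀ U, appLin f U = appLin g U) :
    f = g := by
  apply hom_ext
  intro U
  ext m
  exact LinearMap.congr_fun (h U) m

/-- A morphism of modules from compatible linear maps on sections. -/
noncomputable def homOfLin {M N : X.Modules} (f : ∀ U : X.Opens, Γ(M, U) →ₗ[Γ(X, U)] Γ(N, U))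
    (hf : ∀ (U V : X.Opens) (h : V ≤ U) (m : Γ(M, U)), f V (res M h m) = res N h (f U m)) :
    M ⟶ N :=
  SheafOfModules.Hom.mk (X := M) (Y := N) <| PresheafOfModules.homMk
    { app := fun U => AddCommGrpCat.ofHom (f U.unop).toAddMonoidHom
      naturality := fun U V i => by
        ext m
        exact hf U.unop V.unop (leOfHom i.unop) m } (fun U r m => (f U.unop).map_smul r m)

@[simp] lemma appLin_homOfLin {M N : X.Modules}
    (f : ∀ U : X.Opens, Γ(M, U) →ₗ[Γ(X, U)] Γ(N, U)) (hf) (U : X.Opens) :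
    appLin (homOfLin (M := M) (N := N) f hf) U = f U := rfl

/-- Homomorphisms `M|_U ⟶ N|_U`, as compatible families of linear maps over the opens `V ≤ U`. -/
@[ext] structure LocalHom (M N : X.Modules) (U : X.Opens) where
  app (V : X.Opens) (hV : V ≤ U) : Γ(M, V) →ₗ[Γ(X, V)] Γ(N, V)
  naturality {V W : X.Opens} (hV : V ≤ U) (hW : W ≤ V) (m : Γ(M, V)) :
    app W (hW.trans hV) (res M hW m) = res N hW (app V hV m)

namespace LocalHom
variable {M N : X.Modules} {U V : X.Opens}

noncomputable instance : AddCommGroup (LocalHom M N U) :=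
  letI : Zero (LocalHom M N U) := ⟨⟨fun _ _ => 0, by simp⟩⟩
  letI : Add (LocalHom M N U) := ⟨fun f g => ⟨fun V hV => f.app V hV + g.app V hV,
    fun hV hW m => by simp [f.naturality hV hW m, g.naturality hV hW m]⟩⟩
  letI : Neg (LocalHom M N U) := ⟨fun f => ⟨fun V hV => - f.app V hV,
    fun hV hW m => by simp [f.naturality hV hW m]⟩⟩
  letI : Sub (LocalHom M N U) := ⟨fun f g => ⟨fun V hV => f.app V hV - g.app V hV,
    fun hV hW m => by simp [f.naturality hV hW m, g.naturality hV hW m]⟩⟩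
  letI : SMul ℕ (LocalHom M N U) := ⟨fun n f => ⟨fun V hV => n • f.app V hV,
    fun hV hW m => by simp [f.naturality hV hW m]⟩⟩
  letI : SMul ℤ (LocalHom M N U) := ⟨fun n f => ⟨fun V hV => n • f.app V hV,
    fun hV hW m => by simp [f.naturality hV hW m]⟩⟩
  Function.Injective.addCommGroup (fun f => fun (V : {V : X.Opens // V ≤ U}) => f.app V.1 V.2)
    (fun f g h => LocalHom.ext (by
      funext V hV; exact congrFun h ⟨V, hV⟩)) rfl (fun _ _ => rfl) (fun _ => rfl)
      (fun _ _ => rfl) (fun _ _ => rfl) (fun _ _ => rfl)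

@[simp] lemma add_app (f g : LocalHom M N U) (hV : V ≤ U) :
    (f + g).app V hV = f.app V hV + g.app V hV := rfl
@[simp] lemma zero_app (hV : V ≤ U) : (0 : LocalHom M N U).app V hV = 0 := rfl

noncomputable instance : Module Γ(X, U) (LocalHom M N U) where
  smul r f := ⟨fun V hV => resO X hV r • f.app V hV, fun hV hW m => by
      simp [f.naturality hV hW m, res_smul]⟩
  one_smul f := by ext V hV x; change resO X hV 1 • f.app V hV x = _; simp
  mul_smul r s f := by
    ext V hV x; change resO X hV (r * s) • f.app V hV x = resO X hV r • resO X hV s • f.app V hV x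
    simp [mul_smul]
  smul_zero r := by ext V hV x; change resO X hV r • (0 : Γ(N, V)) = 0; simp
  smul_add r f g := by
    ext V hV x
    change resO X hV r • (f.app V hV x + g.app V hV x) =
      resO X hV r • f.app V hV x + resO X hV r • g.app V hV x
    simp
  add_smul r s f := by
    ext V hV x
    change resO X hV (r + s) • f.app V hV x = resO X hV r • f.app V hV x + resO X hV s • f.app V hV x
    simp [add_smul]
  zero_smul f := by ext V hV x; change resO X hV 0 • f.app V hV x = 0; simp

@[simp] lemma smul_app (r : Γ(X, U)) (f : LocalHom M N U) (hV : V ≤ U) :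
    (r • f).app V hV = resO X hV r • f.app V hV := rfl

/-- Restriction of local homomorphisms. -/
def restrict (h : V ≤ U) : LocalHom M N U →+ LocalHom M N V where
  toFun f := ⟨fun W hW => f.app W (hW.trans h), fun _ _ _ => f.naturality _ _ _⟩
  map_zero' := rfl
  map_add' _ _ := rfl

@[simp] lemma restrict_app (h : V ≤ U) (f : LocalHom M N U) {W} (hW : W ≤ V) :
    (restrict h f).app W hW = f.app W (hW.trans h) := rfl

/-- Postcomposition of local homomorphisms. -/
noncomputable def postcomp {N' : X.Modules} (g : N ⟶ N') (U : X.Opens) :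
    LocalHom M N U →ₗ[Γ(X, U)] LocalHom M N' U where
  toFun f := ⟨fun V hV => appLin g V ∘ₗ f.app V hV, fun hV hW m => by
    simp [f.naturality hV hW m, appLin_res]⟩
  map_add' f f' := by ext V hV m; simp
  map_smul' r f := by ext V hV m; simp

@[simp] lemma postcomp_app {N' : X.Modules} (g : N ⟶ N') (f : LocalHom M N U) (hV : V ≤ U) :
    (postcomp g U f).app V hV = appLin g V ∘ₗ f.app V hV := rfl

end LocalHom

/-- Gluing of sections of a sheaf of modules. -/
lemma existsUnique_glue (N : X.Modules) {ι : Type*} (W : ι → X.Opens) (V : X.Opens)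
    (hW : ∀ i, W i ≤ V) (hV : V ≤ iSup W) (s : ∀ i, Γ(N, W i))
    (hs : ∀ i j, res N (inf_le_left : W i ⊓ W j ≤ W i) (s i) =
      res N (inf_le_right : W i ⊓ W j ≤ W j) (s j)) :
    ∃! n : Γ(N, V), ∀ i, res N (hW i) n = s i :=
  TopCat.Sheaf.existsUnique_gluing' ⟨N.presheaf, N.isSheaf⟩ W V
    (fun i => homOfLE (hW i)) hV s hs

/-- The abelian presheaf `U ↦ Hom(M|_U, N|_U)`. -/
noncomputable def homAb (M N : X.Modules) : TopCat.Presheaf Ab.{u} X where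
  obj U := AddCommGrpCat.of (LocalHom M N U.unop)
  map i := AddCommGrpCat.ofHom (LocalHom.restrict (leOfHom i.unop))

/-- The presheaf of modules `U ↦ Hom(M|_U, N|_U)`. -/
noncomputable def homPresheaf (M N : X.Modules) : X.PresheafOfModules :=
  letI (U : X.Opensᵒᵖ) : Module (X.ringCatSheaf.obj.obj U) ((homAb M N).obj U) :=
    inferInstanceAs (Module Γ(X, U.unop) (LocalHom M N U.unop))
  PresheafOfModules.ofPresheaf (homAb M N) (fun {U V} i r f => by
    change LocalHom.restrict (leOfHom i.unop) (show LocalHom M N U.unop from r • f) =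
      (resO X (leOfHom i.unop) r) •
        (LocalHom.restrict (leOfHom i.unop) (show LocalHom M N U.unop from f))
    refine LocalHom.ext ?_
    funext W hW
    exact congrArg (· • _) (resO_resO (leOfHom i.unop) hW r).symm)

lemma homAb_isSheaf (M N : X.Modules) : (homAb M N).IsSheaf := by
  rw [TopCat.Presheaf.isSheaf_iff_isSheafUniqueGluing]
  intro ι U sf hsf
  have hsf' : ∀ i j (V : X.Opens) (h1 : V ≤ U i) (h2 : V ≤ U j),
      (show LocalHom M N (U i) from sf i).app V h1 =
        (show LocalHom M N (U j) from sf j).app V h2 := by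
    intro i j V h1 h2
    have := congrArg (fun (f : LocalHom M N (U i ⊓ U j)) => f.app V (le_inf h1 h2)) (hsf i j)
    exact this
  have key : ∀ (V : X.Opens) (hV : V ≤ iSup U) (m : Γ(M, V)), ∃! n : Γ(N, V),
      ∀ i, res N (inf_le_left : V ⊓ U i ≤ V) n =
        (show LocalHom M N (U i) from sf i).app (V ⊓ U i) inf_le_right (res M inf_le_left m) := by
    intro V hV m
    refine existsUnique_glue N (fun i => V ⊓ U i) V (fun _ => inf_le_left) ?_ _ ?_
    · rw [← inf_iSup_eq, inf_of_le_left hV]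
    · intro i j
      rw [← LocalHom.naturality, ← LocalHom.naturality, res_res, res_res]
      rw [hsf' i j]
  choose g hg hgu using key
  have hgu' : ∀ V hV m (n : Γ(N, V)), (∀ (i) (W : X.Opens) (h1 : W ≤ V) (h2 : W ≤ U i),
      res N h1 n = (show LocalHom M N (U i) from sf i).app W h2 (res M h1 m)) → n = g V hV m :=
    fun V hV m n h => hgu V hV m n (fun i => h i _ _ _)
  have hg' : ∀ V hV m (i) (W : X.Opens) (h1 : W ≤ V) (h2 : W ≤ U i),
      res N h1 (g V hV m) = (show LocalHom M N (U i) from sf i).app W h2 (res M h1 m) := by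
    intro V hV m i W h1 h2
    have := congrArg (res N (le_inf h1 h2)) (hg V hV m i)
    rwa [res_res, ← LocalHom.naturality, res_res] at this
  let G : LocalHom M N (iSup U) :=
    { app := fun V hV =>
        { toFun := g V hV
          map_add' := fun m m' => by
            symm; apply hgu'
            intro i W h1 h2
            simp [hg' V hV _ i W h1 h2]
          map_smul' := fun r m => by
            symm; apply hgu'
            intro i W h1 h2
            simp [hg' V hV _ i W h1 h2, res_smul] }
      naturality := fun {V W} hV hW m => by
        symm; apply hgu'
        intro i W' h1 h2
        simp [hg' V hV _ i W' _ h2] }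
  refine ⟨G, fun i => ?_, fun G' hG' => ?_⟩
  · change LocalHom.restrict (le_iSup U i) G = _
    refine LocalHom.ext ?_
    funext V hV
    ext m
    have := hg' V (hV.trans (le_iSup U i)) m i V le_rfl hV
    rw [res_self, res_self] at this
    exact this
  · refine LocalHom.ext ?_
    funext V hV
    ext m
    apply hgu'
    intro i W h1 h2
    rw [← hG' i]
    change _ = (show LocalHom M N (iSup U) from G').app W _ _
    exact (LocalHom.naturality _ _ _ _).symm

/-- The sheaf of homomorphisms `U ↦ Hom(M|_U, N|_U)`. -/
noncomputable def sheafHom (M N : X.Modules) : X.Modules where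
  val := homPresheaf M N
  isSheaf := homAb_isSheaf M N

/-- The functor sending `N` to the sheaf of homomorphisms from `M` to `N`. -/
noncomputable def sheafHomFunctor (M : X.Modules) : X.Modules ⥤ X.Modules where
  obj N := sheafHom M N
  map {N N'} g := homOfLin (M := sheafHom M N) (N := sheafHom M N')
    (fun U => LocalHom.postcomp g U) (fun _ _ _ _ => rfl)
  map_id N := hom_ext_lin fun U => rfl
  map_comp f g := hom_ext_lin fun U => rfl

instance (M : X.Modules) : (sheafHomFunctor M).Additive where
  map_add {N N' f g} := hom_ext_lin fun U => by
    refine LinearMap.ext fun (x : LocalHom M N U) => ?_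
    change LocalHom.postcomp (f + g) U x = LocalHom.postcomp f U x + LocalHom.postcomp g U x
    ext V hV m
    simp

/-- The sheaf `Ext` of degree `n`, a right derived functor of the sheaf of homomorphisms. -/
noncomputable def sheafExt (n : ℕ) (M N : X.Modules) : X.Modules :=
  ((sheafHomFunctor M).rightDerived n).obj N

/-- The presheaf `U ↦ M(U) ⊗ N(U)`. -/
noncomputable def tensorPresheaf (M N : X.Modules) : X.PresheafOfModules :=
  PresheafOfModules.Monoidal.tensorObj (R := X.presheaf) M.val N.val

/-- The tensor product of sheaves of modules, the sheafification of `U ↦ M(U) ⊗ N(U)`. -/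
noncomputable def tensor (M N : X.Modules) : X.Modules := (shf X).obj (tensorPresheaf M N)

/-- The sheafification morphism. -/
noncomputable def toTensor (M N : X.Modules) : tensorPresheaf M N ⟶ (tensor M N).val :=
  (shfAdj X).unit.app (tensorPresheaf M N)

/-- The map from the presheaf tensor product to the tensor product on sections. -/
noncomputable def toTensorLin (M N : X.Modules) (U : X.Opens) :
    TensorProduct Γ(X, U) Γ(M, U) Γ(N, U) →ₗ[Γ(X, U)] Γ(tensor M N, U) where
  toFun t := ((toTensor M N).app (op U)).hom t
  map_add' t t' := ((toTensor M N).app (op U)).hom.map_add t t'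
  map_smul' r t := ((toTensor M N).app (op U)).hom.map_smul r t

/-- The section `m ⊗ n` of `M ⊗ N`. -/
noncomputable def tmul {M N : X.Modules} {U : X.Opens} (m : Γ(M, U)) (n : Γ(N, U)) :
    Γ(tensor M N, U) :=
  toTensorLin M N U (m ⊗ₜ[Γ(X, U)] n)

section tmul
variable {M N : X.Modules} {U V : X.Opens}

lemma tmul_add (m : Γ(M, U)) (n n' : Γ(N, U)) : tmul m (n + n') = tmul m n + tmul m n' := by
  simp [tmul, TensorProduct.tmul_add]

lemma add_tmul (m m' : Γ(M, U)) (n : Γ(N, U)) : tmul (m + m') n = tmul m n + tmul m' n := by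
  simp [tmul, TensorProduct.add_tmul]

lemma smul_tmul (r : Γ(X, U)) (m : Γ(M, U)) (n : Γ(N, U)) : tmul (r • m) n = r • tmul m n := by
  simp only [tmul, ← TensorProduct.smul_tmul', LinearMap.map_smul]

lemma tmul_smul (r : Γ(X, U)) (m : Γ(M, U)) (n : Γ(N, U)) : tmul m (r • n) = r • tmul m n := by
  simp only [tmul, TensorProduct.tmul_smul, LinearMap.map_smul]

lemma res_tmul (h : V ≤ U) (m : Γ(M, U)) (n : Γ(N, U)) :
    res (tensor M N) h (tmul m n) = tmul (res M h m) (res N h n) :=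
  (PresheafOfModules.naturality_apply (toTensor M N) (homOfLE h).op
    (show TensorProduct Γ(X, U) Γ(M, U) Γ(N, U) from m ⊗ₜ[Γ(X, U)] n)).symm

end tmul

/-- Bilinear maps `M × N ⟶ Q` of sheaves of modules. -/
structure Bilin (M N Q : X.Modules) where
  app (U : X.Opens) : Γ(M, U) →ₗ[Γ(X, U)] Γ(N, U) →ₗ[Γ(X, U)] Γ(Q, U)
  naturality {U V : X.Opens} (h : V ≤ U) (m : Γ(M, U)) (n : Γ(N, U)) :
    app V (res M h m) (res N h n) = res Q h (app U m n)

noncomputable def tensorLiftPresheaf {M N Q : X.Modules} (b : Bilin M N Q) :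
    tensorPresheaf M N ⟶ Q.val where
  app U := show ModuleCat.of Γ(X, U.unop) (TensorProduct Γ(X, U.unop) Γ(M, U.unop) Γ(N, U.unop)) ⟶
    Q.val.obj U from ModuleCat.ofHom (X := TensorProduct Γ(X, U.unop) Γ(M, U.unop) Γ(N, U.unop))
      (Y := Γ(Q, U.unop)) (TensorProduct.lift (b.app U.unop))
  naturality {U V} f := by
    refine ModuleCat.MonoidalCategory.tensor_ext ?_
    intro m n
    exact b.naturality (leOfHom f.unop) m n

/-- The morphism `M ⊗ N ⟶ Q` given by a bilinear map. -/
noncomputable def tensorLift {M N Q : X.Modules} (b : Bilin M N Q) : tensor M N ⟶ Q :=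
  ((shfAdj X).homEquiv (tensorPresheaf M N) Q).symm (tensorLiftPresheaf b)

lemma tensorLift_tmul {M N Q : X.Modules} (b : Bilin M N Q) {U : X.Opens}
    (m : Γ(M, U)) (n : Γ(N, U)) : appLin (tensorLift b) U (tmul m n) = b.app U m n := by
  have h := (shfAdj X).homEquiv_unit (X := tensorPresheaf M N) (Y := Q) (f := tensorLift b)
  replace h := (((shfAdj X).homEquiv (tensorPresheaf M N) Q).apply_symm_apply
    (tensorLiftPresheaf b)).symm.trans h
  have h2 := congrArg (fun f => (PresheafOfModules.Hom.app f (op U)).hom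
    (show TensorProduct Γ(X, U) Γ(M, U) Γ(N, U) from m ⊗ₜ[Γ(X, U)] n)) h
  exact h2.symm

/-- The structure sheaf as a module. -/
noncomputable def structureSheaf (X : Scheme.{u}) : X.Modules := SheafOfModules.unit X.ringCatSheaf

/-- The dual `M^*`, the sheaf of homomorphisms to the structure sheaf. -/
noncomputable def dual (M : X.Modules) : X.Modules := sheafHom M (structureSheaf X)

/-- Evaluation. -/
noncomputable def evalBilin (M N : X.Modules) : Bilin (sheafHom M N) M N where
  app U :=
    { toFun := fun f : LocalHom M N U => f.app U le_rfl
      map_add' := fun _ _ => rfl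
      map_smul' := fun r (f : LocalHom M N U) => by
        change resO X le_rfl r • f.app U le_rfl = r • f.app U le_rfl
        rw [resO_self] }
  naturality h f m := LocalHom.naturality (show LocalHom M N _ from f) le_rfl h m

/-- The value of a local homomorphism at a section. -/
noncomputable def evalAt {M N : X.Modules} {U : X.Opens} (f : Γ(sheafHom M N, U)) (m : Γ(M, U)) :
    Γ(N, U) := (evalBilin M N).app U f m

/-- The value of a local functional as a function. -/
noncomputable def pair {M : X.Modules} {U : X.Opens} (f : Γ(dual M, U)) (m : Γ(M, U)) :
    Γ(X, U) := (evalBilin M (structureSheaf X)).app U f m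

section pair
variable {M : X.Modules} {U V : X.Opens}

lemma pair_add (f : Γ(dual M, U)) (m m' : Γ(M, U)) : pair f (m + m') = pair f m + pair f m' :=
  ((evalBilin M (structureSheaf X)).app U f).map_add m m'

lemma pair_smul (r : Γ(X, U)) (f : Γ(dual M, U)) (m : Γ(M, U)) : pair f (r • m) = r * pair f m :=
  ((evalBilin M (structureSheaf X)).app U f).map_smul r m

lemma add_pair (f f' : Γ(dual M, U)) (m : Γ(M, U)) : pair (f + f') m = pair f m + pair f' m :=
  LinearMap.congr_fun (((evalBilin M (structureSheaf X)).app U).map_add f f') m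

lemma smul_pair (r : Γ(X, U)) (f : Γ(dual M, U)) (m : Γ(M, U)) : pair (r • f) m = r * pair f m :=
  LinearMap.congr_fun (((evalBilin M (structureSheaf X)).app U).map_smul r f) m

lemma res_pair (h : V ≤ U) (f : Γ(dual M, U)) (m : Γ(M, U)) :
    pair (res (dual M) h f) (res M h m) = resO X h (pair f m) :=
  (evalBilin M (structureSheaf X)).naturality h f m

end pair

/-- Bilinear pairings `L × K ⟶ O`. -/
structure Pairing (L K : X.Modules) where
  app (U : X.Opens) : Γ(L, U) →ₗ[Γ(X, U)] Γ(K, U) →ₗ[Γ(X, U)] Γ(X, U)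
  naturality {U V : X.Opens} (h : V ≤ U) (l : Γ(L, U)) (k : Γ(K, U)) :
    app V (res L h l) (res K h k) = resO X h (app U l k)

/-- The evaluation pairing `M^* × M ⟶ O`. -/
noncomputable def dualPairing (M : X.Modules) : Pairing (dual M) M where
  app U := LinearMap.mk₂ _ pair add_pair smul_pair pair_add pair_smul
  naturality := res_pair

noncomputable def Pairing.flip {L K : X.Modules} (p : Pairing L K) : Pairing K L where
  app U := (p.app U).flip
  naturality h l k := p.naturality h k l

/-- `(k, n) ↦ (l ↦ ⟨l, k⟩ n)`. -/
noncomputable def contractLin {L K : X.Modules} (p : Pairing L K) (N : X.Modules) (U : X.Opens) :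
    Γ(K, U) →ₗ[Γ(X, U)] Γ(N, U) →ₗ[Γ(X, U)] LocalHom L N U :=
  LinearMap.mk₂ _ (fun k n => ⟨fun V hV =>
      LinearMap.smulRight ((p.app V).flip (res K hV k)) (res N hV n),
      fun {V W} hV hW l => by
        have := p.naturality hW l (res K hV k)
        rw [res_res] at this
        simp [res_smul, this]⟩)
    (fun k k' n => by ext V hV l; simp [add_smul])
    (fun r k n => by ext V hV l; simp [res_smul, mul_smul])
    (fun k n n' => by ext V hV l; simp)
    (fun r k n => by ext V hV l; simp [res_smul, smul_smul, mul_comm])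

/-- `K ⊗ N ⟶ Hom(L, N)`, `k ⊗ n ↦ (l ↦ ⟨l, k⟩ n)`. -/
noncomputable def contract {L K : X.Modules} (p : Pairing L K) (N : X.Modules) :
    tensor K N ⟶ sheafHom L N :=
  tensorLift (Q := sheafHom L N)
    { app := fun U => contractLin p N U
      naturality := fun {U V} h k n => LocalHom.ext (by
        funext W hW
        change LinearMap.smulRight ((p.app W).flip (res K hW (res K h k)))
          (res N hW (res N h n)) = LinearMap.smulRight ((p.app W).flip (res K (hW.trans h) k))
          (res N (hW.trans h) n)
        rw [res_res, res_res]) }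

end AlgebraicGeometry.Scheme.Modules

section ext
variable {R S : Type u} [CommRing R] [CommRing S] {f : R →+* S}
variable {M N : Type u} [AddCommGroup M] [AddCommGroup N] [Module R M] [Module S N]

/-- The semilinear map on exterior powers induced by a semilinear map. -/
noncomputable def exteriorPower.semiMap (n : ℕ) (a : M →ₛₗ[f] N) : ⋀[R]^n M →ₛₗ[f] ⋀[S]^n N :=
  letI : Module R (⋀[S]^n N) := Module.compHom _ f
  let b : M [⋀^Fin n]→ₗ[R] (⋀[S]^n N) :=
    { toFun := fun m => exteriorPower.ιMulti S n (fun i => a (m i))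
      map_update_add' := fun m i x y => by
        simp only [Function.apply_update (fun _ => a), map_add, AlternatingMap.map_update_add]
      map_update_smul' := fun m i c x => by
        simp only [Function.apply_update (fun _ => a), map_smulₛₗ, AlternatingMap.map_update_smul]
        rfl
      map_eq_zero_of_eq' := fun m i j h hij =>
        (exteriorPower.ιMulti S n).map_eq_zero_of_eq _ (by simp [h]) hij }
  { toFun := exteriorPower.alternatingMapLinearEquiv b
    map_add' := map_add _
    map_smul' := fun r x => (exteriorPower.alternatingMapLinearEquiv b).map_smul r x }

lemma exteriorPower.semiMap_ιMulti (n : ℕ) (a : M →ₛₗ[f] N) (m : Fin n → M) :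
    exteriorPower.semiMap n a (exteriorPower.ιMulti R n m) =
      exteriorPower.ιMulti S n (fun i => a (m i)) :=
  letI : Module R (⋀[S]^n N) := Module.compHom _ f
  exteriorPower.alternatingMapLinearEquiv_apply_ιMulti _ _

lemma exteriorPower.addHom_ext {n : ℕ} {A : Type*} [AddCommGroup A] (g h : ⋀[R]^n M →+ A)
    (r : R → A → A) (hg : ∀ c x, g (c • x) = r c (g x)) (hh : ∀ c x, h (c • x) = r c (h x))
    (H : ∀ m, g (exteriorPower.ιMulti R n m) = h (exteriorPower.ιMulti R n m)) : g = h := by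
  ext x
  have hx : x ∈ Submodule.span R (Set.range (exteriorPower.ιMulti R n (M := M))) := by
    rw [exteriorPower.ιMulti_span]; trivial
  induction hx using Submodule.span_induction with
  | mem x hx => obtain ⟨m, rfl⟩ := hx; exact H m
  | zero => simp
  | add x y _ _ hx hy => rw [map_add, map_add, hx, hy]
  | smul c x _ hx => rw [hg, hh, hx]
end ext

namespace AlgebraicGeometry.Scheme.Modules
variable {X : Scheme.{u}}

/-- Sections of a presheaf of modules as a module over the ring of functions. -/
noncomputable abbrev secMod (M : X.PresheafOfModules) (U : X.Opens) : ModuleCat.{u} Γ(X, U) :=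
  M.obj (op U)

noncomputable def presheafMap (M : X.PresheafOfModules) {U V : X.Opensᵒᵖ} (i : U ⟶ V) :
    secMod M U.unop →ₛₗ[(X.presheaf.map i).hom] secMod M V.unop where
  toFun m := M.map i m
  map_add' := map_add _
  map_smul' r m := PresheafOfModules.map_smul M i r m

/-- The abelian presheaf `U ↦ ⋀ⁿ M(U)`. -/
noncomputable def exteriorPowerAb (M : X.PresheafOfModules) (n : ℕ) : X.Opensᵒᵖ ⥤ Ab.{u} where
  obj U := AddCommGrpCat.of (⋀[Γ(X, U.unop)]^n (secMod M U.unop))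
  map i := AddCommGrpCat.ofHom (exteriorPower.semiMap n (presheafMap M i)).toAddMonoidHom
  map_id U := by
    ext1
    refine exteriorPower.addHom_ext _ _ (fun c x => c • x) (fun c x => ?_) (fun c x => rfl)
      (fun m => ?_)
    · refine ((exteriorPower.semiMap n (presheafMap M (𝟙 U))).map_smulₛₗ c x).trans ?_
      exact congrArg (· • exteriorPower.semiMap n (presheafMap M (𝟙 U)) x)
        (ConcreteCategory.congr_hom (X.presheaf.map_id U) c)
    · refine (exteriorPower.semiMap_ιMulti n (presheafMap M (𝟙 U)) m).trans ?_
      refine congrArg (exteriorPower.ιMulti _ n) (funext fun j => ?_)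
      exact ConcreteCategory.congr_hom (M.presheaf.map_id U) (m j)
  map_comp {U V W} i j := by
    ext1
    refine exteriorPower.addHom_ext _ _ (fun c x => (X.presheaf.map (i ≫ j)).hom c • x)
      (fun c x => ?_) (fun c x => ?_) (fun m => ?_)
    · exact (exteriorPower.semiMap n (presheafMap M (i ≫ j))).map_smulₛₗ c x
    · refine (congrArg (exteriorPower.semiMap n (presheafMap M j))
        ((exteriorPower.semiMap n (presheafMap M i)).map_smulₛₗ c x)).trans ?_
      refine ((exteriorPower.semiMap n (presheafMap M j)).map_smulₛₗ _ _).trans ?_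
      rw [X.presheaf.map_comp]
      rfl
    · refine (exteriorPower.semiMap_ιMulti n (presheafMap M (i ≫ j)) m).trans ?_
      refine Eq.trans ?_ (congrArg (exteriorPower.semiMap n (presheafMap M j))
        (exteriorPower.semiMap_ιMulti n (presheafMap M i) m)).symm
      refine Eq.trans ?_ (exteriorPower.semiMap_ιMulti n (presheafMap M j) _).symm
      refine congrArg (exteriorPower.ιMulti _ n) (funext fun k => ?_)
      exact ConcreteCategory.congr_hom (M.presheaf.map_comp i j) (m k)

/-- The presheaf of modules `U ↦ ⋀ⁿ M(U)`. -/
noncomputable def exteriorPowerPresheaf (M : X.PresheafOfModules) (n : ℕ) : X.PresheafOfModules :=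
  letI (U : X.Opensᵒᵖ) : Module (X.ringCatSheaf.obj.obj U) ((exteriorPowerAb M n).obj U) :=
    inferInstanceAs (Module Γ(X, U.unop) (⋀[Γ(X, U.unop)]^n (secMod M U.unop)))
  PresheafOfModules.ofPresheaf (exteriorPowerAb M n) (fun {U V} i r m =>
    (exteriorPower.semiMap n (presheafMap M i)).map_smulₛₗ r m)

/-- The structure maps `R ⟶ Γ(X, U)` of a scheme over `Spec R`, as a morphism from the constant
presheaf. -/
noncomputable def structureMap {R : CommRingCat.{u}} (s : X ⟶ Spec R) :
    (Functor.const X.Opensᵒᵖ).obj R ⟶ X.presheaf where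
  app U := (Scheme.ΓSpecIso R).inv ≫ s.appTop ≫ X.presheaf.map (homOfLE (le_top)).op
  naturality U V i := by
    simp [← Functor.map_comp]
    rfl

/-- The presheaf `U ↦ Ω_{Γ(X, U)/R}`. -/
noncomputable def differentials {R : CommRingCat.{u}} (s : X ⟶ Spec R) : X.PresheafOfModules :=
  PresheafOfModules.DifferentialsConstruction.relativeDifferentials' (structureMap s)

/-- The canonical sheaf `⋀²Ω_{S/R}` of a surface `S`, the sheafification of `U ↦ ⋀²Ω_{Γ(S, U)/R}`. -/
noncomputable def canonicalSheaf {R : CommRingCat.{u}} (s : X ⟶ Spec R) : X.Modules :=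
  (shf X).obj (exteriorPowerPresheaf (differentials s) 2)

end AlgebraicGeometry.Scheme.Modules
namespace AlgebraicGeometry.Scheme.Modules
variable {X Y : Scheme.{u}}

section Bilinear

variable {M N Q M' N' : X.Modules}

/-- The universal bilinear map `(m, n) ↦ m ⊗ n`. -/
noncomputable def tmulBilin (M N : X.Modules) : Bilin M N (tensor M N) where
  app U := LinearMap.mk₂ _ tmul add_tmul smul_tmul tmul_add tmul_smul
  naturality h m n := (res_tmul h m n).symm

noncomputable def Bilin.flip (b : Bilin M N Q) : Bilin N M Q where
  app U := (b.app U).flip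
  naturality h n m := b.naturality h m n

noncomputable def Bilin.pre (b : Bilin M N Q) (f : M' ⟶ M) (g : N' ⟶ N) : Bilin M' N' Q where
  app U := (b.app U).compl₁₂ (appLin f U) (appLin g U)
  naturality h m n := by simp [appLin_res, b.naturality]

/-- `f ⊗ g`. -/
noncomputable def tensorMap (f : M' ⟶ M) (g : N' ⟶ N) : tensor M' N' ⟶ tensor M N :=
  tensorLift ((tmulBilin M N).pre f g)

/-- The symmetry `M ⊗ N ⟶ N ⊗ M`. -/
noncomputable def tensorSwap (M N : X.Modules) : tensor M N ⟶ tensor N M :=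
  tensorLift (tmulBilin N M).flip

/-- Multiplication by a global section `τ` of `K`: the morphism `m ↦ m ⊗ τ`. -/
noncomputable def mulSection {K : X.Modules} (M : X.Modules) (τ : Γ(K, ⊤)) : M ⟶ tensor M K :=
  homOfLin (fun U => ((tmulBilin M K).app U).flip (res K le_top τ)) (fun U V h m => by
    have := (tmulBilin M K).naturality h m (res K le_top τ)
    rw [res_res] at this
    exact this)

/-- `M ⊗ N ⟶ Hom(M^*, N)`, `m ⊗ n ↦ (l ↦ l(m) n)`. -/
noncomputable def contractLeft (M N : X.Modules) : tensor M N ⟶ sheafHom (dual M) N :=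
  contract (dualPairing M) N

/-- `M^* ⊗ N ⟶ Hom(M, N)`, `l ⊗ n ↦ (m ↦ l(m) n)`. -/
noncomputable def contractDual (M N : X.Modules) : tensor (dual M) N ⟶ sheafHom M N :=
  contract (dualPairing M).flip N

/-- `M ⊗ N ⟶ Hom(N^*, M)`, `m ⊗ n ↦ (l ↦ l(n) m)`. -/
noncomputable def contractRight (M N : X.Modules) : tensor M N ⟶ sheafHom (dual N) M :=
  tensorSwap M N ≫ contractLeft N M

/-- The morphism `M ⊗ K^* ⟶ N` given by a morphism `ψ : M ⟶ N ⊗ K`. -/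
noncomputable def untwist {K : X.Modules} (ψ : M ⟶ tensor N K) : tensor M (dual K) ⟶ N :=
  tensorLift ((evalBilin (dual K) N).pre (ψ ≫ contractRight N K) (𝟙 (dual K)))

/-- `ψ : E^* ⟶ E^* ⊗ K` is the transpose of `φ : E ⟶ E ⊗ K`: the sections `(ψ l)(e)` and `l(φ e)`
of `K` agree for all local sections `l` of `E^*` and `e` of `E`. -/
def IsTranspose {E K : X.Modules} (φ : E ⟶ tensor E K) (ψ : dual E ⟶ tensor (dual E) K) : Prop :=
  ∀ (U : X.Opens) (l : Γ(dual E, U)) (e : Γ(E, U)),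
    evalAt (appLin (ψ ≫ contractDual E K) U l) e = evalAt (appLin (φ ≫ contractLeft E K) U e) l

/-- The transpose `φ^* : E^* ⟶ E^* ⊗ K` of `φ : E ⟶ E ⊗ K`. -/
noncomputable def transpose {E K : X.Modules} (φ : E ⟶ tensor E K) : dual E ⟶ tensor (dual E) K :=
  Classical.epsilon (IsTranspose φ)

end Bilinear

section Functoriality

variable (f : X ⟶ Y)

noncomputable def Bilin.pushforward {M N Q : X.Modules} (b : Bilin M N Q) :
    Bilin ((Modules.pushforward f).obj M) ((Modules.pushforward f).obj N)
      ((Modules.pushforward f).obj Q) where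
  app U := LinearMap.mk₂ _ (fun m n => (show Γ(Q, f ⁻¹ᵁ U) from
      b.app (f ⁻¹ᵁ U) (show Γ(M, f ⁻¹ᵁ U) from m) (show Γ(N, f ⁻¹ᵁ U) from n)))
    (fun m m' n => (b.app (f ⁻¹ᵁ U)).map_add₂ m m' n)
    (fun r m n => (b.app (f ⁻¹ᵁ U)).map_smul₂ ((f.app U).hom r) m n)
    (fun m n n' => (b.app (f ⁻¹ᵁ U) m).map_add n n')
    (fun r m n => (b.app (f ⁻¹ᵁ U) m).map_smul ((f.app U).hom r) n)
  naturality {U V} h m n :=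
    b.naturality ((Opens.map f.base).map (homOfLE h)).le _ _

/-- `m ↦ f^* m`, as a morphism `M ⟶ f_* f^* M`. -/
noncomputable def pullbackUnit (M : Y.Modules) : M ⟶ (pushforward f).obj ((pullback f).obj M) :=
  (pullbackPushforwardAdjunction f).unit.app M

/-- The pulled back section `f^* m`. -/
noncomputable def pullbackSection {M : Y.Modules} {U : Y.Opens} (m : Γ(M, U)) :
    Γ((pullback f).obj M, f ⁻¹ᵁ U) :=
  (pullbackUnit f M).app U m

/-- The canonical morphism `f^*(M ⊗ N) ⟶ f^* M ⊗ f^* N`. -/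
noncomputable def pullbackTensor (M N : Y.Modules) :
    (pullback f).obj (tensor M N) ⟶ tensor ((pullback f).obj M) ((pullback f).obj N) :=
  ((pullbackPushforwardAdjunction f).homEquiv _ _).symm
    (tensorLift (((tmulBilin ((pullback f).obj M) ((pullback f).obj N)).pushforward f).pre
      (pullbackUnit f M) (pullbackUnit f N)))

/-- The canonical morphism `f_* F ⊗ K ⟶ f_*(F ⊗ f^* K)`. -/
noncomputable def projectionMap (F : X.Modules) (K : Y.Modules) :
    tensor ((pushforward f).obj F) K ⟶ (pushforward f).obj (tensor F ((pullback f).obj K)) :=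
  tensorLift (((tmulBilin F ((pullback f).obj K)).pushforward f).pre (𝟙 _) (pullbackUnit f K))

end Functoriality
end AlgebraicGeometry.Scheme.Modules
namespace AlgebraicGeometry.Scheme.Modules
variable {B X Y : Scheme.{u}}

/-- `E` is a vector bundle: locally it has a finite frame, that is, `E` is locally free of finite
rank. -/
def IsVectorBundle (E : B.Modules) : Prop :=
  ∀ x : B, ∃ (U : B.Opens) (_ : x ∈ U) (n : ℕ) (e : Fin n → Γ(E, U)),
    ∀ (V : B.Opens) (h : V ≤ U),
      Function.Bijective (fun c : Fin n → Γ(B, V) => ∑ i, c i • res E h (e i))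

/-- The section `e` of `K` over `U` is a frame of `K|_U`. -/
def IsFrame {K : B.Modules} {U : B.Opens} (e : Γ(K, U)) : Prop :=
  ∀ (V : B.Opens) (h : V ≤ U), Function.Bijective (fun c : Γ(B, V) => c • res K h e)

/-- The total space of the line bundle `K` on `B`: an affine morphism `π : X ⟶ B` with a
tautological section `τ` of `π^* K` such that, over each affine open `U` of `B` with a frame `e`
of `K|_U`, one has `τ = t e` for a fibre coordinate `t`, with `Γ(B, U)[t] = Γ(X, π⁻¹ U)`. -/
structure TotalSpace (K : B.Modules) where
  X : Scheme.{u}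
  π : X ⟶ B
  τ : Γ((pullback π).obj K, ⊤)
  isAffineHom : IsAffineHom π
  chart (U : B.Opens) (_ : IsAffineOpen U) (e : Γ(K, U)) (_ : IsFrame e) :
    ∃ t : Γ(X, π ⁻¹ᵁ U), res _ le_top τ = t • pullbackSection π e ∧
      Function.Bijective (Polynomial.eval₂ (π.app U).hom t)

/-- For `g ≫ π = π'`, the pullback along `g` of a section of `π^* K`, as a section of `π'^* K`. -/
noncomputable def pullbackGlobal {K : B.Modules} {π : X ⟶ B} {π' : Y ⟶ B} (g : Y ⟶ X)
    (w : g ≫ π = π') (τ : Γ((pullback π).obj K, ⊤)) : Γ((pullback π').obj K, ⊤) :=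
  ((pullbackComp g π).app K ≪≫ (pullbackCongr w).app K).hom.app ⊤ (pullbackSection g τ)

/-- `σ` is `-1` on the fibres of the total space: `(s, t) ↦ (s, -t)`. -/
structure TotalSpace.IsNegation {K : B.Modules} (V : TotalSpace K) (σ : V.X ⟶ V.X) : Prop where
  comp_π : σ ≫ V.π = V.π
  pullback_τ : pullbackGlobal σ comp_π V.τ = - V.τ

/-- A Higgs pair `(E, φ)` with values in `K`. -/
structure HiggsPair (K : B.Modules) where
  E : B.Modules
  φ : E ⟶ tensor E K

namespace HiggsPair
variable {K : B.Modules}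

/-- `P` and `Q` are isomorphic. -/
def IsIsomorphic (P Q : HiggsPair K) : Prop :=
  ∃ β : P.E ≅ Q.E, P.φ ≫ tensorMap β.hom (𝟙 K) = β.hom ≫ Q.φ

/-- `(E^*, -φ^*)`. -/
noncomputable def dual (P : HiggsPair K) : HiggsPair K :=
  ⟨Modules.dual P.E, -transpose P.φ⟩

/-- The pullback of a Higgs pair along `g`, as a Higgs pair for `K' ≅ g^* K`. -/
noncomputable def baseChange {B' : Scheme.{u}} (g : B' ⟶ B) {K' : B'.Modules}
    (κ : (pullback g).obj K ≅ K') (P : HiggsPair K) : HiggsPair K' :=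
  ⟨(pullback g).obj P.E,
    (pullback g).map P.φ ≫ pullbackTensor g P.E K ≫ tensorMap (𝟙 _) κ.hom⟩

variable (π : X ⟶ B) (τ : Γ((pullback π).obj K, ⊤))

/-- `π^*φ - τ : π^* E ⟶ π^* E ⊗ π^* K`. -/
noncomputable def charMap (P : HiggsPair K) :
    (pullback π).obj P.E ⟶ tensor ((pullback π).obj P.E) ((pullback π).obj K) :=
  (pullback π).map P.φ ≫ pullbackTensor π P.E K - mulSection ((pullback π).obj P.E) τ

/-- The spectral sheaf of `(E, φ)`, the cokernel of `π^*φ - τ : π^* E ⊗ (π^* K)^* ⟶ π^* E`. -/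
noncomputable def spectralSheaf (P : HiggsPair K) : X.Modules :=
  cokernel (untwist (P.charMap π τ))

/-- `(E, φ)` is isomorphic to `(π_* F, π_* (τ · id))`. -/
def IsDirectImage (P : HiggsPair K) (F : X.Modules) : Prop :=
  ∃ β : P.E ≅ (pushforward π).obj F,
    P.φ ≫ tensorMap β.hom (𝟙 K) ≫ projectionMap π F K =
      β.hom ≫ (pushforward π).map (mulSection F τ)

end HiggsPair

/-- `F ↦ Ext¹(σ^* F, (π^* K)^*)`. -/
noncomputable def spectralDual (K : B.Modules) (π : X ⟶ B) (σ : X ⟶ X) (F : X.Modules) :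
    X.Modules :=
  sheafExt 1 ((pullback σ).obj F) (dual ((pullback π).obj K))

section Families

variable {C S T T' : Scheme.{u}} (s : S ⟶ C) (t : T ⟶ C) (t' : T' ⟶ C)

/-- `S ×_C T`. -/
noncomputable abbrev prod : Scheme.{u} := Limits.pullback s t

/-- `id × c : S ×_C T' ⟶ S ×_C T`. -/
noncomputable def idProd {t t'} (c : T' ⟶ T) (w : c ≫ t = t') : prod s t' ⟶ prod s t :=
  Limits.pullback.lift (Limits.pullback.fst s t') (Limits.pullback.snd s t' ≫ c)
    (by rw [Category.assoc, w, Limits.pullback.condition])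

/-- `K ⊠ O` on `S ×_C T`. -/
noncomputable def prodK (K : S.Modules) : (prod s t).Modules :=
  (pullback (Limits.pullback.fst s t)).obj K

/-- The pullback of `K ⊠ O` along `id × c`. -/
noncomputable def prodKIso (K : S.Modules) {t t'} (c : T' ⟶ T) (w : c ≫ t = t') :
    (pullback (idProd s c w)).obj (prodK s t K) ≅ prodK s t' K :=
  (pullbackComp (idProd s c w) (Limits.pullback.fst s t)).app K ≪≫
    (pullbackCongr (Limits.pullback.lift_fst _ _ _)).app K

variable {s} {K : S.Modules} (V : TotalSpace K)

namespace TotalSpace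

/-- `π × id : X ×_C T ⟶ S ×_C T`. -/
noncomputable def prodπ : prod (V.π ≫ s) t ⟶ prod s t :=
  Limits.pullback.lift (Limits.pullback.fst _ _ ≫ V.π) (Limits.pullback.snd _ _)
    (by rw [Category.assoc, Limits.pullback.condition])

/-- The tautological section on `X ×_C T`. -/
noncomputable def prodτ : Γ((pullback (V.prodπ (s := s) t)).obj (prodK s t K), ⊤) :=
  ((pullbackComp (V.prodπ t) (Limits.pullback.fst s t)).app K).inv.app ⊤
    (pullbackGlobal (Limits.pullback.fst (V.π ≫ s) t)
      (Limits.pullback.lift_fst _ _ _).symm V.τ)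

/-- `σ × id : X ×_C T ⟶ X ×_C T`. -/
noncomputable def prodσ {V : TotalSpace K} {σ : V.X ⟶ V.X} (hσ : V.IsNegation σ) :
    prod (V.π ≫ s) t ⟶ prod (V.π ≫ s) t :=
  Limits.pullback.lift (Limits.pullback.fst _ _ ≫ σ) (Limits.pullback.snd _ _)
    (by rw [Category.assoc, reassoc_of% hσ.comp_π, Limits.pullback.condition])

end TotalSpace
end Families
section Moduli
variable {C S : Scheme.{u}} (s : S ⟶ C) (K : S.Modules)

/-- A moduli problem of Higgs bundles on `S`: a class of families of Higgs bundles over `C`-schemes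
locally of finite type that is closed under isomorphism and base change. -/
structure ModuliProblem where
  mem {T : Scheme.{u}} (t : T ⟶ C) [LocallyOfFiniteType t] : HiggsPair (prodK s t K) → Prop
  isVectorBundle {T : Scheme.{u}} (t : T ⟶ C) [LocallyOfFiniteType t]
    (P : HiggsPair (prodK s t K)) : mem t P → IsVectorBundle P.E
  of_iso {T : Scheme.{u}} (t : T ⟶ C) [LocallyOfFiniteType t] (P Q : HiggsPair (prodK s t K)) :
    P.IsIsomorphic Q → mem t P → mem t Q
  baseChange {T T' : Scheme.{u}} (t : T ⟶ C) [LocallyOfFiniteType t] (t' : T' ⟶ C)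
    [LocallyOfFiniteType t'] (c : T' ⟶ T) (w : c ≫ t = t') (P : HiggsPair (prodK s t K)) :
    mem t P → mem t' (P.baseChange (idProd s c w) (prodKIso s K c w))

variable {s K}

/-- A natural transformation from the moduli functor to `Hom_C(-, N)`: it attaches to each family
over `T` a classifying map `T ⟶ N`. -/
structure Classifier (𝓜 : ModuliProblem s K) {N : Scheme.{u}} (n : N ⟶ C) where
  map {T : Scheme.{u}} (t : T ⟶ C) [LocallyOfFiniteType t] (P : HiggsPair (prodK s t K))
    (_ : 𝓜.mem t P) : T ⟶ N
  map_comp {T : Scheme.{u}} (t : T ⟶ C) [LocallyOfFiniteType t] (P : HiggsPair (prodK s t K))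
    (h : 𝓜.mem t P) : map t P h ≫ n = t
  map_iso {T : Scheme.{u}} (t : T ⟶ C) [LocallyOfFiniteType t] (P Q : HiggsPair (prodK s t K))
    (h : 𝓜.mem t P) (h' : 𝓜.mem t Q) : P.IsIsomorphic Q → map t P h = map t Q h'
  map_baseChange {T T' : Scheme.{u}} (t : T ⟶ C) [LocallyOfFiniteType t] (t' : T' ⟶ C)
    [LocallyOfFiniteType t'] (c : T' ⟶ T) (w : c ≫ t = t') (P : HiggsPair (prodK s t K))
    (h : 𝓜.mem t P) : map t' _ (𝓜.baseChange t t' c w P h) = c ≫ map t P h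

namespace Classifier

variable {𝓜 : ModuliProblem s K} {N : Scheme.{u}} {n : N ⟶ C} (c : Classifier 𝓜 n)

/-- `N` is a moduli space: it corepresents the moduli functor, so that every natural transformation
from the moduli functor to some `Hom_C(-, N')` factors uniquely through a `C`-morphism `N ⟶ N'`. -/
def IsModuliSpace : Prop :=
  LocallyOfFiniteType n ∧ ∀ (N' : Scheme.{u}) (n' : N' ⟶ C) (_ : LocallyOfFiniteType n')
    (c' : Classifier 𝓜 n'), ∃! f : N ⟶ N', f ≫ n' = n ∧
      ∀ (T : Scheme.{u}) (t : T ⟶ C) (_ : LocallyOfFiniteType t) (P : HiggsPair (prodK s t K))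
        (h : 𝓜.mem t P), c'.map t P h = c.map t P h ≫ f

/-- `P` is a family in the moduli problem, with classifying map `m`. -/
def ClassifiesHiggs {T : Scheme.{u}} (t : T ⟶ C) [LocallyOfFiniteType t]
    (P : HiggsPair (prodK s t K)) (m : T ⟶ N) : Prop :=
  ∃ h : 𝓜.mem t P, c.map t P h = m

/-- `F` is a family of spectral sheaves of the moduli problem, with classifying map `m`. -/
def ClassifiesSpectral (V : TotalSpace K) {T : Scheme.{u}} (t : T ⟶ C) [LocallyOfFiniteType t]
    (F : (prod (V.π ≫ s) t).Modules) (m : T ⟶ N) : Prop :=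
  ∃ (P : HiggsPair (prodK s t K)) (h : 𝓜.mem t P),
    Nonempty (F ≅ P.spectralSheaf (V.prodπ t) (V.prodτ t)) ∧ c.map t P h = m

/-- `ι` is the involution of `N` given on families of Higgs bundles by `(E, φ) ↦ (E^*, -φ^*)`. -/
def IsHiggsInvolution (ι : N ⟶ N) : Prop :=
  ι ≫ n = n ∧ ∀ (T : Scheme.{u}) (t : T ⟶ C) (_ : LocallyOfFiniteType t)
    (P : HiggsPair (prodK s t K)) (m : T ⟶ N),
    c.ClassifiesHiggs t P m → c.ClassifiesHiggs t P.dual (m ≫ ι)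

/-- `ι` is the involution of `N` given on families of spectral sheaves by
`F ↦ Ext¹((σ × id)^* F, (π^* K)^*)`. -/
def IsSpectralInvolution {V : TotalSpace K} {σ : V.X ⟶ V.X} (hσ : V.IsNegation σ)
    (ι : N ⟶ N) : Prop :=
  ι ≫ n = n ∧ ∀ (T : Scheme.{u}) (t : T ⟶ C) (_ : LocallyOfFiniteType t)
    (F : (prod (V.π ≫ s) t).Modules) (m : T ⟶ N),
    c.ClassifiesSpectral V t F m → c.ClassifiesSpectral V t
      (spectralDual (prodK s t K) (V.prodπ t) (TotalSpace.prodσ t hσ) F) (m ≫ ι)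

end Classifier
end Moduli
end AlgebraicGeometry.Scheme.Modules

/-! Everything reduces to linear algebra over small affine opens `U` of the base. With a frame `k`
of `K` and a frame of `E` over `U`, the Higgs field is `Φ ⊗ k` for a matrix `Φ` over `R = Γ(B, U)`,
the functions on `π⁻¹U` form `R[t]` with `τ = t k`, and the characteristic morphism `π^*φ - τ` is
the matrix `Φ - t` on `R[t]ⁿ`. Three facts are used. The matrix is injective, because the adjugate
turns it, up to sign, into multiplication by the characteristic polynomial, which is monic in `t`.
Every vector is a constant vector plus an element of the image, because `t` can be traded for `Φ`. A
nonzero constant vector is never in the image, because the evaluation `R[t]ⁿ → Rⁿ` with `t` acting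
as `Φ` fixes constants and kills the image. So the characteristic morphism is a length one
resolution of the spectral sheaf, and the direct image of the spectral sheaf is `(E, φ)`
(`HasSpectralCharts.isDirectImage_spectralSheaf`).

Since `σ^*t = -t`, the relation `t = Φ` turns into `t = -Φ`, and `σ^*` of the spectral sheaf is
resolved by the characteristic morphism of `(E, -φ)` (`exists_shortExact`). Put `L = (π^*K)^*`. As
`Ext¹(π^*E, L) = 0`, the sheaf `Ext¹(σ^*E_φ, L)` is the cokernel of `Hom(π^*E, L) → Hom(π^*E ⊗ L,
L)` (`nonempty_sheafExt_one_iso`). Contraction identifies the two terms with `π^*E^* ⊗ L` and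
`π^*E^*`, and the arrow with the characteristic morphism of `(E^*, -φ^*)` (`charHom_dual_comp`),
whose cokernel is the spectral sheaf of the dual pair. The statement on direct images is then the
spectral correspondence for the dual pair.

The argument only needs a basis of charts on which `σ` negates `t`. Such charts exist on the total
space of any line bundle, in particular of the canonical sheaf (`isLineBundle_canonicalSheaf`), and
they survive base change to `S × T` because `R[t] ⊗ R' = R'[t]` (`SpectralChart.baseChange`). This
gives families as well.

For moduli spaces, a Higgs bundle is recovered from its spectral sheaf as a direct image, so the two
descriptions of the involution agree on isomorphism classes of families; uniqueness of the
involution is corepresentability. -/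

namespace AlgebraicGeometry.Scheme.Modules

/-! ### Local-to-global principles for sheaves of modules. -/

section Sheaves
variable {X : Scheme.{u}} {M N : X.Modules}

/-- A family of opens is a basis: every neighbourhood of a point contains a member through it. -/
def IsNhdBasis (P : X.Opens → Prop) : Prop :=
  ∀ (U : X.Opens) (p : X), p ∈ U → ∃ V : X.Opens, P V ∧ p ∈ V ∧ V ≤ U

lemma eq_of_locally_eq {U : X.Opens} (x y : Γ(M, U))
    (h : ∀ p ∈ U, ∃ (V : X.Opens) (hV : V ≤ U), p ∈ V ∧ res M hV x = res M hV y) : x = y := by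
  choose V hV hp h using h
  obtain ⟨z, _, hz⟩ := existsUnique_glue M (fun p : U => V p.1 p.2) U (fun p => hV p.1 p.2)
    (fun p hpU => Opens.mem_iSup.mpr ⟨⟨p, hpU⟩, hp p hpU⟩) (fun p => res M (hV p.1 p.2) x)
    (fun i j => by rw [res_res, res_res])
  exact (hz x fun _ => rfl).trans (hz y fun i => (h i.1 i.2).symm).symm

/-- Gluing by characterisation: the uniqueness `hS` forces local solutions of `S` to agree on
overlaps, so only local existence remains to be checked. -/
lemma exists_glue {U : X.Opens} (S : ∀ V : X.Opens, V ≤ U → Γ(M, V) → Prop)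
    (hS : ∀ V hV (x y : Γ(M, V)), S V hV x → S V hV y → x = y)
    (hres : ∀ V W (hV : V ≤ U) (hW : W ≤ V) x, S V hV x → S W (hW.trans hV) (res M hW x))
    (hloc : ∀ p ∈ U, ∃ (V : X.Opens) (hV : V ≤ U) (x : Γ(M, V)), p ∈ V ∧ S V hV x) :
    ∃ x : Γ(M, U), ∀ p ∈ U, ∃ (V : X.Opens) (hV : V ≤ U), p ∈ V ∧ S V hV (res M hV x) := by
  choose V hV y hp h using hloc
  obtain ⟨z, hz, _⟩ := existsUnique_glue M (fun p : U => V p.1 p.2) U (fun p => hV p.1 p.2)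
    (fun p hpU => Opens.mem_iSup.mpr ⟨⟨p, hpU⟩, hp p hpU⟩) (fun p => y p.1 p.2)
    (fun i j => hS _ (inf_le_left.trans (hV _ _)) _ _ (hres _ _ _ _ _ (h _ _)) (hres _ _ _ _ _ (h _ _)))
  refine ⟨z, fun p hpU => ⟨V p hpU, hV p hpU, hp p hpU, ?_⟩⟩
  rw [hz ⟨p, hpU⟩]
  exact h p hpU

lemma res_zero {U V : X.Opens} (h : V ≤ U) : res M h 0 = 0 := map_zero _

lemma hom_ext_basis {P : X.Opens → Prop} (hP : IsNhdBasis P) {f g : M ⟶ N}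
    (h : ∀ U, P U → appLin f U = appLin g U) : f = g := by
  refine hom_ext_lin fun U => LinearMap.ext fun m => eq_of_locally_eq _ _ fun p hp => ?_
  obtain ⟨V, hV, hpV, hVU⟩ := hP U p hp
  exact ⟨V, hVU, hpV, by rw [← appLin_res, ← appLin_res, h V hV]⟩

lemma injective_of_basis {P : X.Opens → Prop} (hP : IsNhdBasis P) (f : M ⟶ N)
    (h : ∀ U, P U → Function.Injective (appLin f U)) (U : X.Opens) :
    Function.Injective (appLin f U) := by
  intro x y hxy
  refine eq_of_locally_eq _ _ fun p hp => ?_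
  obtain ⟨V, hV, hpV, hVU⟩ := hP U p hp
  exact ⟨V, hVU, hpV, h V hV (by rw [appLin_res, appLin_res, hxy])⟩

/-- `f` is locally surjective on sections. -/
def LocSurj (f : M ⟶ N) : Prop :=
  ∀ (U : X.Opens) (y : Γ(N, U)), ∀ p ∈ U, ∃ (V : X.Opens) (hV : V ≤ U) (x : Γ(M, V)), p ∈ V ∧
    appLin f V x = res N hV y

/-- Injectivity makes local preimages unique, hence compatible, so they glue. -/
lemma surjective_of_injective_of_locSurj (f : M ⟶ N)
    (hi : ∀ U, Function.Injective (appLin f U)) (hs : LocSurj f) (U : X.Opens) :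
    Function.Surjective (appLin f U) := by
  intro y
  obtain ⟨x, hx⟩ := exists_glue (M := M) (U := U) (fun V hV x => appLin f V x = res N hV y)
    (fun V hV x y hx hy => hi V (hx.trans hy.symm))
    (fun V W hV hW x hx => by rw [appLin_res, hx, res_res])
    (fun p hp => by
      obtain ⟨V, hV, x, hpV, hx⟩ := hs U y p hp
      exact ⟨V, hV, x, hpV, hx⟩)
  refine ⟨x, eq_of_locally_eq _ _ fun p hp => ?_⟩
  obtain ⟨V, hV, hpV, h⟩ := hx p hp
  exact ⟨V, hV, hpV, by rw [← appLin_res, h]⟩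

lemma isIso_of_bijective (f : M ⟶ N) (h : ∀ U, Function.Bijective (appLin f U)) : IsIso f := by
  rw [Hom.isIso_iff_isIso_app]
  intro U
  rw [ConcreteCategory.isIso_iff_bijective]
  exact h U

lemma locSurj_of_basis {P : X.Opens → Prop} (hP : IsNhdBasis P) (f : M ⟶ N)
    (h : ∀ U, P U → Function.Surjective (appLin f U)) : LocSurj f := by
  intro U y p hp
  obtain ⟨V, hV, hpV, hVU⟩ := hP U p hp
  obtain ⟨x, hx⟩ := h V hV (res N hVU y)
  exact ⟨V, hVU, x, hpV, hx⟩

lemma isIso_of_basis {P : X.Opens → Prop} (hP : IsNhdBasis P) (f : M ⟶ N)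
    (h : ∀ U, P U → Function.Bijective (appLin f U)) : IsIso f := by
  have hi := injective_of_basis hP f fun U hU => (h U hU).1
  exact isIso_of_bijective f fun U => ⟨hi U, surjective_of_injective_of_locSurj f hi
    (locSurj_of_basis hP f fun U hU => (h U hU).2) U⟩

lemma bijective_of_isIso (f : M ⟶ N) [IsIso f] (U : X.Opens) :
    Function.Bijective (appLin f U) :=
  (ConcreteCategory.isIso_iff_bijective (f.app U)).mp inferInstance

lemma mono_of_injective (f : M ⟶ N) (h : ∀ U, Function.Injective (appLin f U)) : Mono f where
  right_cancellation a b hab := hom_ext_lin fun U => LinearMap.ext fun m => h U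
    (LinearMap.congr_fun (congrArg (appLin · U) hab) m)

instance : (toPresheafOfModules X).Additive := inferInstanceAs (SheafOfModules.forget _).Additive

lemma injective_of_mono (f : M ⟶ N) [Mono f] (U : X.Opens) :
    Function.Injective (appLin f U) := by
  have : Mono ((toPresheafOfModules X).map f) := inferInstance
  exact PresheafOfModules.injective_of_mono ((toPresheafOfModules X).map f) (op U)

lemma epi_of_locSurj (f : M ⟶ N) (h : LocSurj f) : Epi f where
  left_cancellation a b hab := hom_ext_lin fun U => LinearMap.ext fun y =>
    eq_of_locally_eq _ _ fun p hp => by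
      obtain ⟨V, hV, x, hpV, hx⟩ := h U y p hp
      refine ⟨V, hV, hpV, ?_⟩
      rw [← appLin_res, ← appLin_res, ← hx]
      exact LinearMap.congr_fun (congrArg (appLin · V) hab) x

/-- Sections are left exact. -/
lemma exists_of_exact_of_mono {S : ShortComplex X.Modules} (hS : S.Exact) [Mono S.f]
    {U : X.Opens} (x : Γ(S.X₂, U)) (hx : appLin S.g U x = 0) : ∃ y, appLin S.f U y = x := by
  let F : X.Modules ⥤ ModuleCat (X.ringCatSheaf.obj.obj (op U)) := 
    toPresheafOfModules X ⋙ PresheafOfModules.evaluation _ (op U)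
  have : F.Additive := inferInstance
  have : PreservesFiniteLimits F := inferInstance
  have h := hS.map_of_mono_of_preservesKernel F inferInstance inferInstance
  rw [ShortComplex.moduleCat_exact_iff] at h
  exact h x hx

end Sheaves
end AlgebraicGeometry.Scheme.Modules

namespace AlgebraicGeometry.Scheme.Modules

/-! ### Sheafification, and epimorphisms as locally surjective maps. -/

section Sheafification
variable {X : Scheme.{u}}

/-- The canonical map from sections of a presheaf of modules to sections of its sheafification. -/
noncomputable def toShf (P : X.PresheafOfModules) (U : X.Opens) :
    secMod P U →ₗ[Γ(X, U)] Γ((shf X).obj P, U) where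
  toFun x := (((shfAdj X).unit.app P).app (op U)).hom x
  map_add' x y := (((shfAdj X).unit.app P).app (op U)).hom.map_add x y
  map_smul' r x := (((shfAdj X).unit.app P).app (op U)).hom.map_smul r x

/-- Restriction of sections of a presheaf of modules. -/
noncomputable def presRes (P : X.PresheafOfModules) {U V : X.Opens} (h : V ≤ U) :
    secMod P U →+ secMod P V :=
  (presheafMap P (homOfLE h).op).toAddMonoidHom

lemma toShf_res (P : X.PresheafOfModules) {U V : X.Opens} (h : V ≤ U) (x : secMod P U) :
    toShf P V (presRes P h x) = res _ h (toShf P U x) :=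
  PresheafOfModules.naturality_apply ((shfAdj X).unit.app P) (homOfLE h).op x

lemma locally_eq_zero_of_toShf_eq_zero (P : X.PresheafOfModules) {U : X.Opens} (x : secMod P U)
    (hx : toShf P U x = 0) : ∀ p ∈ U, ∃ (V : X.Opens) (hV : V ≤ U), p ∈ V ∧ presRes P hV x = 0 := by
  intro p hp
  have := (Presheaf.equalizerSieve_mem (Opens.grothendieckTopology X)
    (CategoryTheory.toSheafify (Opens.grothendieckTopology X) P.presheaf) (X := op U) x 0 (by
      refine Eq.trans hx ?_
      exact (map_zero _).symm)) p hp
  obtain ⟨V, i, hi, hpV⟩ := this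
  refine ⟨V, leOfHom i, hpV, ?_⟩
  have h2 : P.presheaf.map i.op x = P.presheaf.map i.op 0 := hi
  rw [map_zero] at h2
  exact h2

lemma locally_exists_toShf_eq (P : X.PresheafOfModules) {U : X.Opens} (y : Γ((shf X).obj P, U)) :
    ∀ p ∈ U, ∃ (V : X.Opens) (hV : V ≤ U) (x : secMod P V), p ∈ V ∧ toShf P V x = res _ hV y := by
  intro p hp
  obtain ⟨V, i, ⟨x, hx⟩, hpV⟩ := (Presheaf.imageSieve_mem (Opens.grothendieckTopology X)
    (CategoryTheory.toSheafify (Opens.grothendieckTopology X) P.presheaf) (U := op U) y) p hp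
  exact ⟨V, leOfHom i, x, hpV, hx⟩

/-- The map from `N` to the sheafified presheaf cokernel of `f` kills `f`, so it vanishes. A section
of `N` therefore dies locally in the presheaf cokernel, which means that it lifts locally. -/
lemma locSurj_of_epi {M N : X.Modules} (f : M ⟶ N) [Epi f] : LocSurj f := by
  intro U y p hp
  let q : (toPresheafOfModules X).obj N ⟶ cokernel ((toPresheafOfModules X).map f) :=
    cokernel.π ((toPresheafOfModules X).map f)
  let g : N ⟶ (shf X).obj (cokernel ((toPresheafOfModules X).map f)) :=
    (fullyFaithfulToPresheafOfModules (X := X)).preimage (q ≫ (shfAdj X).unit.app _)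
  have hg : (toPresheafOfModules X).map g = q ≫ (shfAdj X).unit.app _ :=
    (fullyFaithfulToPresheafOfModules (X := X)).map_preimage _
  have hfg : f ≫ g = 0 := by
    apply (toPresheafOfModules X).map_injective
    rw [Functor.map_comp, hg, cokernel.condition_assoc, zero_comp, Functor.map_zero]
  have hg0 : g = 0 := (cancel_epi f).mp (by rw [hfg, comp_zero])
  have hy : toShf _ U ((q.app (op U)).hom y) = 0 := by
    have : appLin g U y = 0 := by rw [hg0]; rfl
    rw [← this]
    exact (congrArg (fun k => (PresheafOfModules.Hom.app k (op U)).hom y) hg).symm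
  obtain ⟨V, hV, hpV, h⟩ := locally_eq_zero_of_toShf_eq_zero _ _ hy p hp
  have h2 : (q.app (op V)).hom (res N hV y) = 0 := by
    rw [← h]
    exact PresheafOfModules.naturality_apply q (homOfLE hV).op y
  let S : ShortComplex X.PresheafOfModules := ShortComplex.mk _ q (cokernel.condition _)
  have hS : S.Exact := ShortComplex.exact_cokernel _
  have h3 := hS.map (PresheafOfModules.evaluation _ (op V))
  rw [ShortComplex.moduleCat_exact_iff] at h3
  obtain ⟨x, hx⟩ := h3 (res N hV y) h2
  exact ⟨V, hV, x, hpV, hx⟩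

end Sheafification

/-! ### Exactness tested on sections up to refinement. -/

section Exactness
variable {X : Scheme.{u}}

/-- A complex that is exact on sections up to refinement is exact. -/
lemma exact_of_locally {S : ShortComplex X.Modules}
    (h : ∀ (U : X.Opens) (x : Γ(S.X₂, U)), appLin S.g U x = 0 → ∀ p ∈ U,
      ∃ (V : X.Opens) (hV : V ≤ U) (y : Γ(S.X₁, V)), p ∈ V ∧ appLin S.f V y = res S.X₂ hV x) :
    S.Exact := by
  rw [ShortComplex.exact_iff_epi_kernel_lift]
  apply epi_of_locSurj
  intro U x p hp
  obtain ⟨V, hV, y, hpV, hy⟩ := h U (appLin (kernel.ι S.g) U x) (by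
    change appLin (kernel.ι S.g ≫ S.g) U x = 0
    rw [kernel.condition]; rfl) p hp
  refine ⟨V, hV, y, hpV, injective_of_mono (kernel.ι S.g) V ?_⟩
  rw [appLin_res, ← hy, ← LinearMap.comp_apply, ← appLin_comp, kernel.lift_ι]

/-- `S.f` factors as an epimorphism onto the kernel of `S.g`, which lifts sections locally, followed
by the inclusion; sections of the kernel are the sections killed by `S.g`. -/
lemma locally_of_exact {S : ShortComplex X.Modules} (hS : S.Exact) (U : X.Opens) (x : Γ(S.X₂, U))
    (hx : appLin S.g U x = 0) : ∀ p ∈ U,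
      ∃ (V : X.Opens) (hV : V ≤ U) (y : Γ(S.X₁, V)), p ∈ V ∧ appLin S.f V y = res S.X₂ hV x := by
  intro p hp
  have := (ShortComplex.exact_iff_epi_kernel_lift _).mp hS
  obtain ⟨k, hk⟩ := exists_of_exact_of_mono
    (S := ShortComplex.mk (kernel.ι S.g) S.g (kernel.condition _))
    (ShortComplex.exact_kernel _) x hx
  obtain ⟨V, hV, y, hpV, hy⟩ := locSurj_of_epi (kernel.lift S.g S.f S.zero) U k p hp
  refine ⟨V, hV, y, hpV, ?_⟩
  rw [← hk, ← appLin_res, ← hy, ← LinearMap.comp_apply, ← appLin_comp, kernel.lift_ι]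

end Exactness

/-! ### Local homomorphisms as global morphisms to a corestriction. -/

section Corestriction
variable {X : Scheme.{u}}

/-- The abelian presheaf `W ↦ N(W ⊓ U)`. -/
noncomputable def corestrictAb (N : X.Modules) (U : X.Opens) : TopCat.Presheaf Ab.{u} X where
  obj W := Γ(N, W.unop ⊓ U)
  map i := N.presheaf.map (homOfLE (inf_le_inf_right U (leOfHom i.unop))).op
  map_id _ := N.presheaf.map_id _
  map_comp _ _ := N.presheaf.map_comp _ _

/-- The presheaf of modules `W ↦ N(W ⊓ U)`. -/
noncomputable def corestrictPresheaf (N : X.Modules) (U : X.Opens) : X.PresheafOfModules :=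
  letI (W : X.Opensᵒᵖ) : Module (X.ringCatSheaf.obj.obj W) ((corestrictAb N U).obj W) :=
    Module.compHom Γ(N, W.unop ⊓ U) (resO X (inf_le_left : W.unop ⊓ U ≤ W.unop))
  PresheafOfModules.ofPresheaf (corestrictAb N U) (fun {W W'} i r x => by
    change res N (inf_le_inf_right U (leOfHom i.unop)) (resO X (inf_le_left : W.unop ⊓ U ≤ _) r • (show Γ(N, W.unop ⊓ U) from x)) =
      resO X (inf_le_left : W'.unop ⊓ U ≤ _) (resO X (leOfHom i.unop) r) •
        res N _ (show Γ(N, W.unop ⊓ U) from x)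
    exact (res_smul N _ _ _).trans (congrArg (· • _) ((resO_resO (X := X) _ _ r).trans
      (resO_resO (X := X) (leOfHom i.unop) _ r).symm)))

lemma corestrictAb_isSheaf (N : X.Modules) (U : X.Opens) : (corestrictAb N U).IsSheaf := by
  rw [TopCat.Presheaf.isSheaf_iff_isSheafUniqueGluing]
  intro ι W sf hsf
  refine existsUnique_glue N (fun i => W i ⊓ U) (iSup W ⊓ U)
    (fun i => inf_le_inf_right U (le_iSup W i)) (by rw [iSup_inf_eq]) sf fun i j => ?_
  have h := congrArg (res N (show W i ⊓ U ⊓ (W j ⊓ U) ≤ W i ⊓ W j ⊓ U from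
    le_inf (inf_le_inf inf_le_left inf_le_left) (inf_le_left.trans inf_le_right))) (hsf i j)
  exact ((res_res N _ _ _).symm.trans h).trans (res_res N _ _ _)

/-- The sheaf `W ↦ N(W ⊓ U)`, the direct image of the restriction of `N` to `U`. -/
noncomputable def corestrict (N : X.Modules) (U : X.Opens) : X.Modules where
  val := corestrictPresheaf N U
  isSheaf := corestrictAb_isSheaf N U

/-- Sections of `corestrict N U`. -/
noncomputable def corestrictEquiv (N : X.Modules) (U W : X.Opens) :
    Γ(corestrict N U, W) ≃+ Γ(N, W ⊓ U) := AddEquiv.refl _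

lemma corestrictEquiv_smul (N : X.Modules) (U W : X.Opens) (r : Γ(X, W))
    (x : Γ(corestrict N U, W)) :
    corestrictEquiv N U W (r • x) = resO X (inf_le_left : W ⊓ U ≤ W) r • corestrictEquiv N U W x := rfl

lemma corestrictEquiv_res (N : X.Modules) (U : X.Opens) {W W' : X.Opens} (h : W' ≤ W)
    (x : Γ(corestrict N U, W)) :
    corestrictEquiv N U W' (res _ h x) =
      res N (inf_le_inf_right U h) (corestrictEquiv N U W x) := rfl

variable {M N : X.Modules} {U : X.Opens}

/-- The morphism to `corestrict N U` given by a homomorphism over `U`. -/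
noncomputable def LocalHom.toHom (f : LocalHom M N U) : M ⟶ corestrict N U :=
  homOfLin (M := M) (N := corestrict N U) (fun W =>
    { toFun := fun m => (corestrictEquiv N U W).symm (f.app (W ⊓ U) inf_le_right (res M inf_le_left m))
      map_add' := fun m m' => by simp
      map_smul' := fun r m => by
        apply (corestrictEquiv N U W).injective
        simp [corestrictEquiv_smul, res_smul] })
    (fun W W' h m => by
      apply (corestrictEquiv N U W').injective
      change f.app _ _ _ = res N _ (f.app _ _ _)
      rw [← f.naturality, res_res, res_res])

lemma LocalHom.toHom_apply (f : LocalHom M N U) (W : X.Opens) (m : Γ(M, W)) :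
    corestrictEquiv N U W (appLin f.toHom W m) =
      f.app (W ⊓ U) inf_le_right (res M inf_le_left m) := rfl

/-- The homomorphism over `U` given by a morphism to `corestrict N U`. -/
noncomputable def LocalHom.ofHom (g : M ⟶ corestrict N U) : LocalHom M N U where
  app V hV :=
    { toFun := fun m => res N (le_inf le_rfl hV) (corestrictEquiv N U V (appLin g V m))
      map_add' := fun m m' => by simp
      map_smul' := fun r m => by simp [corestrictEquiv_smul, res_smul] }
  naturality {V W} hV hW m := by
    change res N _ (corestrictEquiv N U W (appLin g W (res M hW m))) =
      res N hW (res N _ (corestrictEquiv N U V (appLin g V m)))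
    rw [appLin_res, corestrictEquiv_res, res_res, res_res]

lemma LocalHom.ofHom_app (g : M ⟶ corestrict N U) (V : X.Opens) (hV : V ≤ U) (m : Γ(M, V)) :
    (LocalHom.ofHom g).app V hV m =
      res N (le_inf le_rfl hV) (corestrictEquiv N U V (appLin g V m)) := rfl

/-- With `LocalHom.toHom_ofHom` this is the adjunction between restriction to `U` and direct image.
It lets universal properties of global morphisms (tensor products, pullbacks, cokernels) be applied
to homomorphisms that exist only over `U`. -/
lemma LocalHom.ofHom_toHom (f : LocalHom M N U) : LocalHom.ofHom f.toHom = f := by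
  ext V hV m
  rw [ofHom_app, toHom_apply, ← f.naturality, res_res, res_self]

lemma LocalHom.toHom_ofHom (g : M ⟶ corestrict N U) : (LocalHom.ofHom g).toHom = g := by
  refine hom_ext_lin fun W => LinearMap.ext fun m => (corestrictEquiv N U W).injective ?_
  rw [toHom_apply, ofHom_app, appLin_res, corestrictEquiv_res, res_res, res_self]

lemma LocalHom.toHom_injective : Function.Injective (LocalHom.toHom (M := M) (N := N) (U := U)) :=
  fun f f' h => by rw [← ofHom_toHom f, h, ofHom_toHom]

/-- Precomposition of local homomorphisms. -/
noncomputable def LocalHom.precomp {M' : X.Modules} (g : M' ⟶ M) (f : LocalHom M N U) :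
    LocalHom M' N U where
  app V hV := f.app V hV ∘ₗ appLin g V
  naturality hV hW m := by
    rw [LinearMap.comp_apply, appLin_res, f.naturality hV hW, LinearMap.comp_apply]

@[simp] lemma LocalHom.precomp_app {M' : X.Modules} (g : M' ⟶ M) (f : LocalHom M N U)
    {V : X.Opens} (hV : V ≤ U) : (f.precomp g).app V hV = f.app V hV ∘ₗ appLin g V := rfl

lemma LocalHom.toHom_precomp {M' : X.Modules} (g : M' ⟶ M) (f : LocalHom M N U) :
    (f.precomp g).toHom = g ≫ f.toHom := by
  refine hom_ext_lin fun W => LinearMap.ext fun m => (corestrictEquiv N U W).injective ?_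
  rw [toHom_apply, appLin_comp, LinearMap.comp_apply, toHom_apply]
  simp [appLin_res]

end Corestriction
end AlgebraicGeometry.Scheme.Modules

namespace AlgebraicGeometry.Scheme.Modules

/-! ### Frames and homomorphisms out of framed modules. -/

section Frames
variable {X : Scheme.{u}} {M N : X.Modules} {U V : X.Opens} {n : ℕ}

/-- The family `e` of sections over `U` is a frame of `M|_U`. -/
def IsFrameFam (e : Fin n → Γ(M, U)) : Prop :=
  ∀ (V : X.Opens) (h : V ≤ U),
    Function.Bijective (fun c : Fin n → Γ(X, V) => ∑ i, c i • res M h (e i))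

lemma IsFrameFam.res {e : Fin n → Γ(M, U)} (he : IsFrameFam e) (h : V ≤ U) :
    IsFrameFam (fun i => res M h (e i)) := by
  intro W hW
  simpa using he W (hW.trans h)

lemma isFrame_iff (k : Γ(M, U)) : IsFrame k ↔ IsFrameFam (fun _ : Fin 1 => k) := by
  refine forall₂_congr fun V h => ?_
  have : (fun c : Fin 1 → Γ(X, V) => ∑ i, c i • Modules.res M h k) =
      (fun c : Γ(X, V) => c • Modules.res M h k) ∘ (Equiv.funUnique (Fin 1) Γ(X, V)) := by
    ext c; simp
  rw [this, Function.Bijective.of_comp_iff _ (Equiv.bijective _)]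

lemma IsFrame.res {k : Γ(M, U)} (hk : IsFrame k) (h : V ≤ U) : IsFrame (res M h k) := by
  rw [isFrame_iff] at hk ⊢
  exact IsFrameFam.res hk h

/-- Coordinates with respect to a frame. -/
noncomputable def IsFrameFam.equiv {e : Fin n → Γ(M, U)} (he : IsFrameFam e) (h : V ≤ U) :
    (Fin n → Γ(X, V)) ≃ₗ[Γ(X, V)] Γ(M, V) :=
  LinearEquiv.ofBijective
    { toFun := fun c => ∑ i, c i • Modules.res M h (e i)
      map_add' := fun c c' => by simp [add_smul, Finset.sum_add_distrib]
      map_smul' := fun r c => by simp [mul_smul, Finset.smul_sum] } (he V h)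

lemma IsFrameFam.equiv_apply {e : Fin n → Γ(M, U)} (he : IsFrameFam e) (h : V ≤ U)
    (c : Fin n → Γ(X, V)) : he.equiv h c = ∑ i, c i • Modules.res M h (e i) := rfl

/-- The homomorphism over `U` with given values at a frame. -/
noncomputable def LocalHom.ofFrame {e : Fin n → Γ(M, U)} (he : IsFrameFam e) (y : Fin n → Γ(N, U)) :
    LocalHom M N U where
  app V h :=
    { toFun := fun m => ∑ i, (he.equiv h).symm m i • res N h (y i)
      map_add' := fun m m' => by simp [add_smul, Finset.sum_add_distrib]
      map_smul' := fun r m => by simp [mul_smul, Finset.smul_sum] }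
  naturality {V W} hV hW m := by
    obtain ⟨c, rfl⟩ := (he.equiv hV).surjective m
    have : res M hW (he.equiv hV c) = he.equiv (hW.trans hV) (fun i => resO X hW (c i)) := by
      simp [IsFrameFam.equiv_apply, res_smul]
    simp [this, res_smul]

lemma LocalHom.ofFrame_app {e : Fin n → Γ(M, U)} (he : IsFrameFam e) (y : Fin n → Γ(N, U))
    (h : V ≤ U) (c : Fin n → Γ(X, V)) :
    (ofFrame he y).app V h (∑ i, c i • res M h (e i)) = ∑ i, c i • res N h (y i) := by
  rw [← he.equiv_apply h]
  simp [ofFrame]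

lemma LocalHom.ofFrame_app_single {e : Fin n → Γ(M, U)} (he : IsFrameFam e) (y : Fin n → Γ(N, U))
    (h : V ≤ U) (i : Fin n) :
    (ofFrame he y).app V h (res M h (e i)) = res N h (y i) := by
  have := ofFrame_app he y h (Pi.single i 1)
  simpa [Pi.single_apply, ite_smul] using this

lemma LocalHom.ext_frame {e : Fin n → Γ(M, U)} (he : IsFrameFam e) {f g : LocalHom M N U}
    (h : ∀ i, f.app U le_rfl (e i) = g.app U le_rfl (e i)) : f = g := by
  ext V hV m
  obtain ⟨c, rfl⟩ := (he.equiv hV).surjective m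
  simp only [IsFrameFam.equiv_apply, map_sum]
  refine Finset.sum_congr rfl fun i _ => ?_
  rw [LinearMap.map_smul, LinearMap.map_smul, f.naturality le_rfl hV, g.naturality le_rfl hV, h]

/-- Evaluation at a frame identifies local homomorphisms with families of sections. -/
lemma LocalHom.bijective_eval {e : Fin n → Γ(M, U)} (he : IsFrameFam e) (h : V ≤ U) :
    Function.Bijective (fun (f : LocalHom M N V) i => f.app V le_rfl (res M h (e i))) := by
  refine ⟨fun f g hfg => ext_frame (he.res h) fun i => congrFun hfg i, fun y =>
    ⟨ofFrame (he.res h) y, funext fun i => ?_⟩⟩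
  have := ofFrame_app_single (he.res h) y le_rfl i
  simpa using this

/-- A morphism restricted to `U`. -/
noncomputable def LocalHom.ofGlobal (f : M ⟶ N) (U : X.Opens) : LocalHom M N U where
  app V _ := appLin f V
  naturality _ hW m := appLin_res f hW m

@[simp] lemma LocalHom.ofGlobal_app (f : M ⟶ N) (hV : V ≤ U) :
    (LocalHom.ofGlobal f U).app V hV = appLin f V := rfl

/-- Composition of local homomorphisms. -/
noncomputable def LocalHom.comp {Q : X.Modules} (g : LocalHom N Q U) (f : LocalHom M N U) :
    LocalHom M Q U where
  app V hV := g.app V hV ∘ₗ f.app V hV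
  naturality hV hW m := by
    rw [LinearMap.comp_apply, f.naturality hV hW, g.naturality hV hW, LinearMap.comp_apply]

@[simp] lemma LocalHom.comp_app {Q : X.Modules} (g : LocalHom N Q U) (f : LocalHom M N U)
    (hV : V ≤ U) (m : Γ(M, V)) : (g.comp f).app V hV m = g.app V hV (f.app V hV m) := rfl

lemma appLin_eq_of_frame {e : Fin n → Γ(M, U)} (he : IsFrameFam e) {f g : M ⟶ N}
    (h : ∀ i, appLin f U (e i) = appLin g U (e i)) (hV : V ≤ U) : appLin f V = appLin g V :=
  congrArg (fun k : LocalHom M N U => k.app V hV)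
    (LocalHom.ext_frame he (f := .ofGlobal f U) (g := .ofGlobal g U) h)

/-- A morphism with invertible action on a frame is an isomorphism over `U`. -/
lemma isFrameFam_of_bijective {e : Fin n → Γ(M, U)} (he : IsFrameFam e) (f : LocalHom M N U)
    (h : ∀ (V : X.Opens) (hV : V ≤ U), Function.Bijective (f.app V hV)) :
    IsFrameFam (fun i => f.app U le_rfl (e i)) := by
  intro V hV
  convert (h V hV).comp (he V hV) using 1
  ext c
  simp only [Function.comp, map_sum]
  refine Finset.sum_congr rfl fun i _ => ?_
  rw [LinearMap.map_smul, f.naturality le_rfl hV]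

lemma bijective_of_isFrameFam {e : Fin n → Γ(M, U)} (he : IsFrameFam e) (f : LocalHom M N U)
    (h : IsFrameFam (fun i => f.app U le_rfl (e i))) (hV : V ≤ U) :
    Function.Bijective (f.app V hV) := by
  rw [← Function.Bijective.of_comp_iff _ (he V hV)]
  convert h V hV using 1
  ext c
  simp only [Function.comp, map_sum]
  refine Finset.sum_congr rfl fun i _ => ?_
  rw [LinearMap.map_smul, f.naturality le_rfl hV]

end Frames

/-! ### Tensor products, and division by a frame of a line bundle. -/

section Tensor
variable {X : Scheme.{u}} {M N K Q : X.Modules} {U V : X.Opens}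

lemma tensor_hom_ext {f g : tensor M N ⟶ Q}
    (h : ∀ (U : X.Opens) (m : Γ(M, U)) (n : Γ(N, U)),
      appLin f U (tmul m n) = appLin g U (tmul m n)) : f = g := by
  apply ((shfAdj X).homEquiv (tensorPresheaf M N) Q).injective
  refine PresheafOfModules.hom_ext fun U => ?_
  refine ModuleCat.MonoidalCategory.tensor_ext (R := Γ(X, U.unop)) ?_
  intro m n
  exact h U.unop m n

lemma LocalHom.tensor_ext {f g : LocalHom (tensor M N) Q U}
    (h : ∀ (V : X.Opens) (hV : V ≤ U) (m : Γ(M, V)) (n : Γ(N, V)),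
      f.app V hV (tmul m n) = g.app V hV (tmul m n)) : f = g := by
  apply toHom_injective
  refine tensor_hom_ext fun W m n => (corestrictEquiv Q U W).injective ?_
  rw [toHom_apply, toHom_apply, res_tmul, h]

/-- Multiplication with a frame. -/
noncomputable def LocalHom.mulRight (M : X.Modules) (k : Γ(K, U)) : LocalHom M (tensor M K) U where
  app _ h := ((tmulBilin M K).app _).flip (res K h k)
  naturality hV hW m := by
    have := (tmulBilin M K).naturality hW m (res K hV k)
    rw [res_res] at this
    exact this

lemma LocalHom.mulRight_app (k : Γ(K, U)) (h : V ≤ U) (m : Γ(M, V)) :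
    (mulRight M k).app V h m = tmul m (res K h k) := rfl

/-- The coefficient with respect to a frame of a line bundle. -/
noncomputable def IsFrame.coef {k : Γ(K, U)} (hk : IsFrame k) (h : V ≤ U) :
    Γ(K, V) ≃ₗ[Γ(X, V)] Γ(X, V) :=
  (LinearEquiv.ofBijective (LinearMap.toSpanSingleton Γ(X, V) Γ(K, V) (Modules.res K h k))
    (hk V h)).symm

lemma IsFrame.coef_smul {k : Γ(K, U)} (hk : IsFrame k) (h : V ≤ U) (c : Γ(X, V)) :
    hk.coef h (c • Modules.res K h k) = c :=
  (LinearEquiv.ofBijective (LinearMap.toSpanSingleton Γ(X, V) Γ(K, V) (Modules.res K h k))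
    (hk V h)).symm_apply_apply c

lemma IsFrame.smul_coef {k : Γ(K, U)} (hk : IsFrame k) (h : V ≤ U) (x : Γ(K, V)) :
    hk.coef h x • Modules.res K h k = x :=
  (LinearEquiv.ofBijective (LinearMap.toSpanSingleton Γ(X, V) Γ(K, V) (Modules.res K h k))
    (hk V h)).apply_symm_apply x

lemma IsFrame.coef_self {k : Γ(K, U)} (hk : IsFrame k) (h : V ≤ U) :
    hk.coef h (Modules.res K h k) = 1 := by
  simpa using hk.coef_smul h 1

lemma IsFrame.coef_res {k : Γ(K, U)} (hk : IsFrame k) (h : V ≤ U) {W : X.Opens} (hW : W ≤ V)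
    (x : Γ(K, V)) : hk.coef (hW.trans h) (Modules.res K hW x) = resO X hW (hk.coef h x) := by
  obtain ⟨c, rfl⟩ := (hk V h).2 x
  simp only [res_smul, res_res, coef_smul]

/-- The bilinear map `(m, c k) ↦ c m`. -/
noncomputable def divBilin (M : X.Modules) {k : Γ(K, U)} (hk : IsFrame k) :
    Bilin M K (corestrict M U) where
  app W := LinearMap.mk₂ _ (fun m k' => (corestrictEquiv M U W).symm
      (hk.coef inf_le_right (res K inf_le_left k') • res M (inf_le_left : W ⊓ U ≤ W) m))
    (fun m m' k' => by simp)
    (fun r m k' => (corestrictEquiv M U W).injective (by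
      rw [corestrictEquiv_smul, AddEquiv.apply_symm_apply, AddEquiv.apply_symm_apply, res_smul,
        smul_comm]))
    (fun m k' k'' => by simp [add_smul])
    (fun r m k' => (corestrictEquiv M U W).injective (by
      simp [corestrictEquiv_smul, res_smul, mul_smul]))
  naturality {W W'} h m k' := by
    apply (corestrictEquiv M U W').injective
    rw [corestrictEquiv_res]
    simp only [LinearMap.mk₂_apply, AddEquiv.apply_symm_apply]
    rw [res_smul, res_res, res_res, res_res, ← hk.coef_res inf_le_right (inf_le_inf_right U h),
      res_res]

/-- Division by a frame: `m ⊗ c k ↦ c m`. -/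
noncomputable def LocalHom.divRight (M : X.Modules) {k : Γ(K, U)} (hk : IsFrame k) :
    LocalHom (tensor M K) M U :=
  ofHom (tensorLift (divBilin M hk))

lemma LocalHom.divRight_tmul {k : Γ(K, U)} (hk : IsFrame k) (h : V ≤ U) (m : Γ(M, V))
    (x : Γ(K, V)) : (divRight M hk).app V h (tmul m x) = hk.coef h x • m := by
  rw [divRight, ofHom_app, tensorLift_tmul]
  change res M _ (hk.coef inf_le_right (res K inf_le_left x) • res M (inf_le_left : V ⊓ U ≤ V) m) = _
  simp [res_smul, ← hk.coef_res]

lemma LocalHom.divRight_mulRight {k : Γ(K, U)} (hk : IsFrame k) (h : V ≤ U) (m : Γ(M, V)) :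
    (divRight M hk).app V h (tmul m (res K h k)) = m := by
  rw [divRight_tmul, hk.coef_self, one_smul]

/-- A section `x` of the tensor sheaf need not be a sum of pure tensors over `V`. Both sides are
local homomorphisms in `x`, so it suffices to compare them on pure tensors over all smaller opens.
-/
lemma LocalHom.mulRight_divRight {k : Γ(K, U)} (hk : IsFrame k) (h : V ≤ U)
    (x : Γ(tensor M K, V)) : tmul ((divRight M hk).app V h x) (res K h k) = x := by
  have : (mulRight M k).comp (divRight M hk) = .ofGlobal (𝟙 _) U := by
    apply tensor_ext
    intro V hV m x
    simp only [comp_app, divRight_tmul, mulRight_app, smul_tmul, ofGlobal_app, appLin_id,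
      LinearMap.id_apply]
    rw [← tmul_smul, hk.smul_coef]
  exact congrArg (fun f : LocalHom (tensor M K) (tensor M K) U => f.app V h x) this

lemma bijective_tmul {k : Γ(K, U)} (hk : IsFrame k) (h : V ≤ U) :
    Function.Bijective (fun m : Γ(M, V) => tmul m (res K h k)) :=
  Function.bijective_iff_has_inverse.mpr
    ⟨_, LocalHom.divRight_mulRight hk h, LocalHom.mulRight_divRight hk h⟩

lemma IsFrameFam.tmul {n : ℕ} {e : Fin n → Γ(M, U)} (he : IsFrameFam e) {k : Γ(K, U)}
    (hk : IsFrame k) : IsFrameFam (fun i => Modules.tmul (e i) k) := by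
  have := isFrameFam_of_bijective he (LocalHom.mulRight M k) fun V hV => bijective_tmul hk hV
  simpa [LocalHom.mulRight_app] using this

end Tensor

/-! ### Dual frames. -/

section Dual
variable {X : Scheme.{u}} {M N : X.Modules} {U V : X.Opens} {n : ℕ}

/-- Evaluation at a frame, for the sheaf of homomorphisms. -/
lemma bijective_evalAt {e : Fin n → Γ(M, U)} (he : IsFrameFam e) (h : V ≤ U) :
    Function.Bijective (fun (f : Γ(sheafHom M N, V)) i => evalAt f (res M h (e i))) :=
  LocalHom.bijective_eval he h

lemma evalAt_eq {f g : Γ(sheafHom M N, U)} {e : Fin n → Γ(M, U)} (he : IsFrameFam e)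
    (h : ∀ i, evalAt f (e i) = evalAt g (e i)) : f = g := by
  apply (bijective_evalAt he le_rfl).1
  simpa using funext h

/-- The dual frame. -/
noncomputable def IsFrameFam.dual {e : Fin n → Γ(M, U)} (he : IsFrameFam e) (i : Fin n) :
    Γ(dual M, U) :=
  LocalHom.ofFrame (N := structureSheaf X) he ((fun j => if i = j then (1 : Γ(X, U)) else 0))

lemma IsFrameFam.pair_dual {e : Fin n → Γ(M, U)} (he : IsFrameFam e) (i j : Fin n) :
    pair (he.dual i) (e j) = if i = j then 1 else 0 := by
  have := LocalHom.ofFrame_app_single (N := structureSheaf X) he ((fun j => if i = j then (1 : Γ(X, U)) else 0))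
    le_rfl j
  rw [res_self, res_self] at this
  exact this

/-- Evaluation at `e` is bijective, and after it the coordinate map of the dual family becomes the
identity. -/
lemma IsFrameFam.isFrameFam_dual {e : Fin n → Γ(M, U)} (he : IsFrameFam e) :
    IsFrameFam he.dual := by
  intro V h
  have h1 : Function.Bijective (fun (f : Γ(Modules.dual M, V)) i =>
      (pair f (Modules.res M h (e i)) : Γ(X, V))) :=
    bijective_evalAt (N := structureSheaf X) he h
  rw [← Function.Bijective.of_comp_iff' h1]
  convert Function.bijective_id using 1
  ext c j
  change pair (∑ i, c i • Modules.res (Modules.dual M) h (he.dual i)) (Modules.res M h (e j)) = c j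
  have : ∀ (s : Finset (Fin n)), pair (∑ i ∈ s, c i • Modules.res (Modules.dual M) h (he.dual i))
      (Modules.res M h (e j)) = ∑ i ∈ s, c i * (if i = j then 1 else 0) := by
    intro s
    induction s using Finset.cons_induction with
    | empty => exact LinearMap.congr_fun (((evalBilin M (structureSheaf X)).app V).map_zero) _
    | cons a s ha ih =>
      rw [Finset.sum_cons, Finset.sum_cons, add_pair, ih, smul_pair, res_pair, he.pair_dual]
      split_ifs <;> simp
  rw [this]
  simp

lemma exists_dual_frame {k : Γ(M, U)} (hk : IsFrame k) :
    ∃ κ : Γ(dual M, U), IsFrame κ ∧ pair κ k = 1 := by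
  rw [isFrame_iff] at hk
  refine ⟨hk.dual 0, ?_, by simpa using hk.pair_dual 0 0⟩
  rw [isFrame_iff]
  convert hk.isFrameFam_dual using 2 with i
  rw [Subsingleton.elim i 0]

end Dual
end AlgebraicGeometry.Scheme.Modules

namespace AlgebraicGeometry.Scheme.Modules

/-! ### Pulled back sections, functionals and frames. -/

section Pullback
variable {X Y Z : Scheme.{u}} (f : X ⟶ Y) {M M' : Y.Modules} {N : X.Modules} {U V : Y.Opens}

lemma preimage_mono' {U V : Y.Opens} (h : V ≤ U) : f ⁻¹ᵁ V ≤ f ⁻¹ᵁ U :=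
  fun _ hx => h hx

lemma pullbackSection_add (m m' : Γ(M, U)) :
    pullbackSection f (m + m') = pullbackSection f m + pullbackSection f m' :=
  (appLin (pullbackUnit f M) U).map_add m m'

lemma pullbackSection_smul (r : Γ(Y, U)) (m : Γ(M, U)) :
    pullbackSection f (r • m) = (f.app U).hom r • pullbackSection f m :=
  (appLin (pullbackUnit f M) U).map_smul r m

lemma pullbackSection_res (h : V ≤ U) (m : Γ(M, U)) :
    pullbackSection f (res M h m) = res _ (preimage_mono' f h) (pullbackSection f m) :=
  appLin_res (pullbackUnit f M) h m

lemma pullbackSection_sum {ι : Type*} (s : Finset ι) (m : ι → Γ(M, U)) :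
    pullbackSection f (∑ i ∈ s, m i) = ∑ i ∈ s, pullbackSection f (m i) :=
  map_sum (appLin (pullbackUnit f M) U) m s

lemma resO_app (h : V ≤ U) (r : Γ(Y, U)) :
    resO X (preimage_mono' f h) ((f.app U).hom r) = (f.app V).hom (resO Y h r) :=
  (ConcreteCategory.congr_hom (f.naturality (homOfLE h).op) r).symm

lemma homEquiv_apply_pullbackSection (g : (pullback f).obj M ⟶ N) (m : Γ(M, U)) :
    appLin g (f ⁻¹ᵁ U) (pullbackSection f m) =
      appLin ((pullbackPushforwardAdjunction f).homEquiv M N g) U m := by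
  rw [Adjunction.homEquiv_unit]
  rfl

lemma homEquiv_symm_apply_pullbackSection (g : M ⟶ (pushforward f).obj N) (m : Γ(M, U)) :
    appLin (((pullbackPushforwardAdjunction f).homEquiv M N).symm g) (f ⁻¹ᵁ U)
      (pullbackSection f m) = appLin g U m := by
  rw [homEquiv_apply_pullbackSection, Equiv.apply_symm_apply]

lemma pullback_hom_ext {g g' : (pullback f).obj M ⟶ N}
    (h : ∀ (U : Y.Opens) (m : Γ(M, U)), appLin g (f ⁻¹ᵁ U) (pullbackSection f m) =
      appLin g' (f ⁻¹ᵁ U) (pullbackSection f m)) : g = g' := by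
  apply ((pullbackPushforwardAdjunction f).homEquiv M N).injective
  refine hom_ext_lin fun U => LinearMap.ext fun m => ?_
  rw [← homEquiv_apply_pullbackSection, ← homEquiv_apply_pullbackSection, h]

lemma pullback_map_pullbackSection (g : M ⟶ M') (m : Γ(M, U)) :
    appLin ((pullback f).map g) (f ⁻¹ᵁ U) (pullbackSection f m) =
      pullbackSection f (appLin g U m) := by
  have := (pullbackPushforwardAdjunction f).unit.naturality g
  exact (LinearMap.congr_fun (congrArg (appLin · U) this) m).symm

lemma pullbackTensor_pullbackSection (m : Γ(M, U)) (m' : Γ(M', U)) :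
    appLin (pullbackTensor f M M') (f ⁻¹ᵁ U) (pullbackSection f (tmul m m')) =
      tmul (pullbackSection f m) (pullbackSection f m') := by
  rw [pullbackTensor, homEquiv_symm_apply_pullbackSection, tensorLift_tmul]
  rfl

/-- The homomorphism over `f⁻¹ U` given by a homomorphism `M|_U ⟶ f_* N|_U`. -/
noncomputable def LocalHom.pullbackLift (h : LocalHom M ((pushforward f).obj N) U) :
    LocalHom ((pullback f).obj M) N (f ⁻¹ᵁ U) :=
  ofHom (((pullbackPushforwardAdjunction f).homEquiv M (corestrict N (f ⁻¹ᵁ U))).symm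
    (homOfLin (M := M) (N := (pushforward f).obj (corestrict N (f ⁻¹ᵁ U))) (fun W =>
      { toFun := fun m => (corestrictEquiv N (f ⁻¹ᵁ U) (f ⁻¹ᵁ W)).symm
          (show Γ(N, f ⁻¹ᵁ W ⊓ f ⁻¹ᵁ U) from h.app (W ⊓ U) inf_le_right (res M inf_le_left m))
        map_add' := fun m m' => by
          rw [map_add, map_add]; rfl
        map_smul' := fun r m => by
          rw [res_smul, LinearMap.map_smul]
          apply (corestrictEquiv N (f ⁻¹ᵁ U) (f ⁻¹ᵁ W)).injective
          refine Eq.trans ?_ (corestrictEquiv_smul _ _ _ ((f.app W).hom r) _).symm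
          rw [AddEquiv.apply_symm_apply, AddEquiv.apply_symm_apply]
          refine (congrArg (fun (c : Γ(X, f ⁻¹ᵁ (W ⊓ U))) => c • (show Γ(N, f ⁻¹ᵁ (W ⊓ U)) from
            h.app (W ⊓ U) inf_le_right (res M inf_le_left m))) (resO_app f inf_le_left r)).symm })
      (fun W W' hW m => by
        have := h.naturality (inf_le_right : W ⊓ U ≤ U) (inf_le_inf_right U hW)
          (res M inf_le_left m)
        rw [res_res] at this
        refine Eq.trans ?_ this
        change h.app _ _ (res M _ (res M _ m)) = _
        rw [res_res])))

lemma LocalHom.pullbackLift_pullbackSection (h : LocalHom M ((pushforward f).obj N) U)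
    (hV : V ≤ U) (m : Γ(M, V)) :
    (h.pullbackLift f).app (f ⁻¹ᵁ V) (preimage_mono' f hV) (pullbackSection f m) =
      h.app V hV m := by
  rw [pullbackLift, ofHom_app, homEquiv_symm_apply_pullbackSection]
  have := h.naturality (inf_le_right : V ⊓ U ≤ U) (le_inf le_rfl hV) (res M inf_le_left m)
  rw [res_res, res_self] at this
  exact this.symm

lemma LocalHom.pullback_ext {g g' : LocalHom ((pullback f).obj M) N (f ⁻¹ᵁ U)}
    (h : ∀ (V : Y.Opens) (hV : V ≤ U) (m : Γ(M, V)),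
      g.app (f ⁻¹ᵁ V) (preimage_mono' f hV) (pullbackSection f m) =
        g'.app (f ⁻¹ᵁ V) (preimage_mono' f hV) (pullbackSection f m)) : g = g' := by
  apply toHom_injective
  refine pullback_hom_ext f fun W m => (corestrictEquiv N _ _).injective ?_
  rw [toHom_apply, toHom_apply]
  have := h (W ⊓ U) inf_le_right (res M inf_le_left m)
  rw [pullbackSection_res] at this
  exact this

/-- The pulled back functional `f_* O`-valued on `M`. -/
noncomputable def LocalHom.toPushforward (h : LocalHom M (structureSheaf Y) U) :
    LocalHom M ((pushforward f).obj (structureSheaf X)) U where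
  app V hV :=
    { toFun := fun m => (show Γ(X, f ⁻¹ᵁ V) from
        (f.app V).hom (show Γ(Y, V) from h.app V hV m))
      map_add' := fun m m' => by
        rw [map_add]; exact (f.app V).hom.map_add _ _
      map_smul' := fun r m => by
        rw [LinearMap.map_smul]; exact (f.app V).hom.map_mul _ _ }
  naturality {V W} hV hW m := by
    have := h.naturality hV hW m
    refine (congrArg (f.app W).hom this).trans ?_
    exact (resO_app f hW (show Γ(Y, V) from h.app V hV m)).symm

/-- A local functional, as a function-valued linear map. -/
noncomputable def LocalHom.functional {Q : X.Modules} {U V : X.Opens}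
    (c : LocalHom Q (structureSheaf X) U) (hV : V ≤ U) : Γ(Q, V) →ₗ[Γ(X, V)] Γ(X, V) :=
  c.app V hV

lemma LocalHom.functional_res {Q : X.Modules} {U V W : X.Opens}
    (c : LocalHom Q (structureSheaf X) U) (hV : V ≤ U) (hW : W ≤ V) (q : Γ(Q, V)) :
    c.functional (hW.trans hV) (res Q hW q) = resO X hW (c.functional hV q) :=
  c.naturality hV hW q

/-- The homomorphism `q ↦ c(q) x` given by a local functional `c` and a section `x`. -/
noncomputable def LocalHom.smulSection {Q Q' : X.Modules} {U : X.Opens}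
    (c : LocalHom Q (structureSheaf X) U) (x : Γ(Q', U)) : LocalHom Q Q' U where
  app _ hV := (c.functional hV).smulRight (res Q' hV x)
  naturality hV hW q := by
    simp [c.functional_res hV hW, res_smul]

/-- Frames pull back to frames. -/
lemma IsFrameFam.pullback {n : ℕ} {e : Fin n → Γ(M, U)} (he : IsFrameFam e) :
    IsFrameFam (fun i => pullbackSection f (e i)) := by
  -- The pulled back dual frame supplies the coordinate functionals of the pulled back frame.
  let c (i : Fin n) : LocalHom ((Modules.pullback f).obj M) (structureSheaf X) (f ⁻¹ᵁ U) :=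
    ((show LocalHom M (structureSheaf Y) U from he.dual i).toPushforward f).pullbackLift f
  have hce (i j : Fin n) : (c i).functional le_rfl (pullbackSection f (e j)) =
      if i = j then 1 else 0 := by
    refine (LocalHom.pullbackLift_pullbackSection f _ le_rfl (e j)).trans ?_
    refine (congrArg (f.app U).hom (he.pair_dual i j)).trans ?_
    split_ifs <;> simp
  have hce' (i j : Fin n) (W : X.Opens) (hW : W ≤ f ⁻¹ᵁ U) :
      (c i).functional hW (Modules.res ((Modules.pullback f).obj M) hW (pullbackSection f (e j))) =
        if i = j then 1 else 0 := by
    rw [(c i).functional_res le_rfl hW, hce]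
    split_ifs <;> simp
  have h1 (W : X.Opens) (hW : W ≤ f ⁻¹ᵁ U) (a : Fin n → Γ(X, W)) (j : Fin n) :
      (c j).functional hW (∑ i, a i • Modules.res ((Modules.pullback f).obj M) hW
        (pullbackSection f (e i))) = a j := by
    simp [hce']
  intro W hW
  refine ⟨fun a b hab => funext fun j => ?_, fun x => ⟨fun i => (c i).functional hW x, ?_⟩⟩
  · exact (h1 W hW a j).symm.trans ((congrArg ((c j).functional hW) hab).trans (h1 W hW b j))
  -- The endomorphism `x ↦ ∑ cᵢ(x) eᵢ` is the identity: it fixes pulled back sections, and these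
  -- determine a homomorphism out of a pullback. This is the spanning property.
  · have hg : ∑ i, (c i).smulSection (pullbackSection f (e i)) = .ofGlobal (𝟙 _) _ := by
      refine LocalHom.pullback_ext f fun V hV m => ?_
      have h2 (s : Finset (Fin n)) : (∑ i ∈ s, (c i).smulSection (pullbackSection f (e i))).app
          (f ⁻¹ᵁ V) (preimage_mono' f hV) (pullbackSection f m) =
          ∑ i ∈ s, (c i).functional (preimage_mono' f hV) (pullbackSection f m) •
            Modules.res ((Modules.pullback f).obj M) (preimage_mono' f hV)
              (pullbackSection f (e i)) := by
        induction s using Finset.cons_induction with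
        | empty => rfl
        | cons a s ha ih => rw [Finset.sum_cons, Finset.sum_cons, ← ih]; rfl
      rw [h2, LocalHom.ofGlobal_app, appLin_id, LinearMap.id_apply]
      obtain ⟨a, rfl⟩ := (he.equiv hV).surjective m
      have h3 : pullbackSection f (he.equiv hV a) = ∑ i, (f.app V).hom (a i) •
          Modules.res ((Modules.pullback f).obj M) (preimage_mono' f hV)
            (pullbackSection f (e i)) := by
        rw [IsFrameFam.equiv_apply, pullbackSection_sum]
        exact Finset.sum_congr rfl fun i _ => by rw [pullbackSection_smul, pullbackSection_res]
      rw [h3]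
      exact Finset.sum_congr rfl fun i _ => by rw [h1]
    have h2 (s : Finset (Fin n)) : (∑ i ∈ s, (c i).smulSection (pullbackSection f (e i))).app
        W hW x = ∑ i ∈ s, (c i).functional hW x •
          Modules.res ((Modules.pullback f).obj M) hW (pullbackSection f (e i)) := by
      induction s using Finset.cons_induction with
      | empty => rfl
      | cons a s ha ih => rw [Finset.sum_cons, Finset.sum_cons, ← ih]; rfl
    have := congrArg (fun k : LocalHom _ _ (f ⁻¹ᵁ U) => k.app W hW x) hg
    exact (h2 _).symm.trans this

lemma IsFrame.pullback {k : Γ(M, U)} (hk : IsFrame k) : IsFrame (pullbackSection f k) := by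
  rw [isFrame_iff] at hk ⊢
  exact hk.pullback f

/-- `pullbackComp` is conjugate to the comparison of direct images, so it carries the composite of
the two units to the unit of the composite adjunction. -/
lemma pullbackComp_pullbackSection (g : Y ⟶ Z) {K : Z.Modules} {U : Z.Opens} (k : Γ(K, U)) :
    appLin ((pullbackComp f g).hom.app K) (f ⁻¹ᵁ g ⁻¹ᵁ U) (pullbackSection f (pullbackSection g k)) =
      pullbackSection (f ≫ g) k := by
  have h := unit_conjugateEquiv ((pullbackPushforwardAdjunction g).comp
    (pullbackPushforwardAdjunction f)) (pullbackPushforwardAdjunction (f ≫ g))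
    (pullbackComp f g).inv K
  rw [conjugateEquiv_pullbackComp_inv] at h
  have h2 := LinearMap.congr_fun (congrArg (appLin · U) h) k
  have h3 : pullbackSection f (pullbackSection g k) =
    appLin ((pullbackComp f g).inv.app K) (f ⁻¹ᵁ g ⁻¹ᵁ U) (pullbackSection (f ≫ g) k) := by
    exact h2
  have h4 := congrArg (fun a => appLin a (f ⁻¹ᵁ g ⁻¹ᵁ U) (pullbackSection (f ≫ g) k))
    ((pullbackComp f g).inv_hom_id_app K)
  exact (congrArg (appLin ((pullbackComp f g).hom.app K) (f ⁻¹ᵁ g ⁻¹ᵁ U)) h3).trans h4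

lemma pullbackCongr_pullbackSection {f g : X ⟶ Y} (h : f = g) (m : Γ(M, U)) :
    appLin ((pullbackCongr h).hom.app M) (f ⁻¹ᵁ U) (pullbackSection f m) =
      res _ (by rw [h]) (pullbackSection g m) := by
  subst h
  simp [pullbackCongr]

end Pullback
end AlgebraicGeometry.Scheme.Modules

namespace AlgebraicGeometry.Scheme.Modules

/-! ### Contractions and the transpose. -/

section Contraction
variable {X : Scheme.{u}} {M N K L Q : X.Modules} {U V : X.Opens}

lemma isNhdBasis_of_local {P : X.Opens → Prop} (hP : ∀ U V, V ≤ U → P U → P V)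
    (h : ∀ x : X, ∃ U, x ∈ U ∧ P U) : IsNhdBasis P := fun U p hp => by
  obtain ⟨W, hpW, hW⟩ := h p
  exact ⟨W ⊓ U, hP _ _ inf_le_left hW, ⟨hpW, hp⟩, inf_le_right⟩

/-- `K` is locally free of rank one. -/
def IsLineBundle (K : X.Modules) : Prop :=
  ∀ x : X, ∃ U : X.Opens, x ∈ U ∧ ∃ k : Γ(K, U), IsFrame k

/-- `E` has a finite frame over `U`. -/
def HasFrame (E : X.Modules) (U : X.Opens) : Prop :=
  ∃ (n : ℕ) (e : Fin n → Γ(E, U)), IsFrameFam e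

lemma HasFrame.mono {E : X.Modules} (h : HasFrame E U) (hV : V ≤ U) : HasFrame E V := by
  obtain ⟨n, e, he⟩ := h
  exact ⟨n, _, he.res hV⟩

lemma IsVectorBundle.isNhdBasis {E : X.Modules} (hE : IsVectorBundle E) :
    IsNhdBasis (HasFrame E) :=
  isNhdBasis_of_local (fun _ _ h hU => hU.mono h) fun x => by
    obtain ⟨U, hx, n, e, he⟩ := hE x
    exact ⟨U, hx, n, e, he⟩

lemma IsVectorBundle.isNhdBasis_and {E : X.Modules} (hE : IsVectorBundle E) {P : X.Opens → Prop}
    (hP : IsNhdBasis P) : IsNhdBasis (fun U => P U ∧ HasFrame E U) := fun U p hp => by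
  obtain ⟨W, hW, hpW, hWU⟩ := hE.isNhdBasis U p hp
  obtain ⟨V, hV, hpV, hVW⟩ := hP W p hpW
  exact ⟨V, ⟨hV, hW.mono hVW⟩, hpV, hVW.trans hWU⟩

lemma IsLineBundle.isNhdBasis (hK : IsLineBundle K) :
    IsNhdBasis (fun U : X.Opens => ∃ k : Γ(K, U), IsFrame k) :=
  isNhdBasis_of_local (fun _ _ h hU => by
    obtain ⟨k, hk⟩ := hU
    exact ⟨_, hk.res h⟩) hK

lemma sheafHom_section_ext {f g : Γ(sheafHom M N, U)}
    (h : ∀ (V : X.Opens) (hV : V ≤ U) (m : Γ(M, V)),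
      evalAt (res _ hV f) m = evalAt (res _ hV g) m) : f = g :=
  LocalHom.ext (funext fun V => funext fun hV => LinearMap.ext fun m => h V hV m)

lemma sheafHom_hom_ext {a b : L ⟶ sheafHom M N}
    (h : ∀ (U : X.Opens) (l : Γ(L, U)) (m : Γ(M, U)),
      evalAt (appLin a U l) m = evalAt (appLin b U l) m) : a = b :=
  hom_ext_lin fun U => LinearMap.ext fun l => sheafHom_section_ext fun V hV m => by
    rw [← appLin_res, ← appLin_res, h]

/-- The morphism `M ⟶ Hom(N, Q)` given by a bilinear map. -/
noncomputable def Bilin.curry (b : Bilin M N Q) : M ⟶ sheafHom N Q :=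
  homOfLin (M := M) (N := sheafHom N Q) (fun U =>
    { toFun := fun m => (show LocalHom N Q U from
        ⟨fun V hV => b.app V (res M hV m), fun {V W} hV hW n => by
          have := b.naturality hW (res M hV m) n
          rwa [res_res] at this⟩)
      map_add' := fun m m' => LocalHom.ext (funext fun V => funext fun hV => by
        change b.app V _ = b.app V _ + b.app V _
        rw [map_add, map_add])
      map_smul' := fun r m => LocalHom.ext (funext fun V => funext fun hV => by
        change b.app V _ = resO X hV r • b.app V _
        rw [res_smul, LinearMap.map_smul]) })
    (fun U V h m => LocalHom.ext (funext fun W => funext fun hW => by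
      change b.app W _ = b.app W _
      rw [res_res]))

lemma Bilin.evalAt_curry (b : Bilin M N Q) (m : Γ(M, U)) (n : Γ(N, U)) :
    evalAt (appLin b.curry U m) n = b.app U m n := by
  change b.app U (res M le_rfl m) n = _
  rw [res_self]

lemma evalAt_contract (p : Pairing L K) (k : Γ(K, U)) (n : Γ(N, U)) (l : Γ(L, U)) :
    evalAt (appLin (contract p N) U (tmul k n)) l = p.app U l k • n := by
  rw [contract, tensorLift_tmul]
  change p.app U l (res K le_rfl k) • res N le_rfl n = _
  rw [res_self, res_self]

lemma evalAt_contractLeft (m : Γ(M, U)) (n : Γ(N, U)) (l : Γ(dual M, U)) :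
    evalAt (appLin (contractLeft M N) U (tmul m n)) l = pair l m • n :=
  evalAt_contract _ _ _ _

lemma evalAt_contractDual (l : Γ(dual M, U)) (n : Γ(N, U)) (m : Γ(M, U)) :
    evalAt (appLin (contractDual M N) U (tmul l n)) m = pair l m • n :=
  evalAt_contract _ _ _ _

lemma appLin_tensorMap {M' N' : X.Modules} (f : M' ⟶ M) (g : N' ⟶ N) (m : Γ(M', U))
    (n : Γ(N', U)) : appLin (tensorMap f g) U (tmul m n) = tmul (appLin f U m) (appLin g U n) :=
  tensorLift_tmul _ _ _

lemma evalAt_contractRight (m : Γ(M, U)) (n : Γ(N, U)) (l : Γ(dual N, U)) :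
    evalAt (appLin (contractRight M N) U (tmul m n)) l = pair l n • m := by
  rw [contractRight, appLin_comp, LinearMap.comp_apply, tensorSwap, tensorLift_tmul]
  exact evalAt_contractLeft _ _ _

lemma appLin_untwist (ψ : M ⟶ tensor N K) (m : Γ(M, U)) (κ : Γ(dual K, U)) :
    appLin (untwist ψ) U (tmul m κ) = evalAt (appLin (contractRight N K) U (appLin ψ U m)) κ := by
  rw [untwist, tensorLift_tmul]
  rfl

lemma pair_sum {ι : Type*} (s : Finset ι) (l : ι → Γ(dual M, U)) (m : Γ(M, U)) :
    pair (∑ i ∈ s, l i) m = ∑ i ∈ s, pair (l i) m := by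
  classical
  induction s using Finset.cons_induction with
  | empty => exact LinearMap.congr_fun (((evalBilin M (structureSheaf X)).app U).map_zero) _
  | cons a s ha ih => rw [Finset.sum_cons, Finset.sum_cons, add_pair, ih]

lemma IsFrameFam.pair_dual_sum {n : ℕ} {e : Fin n → Γ(M, U)} (he : IsFrameFam e)
    (h : V ≤ U) (c : Fin n → Γ(X, V)) (j : Fin n) :
    pair (∑ i, c i • Modules.res (Modules.dual M) h (he.dual i)) (Modules.res M h (e j)) = c j := by
  rw [pair_sum, Finset.sum_eq_single j]
  · rw [smul_pair, res_pair, he.pair_dual, if_pos rfl, map_one, mul_one]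
  · intro i _ hij
    rw [smul_pair, res_pair, he.pair_dual, if_neg hij, map_zero, mul_zero]
  · simp

lemma bijective_smul_frame {n : ℕ} {k : Γ(K, U)} (hk : IsFrame k) (h : V ≤ U) :
    Function.Bijective (fun (c : Fin n → Γ(X, V)) i => c i • res K h k) :=
  Function.Bijective.piMap fun _ : Fin n => hk V h

/-- In the dual frame on the source and evaluation at the frame on the target, contraction
multiplies every coordinate by `k`. -/
lemma bijective_contractDual (hM : HasFrame M U) {k : Γ(K, U)} (hk : IsFrame k) :
    Function.Bijective (appLin (contractDual M K) U) := by
  obtain ⟨n, e, he⟩ := hM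
  rw [← Function.Bijective.of_comp_iff' (bijective_evalAt (N := K) he le_rfl),
    ← Function.Bijective.of_comp_iff _ (bijective_tmul (M := dual M) hk le_rfl),
    ← Function.Bijective.of_comp_iff _ (he.isFrameFam_dual U le_rfl)]
  convert bijective_smul_frame (n := n) hk le_rfl using 1
  ext c j
  simp only [Function.comp]
  rw [evalAt_contractDual, he.pair_dual_sum]

theorem isIso_contractDual (hM : IsVectorBundle M) (hK : IsLineBundle K) :
    IsIso (contractDual M K) :=
  isIso_of_basis (hM.isNhdBasis_and hK.isNhdBasis) _ fun U ⟨⟨_, hk⟩, hU⟩ =>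
    bijective_contractDual hU hk

/-- The defining identity prescribes the composite of `ψ` with `contractDual E K`: it has to be the
curried form of `(l, e) ↦ l(φ e)`. Contraction is an isomorphism, so it can be cancelled. -/
theorem existsUnique_isTranspose {E : X.Modules} (hE : IsVectorBundle E) (hK : IsLineBundle K)
    (φ : E ⟶ tensor E K) : ∃! ψ, IsTranspose φ ψ := by
  have := isIso_contractDual hE hK
  let b : Bilin (dual E) E K := ((evalBilin (dual E) K).pre (φ ≫ contractLeft E K) (𝟙 _)).flip
  refine ⟨b.curry ≫ inv (contractDual E K), fun U l e => ?_, fun ψ hψ => ?_⟩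
  · rw [Category.assoc, IsIso.inv_hom_id, Category.comp_id, Bilin.evalAt_curry]
    rfl
  · rw [IsIso.eq_comp_inv]
    refine sheafHom_hom_ext fun U l e => ?_
    rw [hψ, Bilin.evalAt_curry]
    rfl

theorem isTranspose_transpose {E : X.Modules} (hE : IsVectorBundle E) (hK : IsLineBundle K)
    (φ : E ⟶ tensor E K) : IsTranspose φ (transpose φ) :=
  Classical.epsilon_spec (existsUnique_isTranspose hE hK φ).exists

/-- `φ_k`, the endomorphism with `φ(e) = φ_k(e) ⊗ k`. -/
noncomputable def coefHom (φ : M ⟶ tensor N K) {k : Γ(K, U)} (hk : IsFrame k) : LocalHom M N U :=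
  (LocalHom.divRight N hk).comp (.ofGlobal φ U)

lemma tmul_coefHom (φ : M ⟶ tensor N K) {k : Γ(K, U)} (hk : IsFrame k) (h : V ≤ U) (m : Γ(M, V)) :
    tmul ((coefHom φ hk).app V h m) (res K h k) = appLin φ V m :=
  LocalHom.mulRight_divRight hk h _

lemma coefHom_neg (φ : M ⟶ tensor N K) {k : Γ(K, U)} (hk : IsFrame k) (h : V ≤ U) (m : Γ(M, V)) :
    (coefHom (-φ) hk).app V h m = -(coefHom φ hk).app V h m := by
  have : appLin (-φ) V m = -appLin φ V m := rfl
  simp [coefHom, this]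

/-- Cancelling the frame `k` from the defining identity turns the transpose into the usual transpose
of the endomorphism `φ_k`. -/
lemma coefHom_transpose {E : X.Modules} {φ : E ⟶ tensor E K} {ψ : dual E ⟶ tensor (dual E) K}
    (hψ : IsTranspose φ ψ) {k : Γ(K, U)} (hk : IsFrame k) (h : V ≤ U) (l : Γ(dual E, V))
    (e : Γ(E, V)) :
    pair ((coefHom ψ hk).app V h l) e = pair l ((coefHom φ hk).app V h e) := by
  have := hψ V l e
  rw [appLin_comp, appLin_comp, LinearMap.comp_apply, LinearMap.comp_apply, ← tmul_coefHom ψ hk h,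
    ← tmul_coefHom φ hk h, evalAt_contractDual, evalAt_contractLeft] at this
  exact (hk V h).1 this

/-- The dual of a vector bundle is a vector bundle. -/
theorem IsVectorBundle.dual {E : X.Modules} (hE : IsVectorBundle E) :
    IsVectorBundle (Modules.dual E) := fun x => by
  obtain ⟨U, hx, n, e, he⟩ := hE x
  exact ⟨U, hx, n, _, IsFrameFam.isFrameFam_dual (e := e) he⟩

theorem IsVectorBundle.pullback {Y : Scheme.{u}} (f : Y ⟶ X) {E : X.Modules}
    (hE : IsVectorBundle E) : IsVectorBundle ((Modules.pullback f).obj E) := fun x => by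
  obtain ⟨U, hx, n, e, he⟩ := hE (f x)
  exact ⟨f ⁻¹ᵁ U, hx, n, _, IsFrameFam.pullback f (e := e) he⟩

theorem IsLineBundle.pullback {Y : Scheme.{u}} (f : Y ⟶ X) (hK : IsLineBundle K) :
    IsLineBundle ((Modules.pullback f).obj K) := fun x => by
  obtain ⟨U, hx, k, hk⟩ := hK (f x)
  exact ⟨f ⁻¹ᵁ U, hx, _, hk.pullback f⟩

end Contraction
end AlgebraicGeometry.Scheme.Modules

namespace AlgebraicGeometry.Scheme.Modules

/-! ### Extension by zero, and local extension of maps into injectives. -/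

section ExtensionByZero
variable {X : Scheme.{u}} {M N : X.Modules}

open Classical in
/-- The extension by zero of `M|_U`, as a subpresheaf of `M`. -/
noncomputable def zeroExt (M : X.Modules) (U : X.Opens) :
    PresheafOfModules.Submodule M.val where
  obj V := if V.unop ≤ U then ⊤ else ⊥
  map {V W} i x hx := by
    split_ifs at hx with h
    · rw [if_pos ((leOfHom i.unop).trans h)]; trivial
    · obtain rfl := (Submodule.mem_bot _).mp hx
      exact Submodule.zero_mem _

lemma mem_zeroExt {U V : X.Opens} (h : V ≤ U) (m : M.val.obj (op V)) :
    m ∈ (zeroExt M U).obj (op V) := by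
  rw [zeroExt]; dsimp only; rw [if_pos h]; trivial

lemma eq_zero_of_mem_zeroExt {U V : X.Opens} (h : ¬ V ≤ U) {m : M.val.obj (op V)}
    (hm : m ∈ (zeroExt M U).obj (op V)) : m = 0 := by
  rw [zeroExt] at hm; dsimp only at hm; rw [if_neg h] at hm
  exact (Submodule.mem_bot _).mp hm

open Classical in
/-- The maps on sections of the extension by zero of a homomorphism over `U`. -/
noncomputable def LocalHom.zeroExtLin {U : X.Opens} (f : LocalHom M N U) (V : X.Opensᵒᵖ) :
    (Modules.zeroExt M U).obj V →ₗ[X.ringCatSheaf.obj.obj V] N.val.obj V :=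
  if h : V.unop ≤ U then
    (show M.val.obj V →ₗ[X.ringCatSheaf.obj.obj V] N.val.obj V from f.app V.unop h) ∘ₗ
      ((Modules.zeroExt M U).obj V).subtype
  else 0

lemma LocalHom.zeroExtLin_apply {U : X.Opens} (f : LocalHom M N U) {V : X.Opensᵒᵖ}
    (h : V.unop ≤ U) (m : (Modules.zeroExt M U).obj V) :
    f.zeroExtLin V m = f.app V.unop h m.val := by
  rw [zeroExtLin, dif_pos h]
  rfl

/-- Homomorphisms over `U` extend to the extension by zero. -/
noncomputable def LocalHom.zeroExt {U : X.Opens} (f : LocalHom M N U) :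
    (Modules.zeroExt M U).toPresheafOfModules ⟶ N.val where
  app V := ModuleCat.ofHom (f.zeroExtLin V)
  naturality {V W} i := by
    ext m
    by_cases h : V.unop ≤ U
    · have h' : W.unop ≤ U := (leOfHom i.unop).trans h
      refine (f.zeroExtLin_apply h' _).trans ?_
      refine (f.naturality h (leOfHom i.unop) m.val).trans ?_
      exact congrArg (res N (leOfHom i.unop)) (f.zeroExtLin_apply h _).symm
    · have hm : m = 0 := Subtype.ext (eq_zero_of_mem_zeroExt h m.2)
      rw [hm, map_zero, map_zero]

lemma LocalHom.zeroExt_app {U V : X.Opens} (f : LocalHom M N U) (h : V ≤ U) (m : Γ(M, V)) :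
    (f.zeroExt.app (op V)).hom ⟨m, mem_zeroExt h m⟩ = f.app V h m := f.zeroExtLin_apply h _

/-- Homomorphisms into an injective sheaf extend along monomorphisms, also locally. -/
lemma LocalHom.exists_extension {M' I : X.Modules} [Injective I] (a : M' ⟶ M) [Mono a]
    {U : X.Opens} (f : LocalHom M' I U) : ∃ g : LocalHom M I U, g.precomp a = f := by
  have : PreservesFiniteLimits (shf X) := inferInstanceAs
    (PreservesFiniteLimits (PresheafOfModules.sheafification (𝟙 X.ringCatSheaf.obj)))
  -- The forgetful functor is right adjoint to the exact sheafification, so `I` stays injective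
  -- among presheaves; the presheaf extension by zero needs no sheafification.
  have : Injective ((toPresheafOfModules X).obj I) := Injective.injective_of_adjoint (shfAdj X) I
  have : Mono ((toPresheafOfModules X).map a) := (toPresheafOfModules X).map_mono a
  let j : (Modules.zeroExt M' U).toPresheafOfModules ⟶ (toPresheafOfModules X).obj M :=
    (Modules.zeroExt M' U).ι ≫ (toPresheafOfModules X).map a
  have : Mono j := @mono_comp _ _ _ _ _ _ inferInstance _ ‹Mono ((toPresheafOfModules X).map a)›
  let g : (toPresheafOfModules X).obj M ⟶ (toPresheafOfModules X).obj I :=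
    Injective.factorThru (show _ ⟶ (toPresheafOfModules X).obj I from f.zeroExt) j
  have hg : j ≫ g = f.zeroExt := Injective.comp_factorThru _ _
  refine ⟨.ofGlobal ((fullyFaithfulToPresheafOfModules (X := X)).preimage g) U, ?_⟩
  ext V hV m
  rw [← f.zeroExt_app hV m, ← hg]
  rfl

end ExtensionByZero

/-! ### Exactness of the sheaf of homomorphisms in each variable. -/

section Ext
variable {X : Scheme.{u}}

/-- Precomposition with `a`, as a natural transformation `Hom(M, -) ⟶ Hom(M', -)`. -/
noncomputable def sheafHomPrecomp {M' M : X.Modules} (a : M' ⟶ M) :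
    sheafHomFunctor M ⟶ sheafHomFunctor M' where
  app N := homOfLin (M := sheafHom M N) (N := sheafHom M' N)
    (fun U =>
      { toFun := fun f : LocalHom M N U => f.precomp a
        map_add' := fun f g => rfl
        map_smul' := fun r f => rfl }) (fun _ _ _ _ => rfl)
  naturality N N' g := hom_ext_lin fun U => rfl

/-- `Hom(M, -)` is left exact. -/
lemma sheafHom_exact_of_mono (M : X.Modules) {S : ShortComplex X.Modules} (hS : S.Exact) [Mono S.f] :
    (S.map (sheafHomFunctor M)).Exact := by
  apply exact_of_locally
  intro U (f : LocalHom M S.X₂ U) hf p hp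
  have hf' : ∀ V hV m, appLin S.g V (f.app V hV m) = 0 := fun V hV m =>
    congrArg (fun k : LocalHom M S.X₃ U => k.app V hV m) hf
  choose l hl using fun V hV m => exists_of_exact_of_mono hS _ (hf' V hV m)
  refine ⟨U, le_rfl, (show LocalHom M S.X₁ U from
    ⟨fun V hV => ⟨⟨l V hV, fun m m' => injective_of_mono S.f V (by simp [hl])⟩,
      fun r m => injective_of_mono S.f V (by simp [hl])⟩, fun {V W} hV hW m =>
        injective_of_mono S.f W ?_⟩), hp, ?_⟩
  · change appLin S.f W (l W _ _) = appLin S.f W (res _ hW (l V hV m))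
    rw [appLin_res, hl, hl, f.naturality hV hW]
  · exact LocalHom.ext (funext fun V => funext fun hV => LinearMap.ext fun m => hl V hV m)

lemma sheafHom_mono (M : X.Modules) {N N' : X.Modules} (g : N ⟶ N') [Mono g] :
    Mono ((sheafHomFunctor M).map g) := by
  refine mono_of_injective _ fun U (f f' : LocalHom M N U) h => ?_
  exact LocalHom.ext (funext fun V => funext fun hV => LinearMap.ext fun m =>
    injective_of_mono g V (congrArg (fun k : LocalHom M N' U => k.app V hV m) h))

/-- `Hom(M, -)` is exact for a vector bundle `M`. -/
lemma sheafHom_exact_of_isVectorBundle {M : X.Modules} (hM : IsVectorBundle M)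
    {S : ShortComplex X.Modules} (hS : S.Exact) : (S.map (sheafHomFunctor M)).Exact := by
  apply exact_of_locally
  intro U (f : LocalHom M S.X₂ U) hf p hp
  obtain ⟨W, ⟨n, e, he⟩, hpW, hWU⟩ := hM.isNhdBasis U p hp
  have hf' : ∀ V hV m, appLin S.g V (f.app V hV m) = 0 := fun V hV m =>
    congrArg (fun k : LocalHom M S.X₃ U => k.app V hV m) hf
  choose V hVW y hpV hy using fun i => locally_of_exact hS W _ (hf' W hWU (e i)) p hpW
  -- The images of the finitely many frame elements lift on separate neighbourhoods; on their
  -- intersection these lifts define a homomorphism.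
  let V' : X.Opens := ⟨W.1 ∩ ⋂ i, (V i).1, W.2.inter (isOpen_iInter_of_finite fun i => (V i).2)⟩
  have hV' : V' ≤ W := fun q hq => hq.1
  have hV'i (i) : V' ≤ V i := fun q hq => Set.mem_iInter.mp hq.2 i
  refine ⟨V', hV'.trans hWU, (show LocalHom M S.X₁ V' from
    LocalHom.ofFrame (he.res hV') (fun i => res _ (hV'i i) (y i))),
    ⟨hpW, Set.mem_iInter.mpr hpV⟩, ?_⟩
  refine LocalHom.ext_frame (he.res hV') fun i => ?_
  have h1 := LocalHom.ofFrame_app_single (he.res hV') (fun i => res S.X₁ (hV'i i) (y i)) le_rfl i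
  rw [res_self, res_self] at h1
  change appLin S.f V' ((LocalHom.ofFrame (he.res hV') (fun i => res S.X₁ (hV'i i) (y i))).app V' le_rfl
    (res M hV' (e i))) = f.app V' _ (res M hV' (e i))
  rw [h1, appLin_res, hy, res_res, f.naturality hWU hV']

/-- `Hom(-, I)` is exact for an injective `I`. -/
lemma sheafHomPrecomp_shortExact {S : ShortComplex X.Modules} (hS : S.ShortExact) (I : X.Modules)
    [Injective I] : (ShortComplex.mk ((sheafHomPrecomp S.g).app I) ((sheafHomPrecomp S.f).app I)
      (hom_ext_lin fun U => LinearMap.ext fun (f : LocalHom S.X₃ I U) => by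
        change (f.precomp S.g).precomp S.f = 0
        ext V hV m
        have : appLin S.g V (appLin S.f V m) = 0 :=
          LinearMap.congr_fun (congrArg (appLin · V) S.zero) m
        simp [this])).ShortExact := by
  have := hS.mono_f
  have := hS.epi_g
  refine ShortComplex.ShortExact.mk' (exact_of_locally ?_)
    (mono_of_injective ((sheafHomPrecomp S.g).app I) ?_)
    (epi_of_locSurj ((sheafHomPrecomp S.f).app I) ?_)
  · intro U (f : LocalHom S.X₂ I U) hf p hp
    have hf' : f.precomp S.f = 0 := hf
    have h0 : S.f ≫ f.toHom = 0 := by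
      rw [← LocalHom.toHom_precomp, hf']
      exact hom_ext_lin fun W => rfl
    -- Seen as a morphism to `corestrict I U`, the homomorphism `f` kills `S.f` and so descends
    -- along the cokernel `S.g`.
    refine ⟨U, le_rfl, (show LocalHom S.X₃ I U from LocalHom.ofHom (hS.exact.desc f.toHom h0)),
      hp, ?_⟩
    change (LocalHom.ofHom (hS.exact.desc f.toHom h0)).precomp S.g = f
    apply LocalHom.toHom_injective
    have h1 : LocalHom.toHom (LocalHom.ofHom (hS.exact.desc f.toHom h0)) =
      hS.exact.desc f.toHom h0 := LocalHom.toHom_ofHom _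
    rw [LocalHom.toHom_precomp, h1]
    exact hS.exact.g_desc _ _
  · intro U (f : LocalHom S.X₃ I U) (f' : LocalHom S.X₃ I U) h
    have h' : f.precomp S.g = f'.precomp S.g := h
    apply LocalHom.toHom_injective
    rw [← cancel_epi S.g, ← LocalHom.toHom_precomp, h', LocalHom.toHom_precomp]
  · intro U (f : LocalHom S.X₁ I U) p hp
    obtain ⟨g, hg⟩ := LocalHom.exists_extension S.f f
    exact ⟨U, le_rfl, (show LocalHom S.X₂ I U from g), hp, hg⟩

end Ext
end AlgebraicGeometry.Scheme.Modules

namespace AlgebraicGeometry.Scheme.Modules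

/-! ### Degree zero homology of a cochain complex. -/

section HomologyZero
variable {C : Type*} [Category C] [Abelian C]

/-- The morphism to `H⁰(K)` given by a morphism to `K⁰` killed by the differential. -/
noncomputable def toHomologyZero (K : CochainComplex C ℕ) {A : C} (k : A ⟶ K.X 0)
    (hk : k ≫ K.d 0 1 = 0) : A ⟶ K.homology 0 :=
  K.liftCycles k 1 (by simp) hk ≫ K.homologyπ 0

/-- Both `k` and the inclusion of cycles are kernels of the first differential, and nothing maps
into degree zero, so cycles are homology. -/
lemma isIso_toHomologyZero (K : CochainComplex C ℕ) {A : C} (k : A ⟶ K.X 0)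
    (hk : k ≫ K.d 0 1 = 0) (hm : Mono k) (h : (ShortComplex.mk k (K.d 0 1) hk).Exact) :
    IsIso (toHomologyZero K k hk) := by
  have : Mono (ShortComplex.mk k (K.d 0 1) hk).f := ‹Mono k›
  have hl : h.lift (K.iCycles 0) (K.iCycles_d 0 1) ≫ k = K.iCycles 0 := h.lift_f _ _
  have : IsIso (K.liftCycles k 1 (by simp) hk) := by
    refine ⟨h.lift (K.iCycles 0) (K.iCycles_d 0 1), ?_, ?_⟩
    · rw [← cancel_mono k, Category.assoc, hl, HomologicalComplex.liftCycles_i, Category.id_comp]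
    · rw [← cancel_mono (K.iCycles 0), Category.assoc, HomologicalComplex.liftCycles_i, hl,
        Category.id_comp]
  exact IsIso.comp_isIso

lemma toHomologyZero_naturality {K L : CochainComplex C ℕ} (φ : K ⟶ L) {A B : C} (k : A ⟶ K.X 0)
    (hk : k ≫ K.d 0 1 = 0) (l : B ⟶ L.X 0) (hl : l ≫ L.d 0 1 = 0) (a : A ⟶ B)
    (h : k ≫ φ.f 0 = a ≫ l) :
    toHomologyZero K k hk ≫ HomologicalComplex.homologyMap φ 0 = a ≫ toHomologyZero L l hl := by
  rw [toHomologyZero, toHomologyZero, Category.assoc, HomologicalComplex.homologyπ_naturality,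
    ← Category.assoc, ← Category.assoc]
  congr 1
  rw [← cancel_mono (HomologicalComplex.iCycles _ 0)]
  simp only [Category.assoc, HomologicalComplex.liftCycles_i, HomologicalComplex.cyclesMap_i,
    HomologicalComplex.liftCycles_i_assoc, h]

/-- The last term of an exact sequence, as a cokernel. -/
noncomputable def exactIsoCokernel {S : ShortComplex C} (hS : S.Exact) [Epi S.g] :
    S.X₃ ≅ cokernel S.f :=
  hS.gIsCokernel.coconePointUniqueUpToIso (colimit.isColimit _)

end HomologyZero

/-! ### `Ext¹` from a resolution of length one. -/

section Ext
variable {X : Scheme.{u}}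

/-- The complex `Hom(M, I)` for a complex `I`. -/
noncomputable abbrev homComplex (M : X.Modules) (I : CochainComplex X.Modules ℕ) :
    CochainComplex X.Modules ℕ :=
  ((sheafHomFunctor M).mapHomologicalComplex _).obj I

/-- Precomposition as a map of complexes. -/
noncomputable abbrev homComplexPrecomp {M' M : X.Modules} (a : M' ⟶ M)
    (I : CochainComplex X.Modules ℕ) : homComplex M I ⟶ homComplex M' I :=
  (NatTrans.mapHomologicalComplex (sheafHomPrecomp a) _).app I

lemma sheafHomPrecomp_comp_zero {S : ShortComplex X.Modules} (I : X.Modules) :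
    (sheafHomPrecomp S.g).app I ≫ (sheafHomPrecomp S.f).app I = 0 :=
  hom_ext_lin fun U => LinearMap.ext fun (f : LocalHom S.X₃ I U) => by
    change (f.precomp S.g).precomp S.f = 0
    ext V hV m
    have : appLin S.g V (appLin S.f V m) = 0 :=
      LinearMap.congr_fun (congrArg (appLin · V) S.zero) m
    simp [this]

/-- The complex of complexes `Hom(M₃, I) ⟶ Hom(M₂, I) ⟶ Hom(M₁, I)`. -/
noncomputable abbrev homShortComplex (S : ShortComplex X.Modules) (I : CochainComplex X.Modules ℕ) :
    ShortComplex (CochainComplex X.Modules ℕ) :=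
  ShortComplex.mk (homComplexPrecomp S.g I) (homComplexPrecomp S.f I) (by
    ext n : 1
    exact sheafHomPrecomp_comp_zero _)

lemma homShortComplex_shortExact {S : ShortComplex X.Modules} (hS : S.ShortExact) {N : X.Modules}
    (I : InjectiveResolution N) : (homShortComplex S I.cocomplex).ShortExact :=
  HomologicalComplex.shortExact_of_degreewise_shortExact _ fun n =>
    have := I.injective n
    sheafHomPrecomp_shortExact hS (I.cocomplex.X n)

/-- This is the vanishing of `Ext¹(M, N)`: for a vector bundle `M`, the functor `Hom(M, -)` keeps
the injective resolution exact in degree one. -/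
lemma isZero_homology_homComplex {M N : X.Modules} (hM : IsVectorBundle M)
    (I : InjectiveResolution N) : IsZero ((homComplex M I.cocomplex).homology 1) := by
  rw [← HomologicalComplex.exactAt_iff_isZero_homology,
    HomologicalComplex.exactAt_iff' _ 0 1 2 (by simp) (by simp)]
  exact sheafHom_exact_of_isVectorBundle hM (I.exact_succ 0)

/-- `Hom(M, N) ⟶ H⁰(Hom(M, I))`. -/
noncomputable def homToHomology (M : X.Modules) {N : X.Modules} (I : InjectiveResolution N) :
    (sheafHomFunctor M).obj N ⟶ (homComplex M I.cocomplex).homology 0 :=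
  toHomologyZero (homComplex M I.cocomplex) ((sheafHomFunctor M).map (I.ι.f 0)) (by
    change (sheafHomFunctor M).map (I.ι.f 0) ≫ (sheafHomFunctor M).map (I.cocomplex.d 0 1) = 0
    rw [← Functor.map_comp, I.ι_f_zero_comp_complex_d, Functor.map_zero])

instance (M : X.Modules) {N : X.Modules} (I : InjectiveResolution N) :
    IsIso (homToHomology M I) := by
  let S : ShortComplex X.Modules := ShortComplex.mk (I.ι.f 0) (I.cocomplex.d 0 1)
    I.ι_f_zero_comp_complex_d
  have : Mono S.f := inferInstanceAs (Mono (I.ι.f 0))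
  have hS : S.Exact := ShortComplex.exact_of_f_is_kernel _ I.isLimitKernelFork
  exact isIso_toHomologyZero (homComplex M I.cocomplex) ((sheafHomFunctor M).map (I.ι.f 0)) _
    (sheafHom_mono M (I.ι.f 0)) (sheafHom_exact_of_mono M hS)

lemma homToHomology_naturality {M' M : X.Modules} (a : M' ⟶ M) {N : X.Modules}
    (I : InjectiveResolution N) :
    homToHomology M I ≫ HomologicalComplex.homologyMap (homComplexPrecomp a I.cocomplex) 0 =
      (sheafHomPrecomp a).app N ≫ homToHomology M' I :=
  toHomologyZero_naturality (homComplexPrecomp a I.cocomplex) _ _ _ _ _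
    ((sheafHomPrecomp a).naturality (I.ι.f 0))

/-- `Ext¹(Q, N)` from a resolution of `Q` of length one whose middle term is a vector bundle. -/
theorem nonempty_sheafExt_one_iso {S : ShortComplex X.Modules} (hS : S.ShortExact)
    (h₂ : IsVectorBundle S.X₂) (N : X.Modules) :
    Nonempty (sheafExt 1 S.X₃ N ≅ cokernel ((sheafHomPrecomp S.f).app N)) := by
  let I : InjectiveResolution N := InjectiveResolution.of N
  have hE := homShortComplex_shortExact hS I
  -- In the long exact sequence the target after the connecting map is `Ext¹(S.X₂, N) = 0`, so
  -- `Ext¹(S.X₃, N)` is the cokernel of the map before it.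
  have hδ : Epi (hE.δ 0 1 rfl) :=
    (hE.homology_exact₁ 0 1 rfl).epi_f ((isZero_homology_homComplex h₂ I).eq_of_tgt _ _)
  have hex := hE.homology_exact₃ 0 1 rfl
  have e1 : (homComplex S.X₃ I.cocomplex).homology 1 ≅
      cokernel (HomologicalComplex.homologyMap (homComplexPrecomp S.f I.cocomplex) 0) :=
    exactIsoCokernel hex
  exact ⟨I.isoRightDerivedObj (sheafHomFunctor S.X₃) 1 ≪≫ e1 ≪≫
    (cokernel.mapIso _ _ (asIso (homToHomology S.X₂ I)) (asIso (homToHomology S.X₁ I))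
      (homToHomology_naturality S.f I).symm).symm⟩

end Ext
end AlgebraicGeometry.Scheme.Modules

/-! ### Linear algebra of `Φ - t` over a polynomial ring. -/

section CharacteristicMatrix
open Polynomial
variable {R S : Type*} [CommRing R] [CommRing S] {n : ℕ} (Φ : Matrix (Fin n) (Fin n) R)

/-- The evaluation `R[X]ⁿ ⟶ Rⁿ` with `X` acting on `Rⁿ` through `Φ`. -/
noncomputable def Matrix.evalVec (p : Fin n → R[X]) : Fin n → R :=
  ∑ j, (aeval Φ (p j)).mulVec (Pi.single j 1)

lemma Matrix.evalVec_C (r : Fin n → R) : Φ.evalVec (fun i => C (r i)) = r := by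
  ext i
  simp [evalVec, Algebra.algebraMap_eq_smul_one, Matrix.one_apply]

lemma Matrix.evalVec_smul (q : R[X]) (p : Fin n → R[X]) :
    Φ.evalVec (q • p) = (aeval Φ q).mulVec (Φ.evalVec p) := by
  simp only [evalVec, Pi.smul_apply, smul_eq_mul, map_mul, Matrix.mulVec_sum, Matrix.mulVec_mulVec]

/-- Polynomials in `Φ` commute with `Φ`. Together with `Matrix.evalVec_smul` for `q = X` it follows
that `evalVec` kills the image of `Φ - X`. -/
lemma Matrix.evalVec_mulVec (p : Fin n → R[X]) :
    Φ.evalVec ((Φ.map C).mulVec p) = Φ.mulVec (Φ.evalVec p) := by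
  have h (l : Fin n) : ∑ j, Φ j l • (Pi.single j 1 : Fin n → R) = Φ.mulVec (Pi.single l 1) := by
    ext i
    simp [Pi.single_apply]
  have h2 (j : Fin n) : (aeval Φ ((Φ.map C).mulVec p j)).mulVec (Pi.single j 1 : Fin n → R) =
      ∑ l, (aeval Φ (p l)).mulVec (Φ j l • (Pi.single j 1 : Fin n → R)) := by
    simp only [Matrix.mulVec_smul]
    simp only [Matrix.mulVec, dotProduct, Matrix.map_apply, map_sum, map_mul, aeval_C]
    ext i
    simp [Algebra.algebraMap_eq_smul_one, Matrix.sum_apply]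
  simp only [evalVec, h2]
  rw [Finset.sum_comm]
  simp only [← Matrix.mulVec_sum, h, Matrix.mulVec_mulVec]
  rw [Matrix.mulVec_sum]
  refine Finset.sum_congr rfl fun l _ => ?_
  rw [Matrix.mulVec_mulVec]
  refine congrArg (Matrix.mulVec · _) ?_
  have := congrArg (aeval Φ) (mul_comm (p l) X)
  rwa [map_mul, map_mul, aeval_X] at this

variable {f : R →+* S} {t : S}

lemma sub_scalar_mulVec (c : Fin n → S) :
    (Φ.map f - Matrix.scalar (Fin n) t).mulVec c = (Φ.map f).mulVec c - t • c := by
  rw [Matrix.sub_mulVec]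
  congr 1
  ext i
  simp [Matrix.mulVec_diagonal]

lemma map_mulVec_eval₂ (p : Fin n → R[X]) :
    (Φ.map f - Matrix.scalar (Fin n) t).mulVec (fun i => eval₂ f t (p i)) =
      fun i => eval₂ f t (((Φ.map C).mulVec p - (X : R[X]) • p) i) := by
  rw [sub_scalar_mulVec]
  ext i
  simp [Matrix.mulVec, dotProduct, eval₂_finsetSum, eval₂_mul]


/-- Since `t^(k+1) r = t^k Φ r - (Φ - t)(t^k r)`, the exponent of `t` drops modulo the image until
only a constant vector is left. -/
lemma exists_add_mulVec (hf : Function.Surjective (eval₂ f t)) (m : Fin n → S) : ∃ (r : Fin n → R) (c : Fin n → S),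
    m = f ∘ r + (Φ.map f - Matrix.scalar (Fin n) t).mulVec c := by
  let Q (m : Fin n → S) : Prop := ∃ (r : Fin n → R) (c : Fin n → S),
    m = f ∘ r + (Φ.map f - Matrix.scalar (Fin n) t).mulVec c
  have hadd (m m' : Fin n → S) (h : Q m) (h' : Q m') : Q (m + m') := by
    obtain ⟨r, c, rfl⟩ := h
    obtain ⟨r', c', rfl⟩ := h'
    refine ⟨r + r', c + c', ?_⟩
    rw [Matrix.mulVec_add]
    ext i
    simp
    ring
  have hpow (k : ℕ) : ∀ r : Fin n → R, Q (t ^ k • (f ∘ r)) := by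
    induction k with
    | zero => exact fun r => ⟨r, 0, by simp⟩
    | succ k ih =>
      intro r
      have h1 : t ^ (k + 1) • (f ∘ r) = t ^ k • (f ∘ (Φ.mulVec r)) +
          (Φ.map f - Matrix.scalar (Fin n) t).mulVec (-(t ^ k • (f ∘ r))) := by
        rw [sub_scalar_mulVec, Matrix.mulVec_neg, Matrix.mulVec_smul]
        have : f ∘ (Φ.mulVec r) = (Φ.map f).mulVec (f ∘ r) := funext fun i => RingHom.map_mulVec f Φ r i
        rw [this]
        ext i
        simp
        ring
      rw [h1]
      exact hadd _ _ (ih _) ⟨0, _, funext fun _ => by simp; rfl⟩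
  choose p hp using fun i => hf (m i)
  -- Each coordinate is a polynomial in `t`; the sum of the degrees serves as a common degree bound.
  have hm : m = ∑ k ∈ Finset.range (∑ i, (p i).natDegree + 1),
      t ^ k • (f ∘ fun i => (p i).coeff k) := by
    ext i
    rw [← hp i, eval₂_eq_sum_range' f (Nat.lt_succ_of_le
      (Finset.single_le_sum (f := fun i => (p i).natDegree) (fun _ _ => Nat.zero_le _)
        (Finset.mem_univ i)))]
    simp [mul_comm]
  rw [hm]
  exact Finset.sum_induction _ Q hadd ⟨0, 0, by ext; simp⟩ fun k _ => hpow k _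

/-- Lift the equation to `R[X]` and apply `evalVec`, which fixes constant vectors and kills the
image of `Φ - X`. -/
lemma eq_zero_of_mulVec_eq {r : Fin n → R} {c : Fin n → S}
    (hf : Function.Bijective (eval₂ f t))
    (h : f ∘ r = (Φ.map f - Matrix.scalar (Fin n) t).mulVec c) : r = 0 := by
  choose p hp using fun i => hf.2 (c i)
  obtain rfl : (fun i => eval₂ f t (p i)) = c := funext hp
  rw [map_mulVec_eval₂ Φ] at h
  have h' : (fun i => C (r i)) = (Φ.map C).mulVec p - (X : R[X]) • p :=
    funext fun i => hf.1 (by simpa using congrFun h i)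
  have h2 := congrArg Φ.evalVec h'
  have hs (p p' : Fin n → R[X]) : Φ.evalVec (p - p') = Φ.evalVec p - Φ.evalVec p' := by
    simp only [Matrix.evalVec, Pi.sub_apply, map_sub, Matrix.sub_mulVec, Finset.sum_sub_distrib]
  rw [Matrix.evalVec_C, hs, Matrix.evalVec_mulVec, Matrix.evalVec_smul, aeval_X, sub_self] at h2
  exact h2

/-- The adjugate of the characteristic matrix gives `charpoly • p = 0`, and a monic polynomial is
not a zero divisor. -/
lemma eq_zero_of_mulVec_eq_zero {c : Fin n → S}
    (hf : Function.Bijective (eval₂ f t))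
    (h : (Φ.map f - Matrix.scalar (Fin n) t).mulVec c = 0) : c = 0 := by
  choose p hp using fun i => hf.2 (c i)
  obtain rfl : (fun i => eval₂ f t (p i)) = c := funext hp
  rw [map_mulVec_eval₂ Φ] at h
  have h' : Φ.charmatrix.mulVec p = 0 := by
    have : (Φ.map C).mulVec p - (X : R[X]) • p = 0 :=
      funext fun i => hf.1 (by simpa using congrFun h i)
    rw [sub_eq_zero] at this
    rw [Matrix.charmatrix, Matrix.sub_mulVec, sub_eq_zero, RingHom.mapMatrix_apply, this]
    ext i
    simp [Matrix.mulVec_diagonal]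
  have h2 : Φ.charpoly • p = 0 := by
    have := congrArg (Φ.charmatrix.adjugate.mulVec ·) h'
    simp only [Matrix.mulVec_mulVec, Matrix.adjugate_mul, Matrix.mulVec_zero, Matrix.smul_mulVec,
      Matrix.one_mulVec] at this
    exact this
  have h3 : p = 0 := funext fun i => by
    have := congrFun h2 i
    rw [Pi.smul_apply, smul_eq_mul, mul_comm] at this
    exact (Matrix.charpoly_monic Φ).mem_nonZeroDivisors.2 _ this
  ext i
  simp [h3]

end CharacteristicMatrix

namespace AlgebraicGeometry.Scheme.Modules

/-! ### Sections over affine opens: clearing denominators for framed modules. -/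

section AffineSections
variable {X : Scheme.{u}} {M₁ M F : X.Modules} {V : X.Opens} {n : ℕ}

lemma exists_resO_eq_pow_mul (hV : IsAffineOpen V) (f : Γ(X, V)) (x : Γ(X, X.basicOpen f)) :
    ∃ (N : ℕ) (y : Γ(X, V)), resO X (X.basicOpen_le f) y = resO X (X.basicOpen_le f) f ^ N * x := by
  have := hV.isLocalization_basicOpen f
  obtain ⟨N, y, h⟩ := IsLocalization.Away.surj f x
  exact ⟨N, y, by rw [mul_comm]; exact h.symm⟩

lemma exists_pow_mul_eq_zero (hV : IsAffineOpen V) (f : Γ(X, V)) (x : Γ(X, V))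
    (hx : resO X (X.basicOpen_le f) x = 0) : ∃ N : ℕ, f ^ N * x = 0 := by
  have := hV.isLocalization_basicOpen f
  obtain ⟨⟨_, N, rfl⟩, h⟩ := (IsLocalization.map_eq_zero_iff (Submonoid.powers f)
    Γ(X, X.basicOpen f) x).mp hx
  exact ⟨N, h⟩

lemma exists_res_eq_pow_smul (hV : IsAffineOpen V) {e : Fin n → Γ(M, V)} (he : IsFrameFam e)
    (f : Γ(X, V)) (x : Γ(M, X.basicOpen f)) :
    ∃ (N : ℕ) (y : Γ(M, V)),
      res M (X.basicOpen_le f) y = resO X (X.basicOpen_le f) f ^ N • x := by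
  obtain ⟨c, rfl⟩ := (he _ (X.basicOpen_le f)).2 x
  choose N y hy using fun i => exists_resO_eq_pow_mul hV f (c i)
  -- The sum of the exponents is a common denominator for all coordinates; the difference `∑ N - N
  -- i` makes up for the `i`-th one.
  refine ⟨∑ i, N i, ∑ i, (f ^ (∑ i, N i - N i) * y i) • e i, ?_⟩
  have hN (i : Fin n) : ∑ i, N i = ∑ i, N i - N i + N i :=
    (Nat.sub_add_cancel (Finset.single_le_sum (fun _ _ => Nat.zero_le _) (Finset.mem_univ i))).symm
  simp only [map_sum, res_smul, map_mul, map_pow, hy, Finset.smul_sum, smul_smul, ← mul_assoc,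
    ← pow_add, ← hN]

lemma exists_pow_smul_eq_zero (hV : IsAffineOpen V) {e : Fin n → Γ(M, V)} (he : IsFrameFam e)
    (f : Γ(X, V)) (x : Γ(M, V)) (hx : res M (X.basicOpen_le f) x = 0) :
    ∃ N : ℕ, f ^ N • x = 0 := by
  obtain ⟨c, rfl⟩ := (he V le_rfl).2 x
  have hc (i : Fin n) : resO X (X.basicOpen_le f) (c i) = 0 := by
    have : (fun i => resO X (X.basicOpen_le f) (c i)) = 0 :=
      (he _ (X.basicOpen_le f)).1 (by simpa [res_smul] using hx)
    exact congrFun this i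
  choose N hN using fun i => exists_pow_mul_eq_zero hV f (c i) (hc i)
  refine ⟨∑ i, N i, ?_⟩
  have hN' (i : Fin n) : f ^ (∑ i, N i) * c i = 0 := by
    rw [← Nat.sub_add_cancel (Finset.single_le_sum (f := N) (fun _ _ => Nat.zero_le _) (Finset.mem_univ i)),
      pow_add, mul_assoc, hN, mul_zero]
  simp [Finset.smul_sum, smul_smul, hN']

/-- Sections over a basic open are fractions of sections over `V`: clear the denominator of `x`,
then a further power of `f` kills the image already over `V`, where `a` is injective. -/
lemma injective_basicOpen (hV : IsAffineOpen V) {e : Fin n → Γ(M, V)} (he : IsFrameFam e)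
    {N : X.Modules} {m : ℕ} {e' : Fin m → Γ(N, V)} (he' : IsFrameFam e') (a : M ⟶ N)
    (ha : Function.Injective (appLin a V)) (f : Γ(X, V)) :
    Function.Injective (appLin a (X.basicOpen f)) := by
  rw [injective_iff_map_eq_zero]
  intro x hx
  have hu : IsUnit (resO X (X.basicOpen_le f) f) := X.toRingedSpace.isUnit_res_basicOpen f
  obtain ⟨k, y, hy⟩ := exists_res_eq_pow_smul hV he f x
  obtain ⟨l, hl⟩ := exists_pow_smul_eq_zero hV he' f (appLin a V y) (by
    rw [← appLin_res, hy, LinearMap.map_smul, hx, smul_zero])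
  rw [← LinearMap.map_smul] at hl
  have h0 : f ^ l • y = 0 := ha (hl.trans (map_zero _).symm)
  have := congrArg (res M (X.basicOpen_le f)) h0
  rw [res_smul, hy, smul_smul, map_pow, ← pow_add, res_zero] at this
  exact (hu.pow _).smul_eq_zero.mp this

/-- Over the basic open, `m` comes from `S.X₁` by left exactness. After clearing denominators that
lift lives over `V`, and its difference from a multiple of `m` is killed by a power of `f`. -/
lemma exists_pow_smul_appLin_eq_zero {S : ShortComplex X.Modules} (hS : S.ShortExact)
    (hV : IsAffineOpen V) (h₁ : HasFrame S.X₁ V) (h₂ : HasFrame S.X₂ V) (f : Γ(X, V))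
    (m : Γ(S.X₂, V)) (hm : res S.X₃ (X.basicOpen_le f) (appLin S.g V m) = 0) :
    ∃ N : ℕ, f ^ N • appLin S.g V m = 0 := by
  have := hS.mono_f
  obtain ⟨n, e, he⟩ := h₁
  obtain ⟨n', e', he'⟩ := h₂
  have hgf (W : X.Opens) (z : Γ(S.X₁, W)) : appLin S.g W (appLin S.f W z) = 0 :=
    LinearMap.congr_fun (congrArg (appLin · W) S.zero) z
  obtain ⟨y, hy⟩ := exists_of_exact_of_mono hS.exact (res S.X₂ (X.basicOpen_le f) m) (by
    rw [appLin_res, hm])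
  obtain ⟨k, z, hz⟩ := exists_res_eq_pow_smul hV he f y
  obtain ⟨l, hl⟩ := exists_pow_smul_eq_zero hV he' f (f ^ k • m - appLin S.f V z) (by
    rw [map_sub, res_smul, ← appLin_res, hz, LinearMap.map_smul, hy, map_pow, sub_self])
  refine ⟨l + k, ?_⟩
  have := congrArg (appLin S.g V) hl
  rwa [LinearMap.map_smul, map_sub, hgf, sub_zero, LinearMap.map_smul, smul_smul, ← pow_add,
    map_zero] at this

/-- Sections over an affine open of the cokernel of an injective map between framed modules. -/
theorem surjective_of_isAffineOpen {S : ShortComplex X.Modules} (hS : S.ShortExact)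
    (hV : IsAffineOpen V) (h₁ : HasFrame S.X₁ V) (h₂ : HasFrame S.X₂ V) :
    Function.Surjective (appLin S.g V) := by
  have := hS.mono_f
  have := hS.epi_g
  have hcover (s : Γ(S.X₃, V)) (p : X) (hp : p ∈ V) : ∃ (f : Γ(X, V)), p ∈ X.basicOpen f ∧
      ∃ m, appLin S.g _ m = res S.X₃ (X.basicOpen_le f) s := by
    obtain ⟨W, hW, m, hpW, hm⟩ := locSurj_of_epi S.g V s p hp
    obtain ⟨f, hf, hpf⟩ := hV.exists_basicOpen_le (V := W) ⟨p, hpW⟩ hp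
    exact ⟨f, hpf, res _ hf m, by rw [appLin_res, hm, res_res]⟩
  -- Torsion for arbitrary sections of the cokernel: a lift exists only locally, so the preceding
  -- lemma is applied on basic opens `D(g)` that carry a lift, and finitely many of them cover `V`.
  have hzero (s : Γ(S.X₃, V)) (f : Γ(X, V)) (hs : res S.X₃ (X.basicOpen_le f) s = 0) :
      ∃ N : ℕ, f ^ N • s = 0 := by
    choose g hg m hm using hcover s
    let P : Set Γ(X, V) := {g | ∃ N : ℕ, res S.X₃ (X.basicOpen_le g) (f ^ N • s) = 0}
    have hP (p : X) (hp : p ∈ V) : g p hp ∈ P := by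
      obtain ⟨N, hN⟩ := exists_pow_smul_appLin_eq_zero hS (hV.basicOpen (g p hp))
        (h₁.mono (X.basicOpen_le _)) (h₂.mono (X.basicOpen_le _))
        (resO X (X.basicOpen_le (g p hp)) f) (m p hp) (by
          have hle : X.basicOpen (resO X (X.basicOpen_le (g p hp)) f) ≤ X.basicOpen f :=
            (X.basicOpen_res _ _).le.trans inf_le_right
          rw [hm, res_res, ← res_res _ (X.basicOpen_le f) hle, hs, res_zero])
      rw [hm] at hN
      exact ⟨N, by rw [res_smul, map_pow, hN]⟩
    have hspan : Ideal.span P = ⊤ := by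
      rw [← hV.iSup_basicOpen_eq_self_iff]
      exact le_antisymm (iSup_le fun i => X.basicOpen_le _) fun p hp =>
        Opens.mem_iSup.mpr ⟨⟨_, hP p hp⟩, hg p hp⟩
    obtain ⟨t, htP, ht⟩ := (Ideal.span_eq_top_iff_finite _).mp hspan
    choose N hN using fun g : t => htP g.2
    rw [← hV.iSup_basicOpen_eq_self_iff] at ht
    refine ⟨∑ g, N g, eq_of_locally_eq _ _ fun p hp => ?_⟩
    obtain ⟨g, hpg⟩ := Opens.mem_iSup.mp (ht.ge hp)
    refine ⟨X.basicOpen g.1, X.basicOpen_le _, hpg, ?_⟩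
    rw [res_zero, ← Nat.sub_add_cancel (Finset.single_le_sum (f := N) (fun _ _ => Nat.zero_le _)
      (Finset.mem_univ g)), pow_add, mul_smul, res_smul, hN, smul_zero]
  intro s
  -- The multipliers that bring `s` into the image form an ideal. It contains a power of every `f`
  -- for which `s` lifts over `D(f)`, and such `D(f)` cover `V`, so it contains `1`.
  let I : Ideal Γ(X, V) :=
    { carrier := {f | f • s ∈ LinearMap.range (appLin S.g V)}
      add_mem' := fun {a b} ha hb => by
        simp only [Set.mem_ofPred_eq, add_smul]
        exact add_mem ha hb
      zero_mem' := by simpa using ⟨0, map_zero _⟩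
      smul_mem' := fun c f hf => by
        simp only [Set.mem_ofPred_eq, smul_assoc]
        exact Submodule.smul_mem _ c hf }
  have hI (f : Γ(X, V)) (m : Γ(S.X₂, X.basicOpen f))
      (hm : appLin S.g _ m = res S.X₃ (X.basicOpen_le f) s) : ∃ N : ℕ, f ^ N ∈ I := by
    obtain ⟨n, e, he⟩ := h₂
    obtain ⟨k, y, hy⟩ := exists_res_eq_pow_smul hV he f m
    obtain ⟨l, hl⟩ := hzero (f ^ k • s - appLin S.g V y) f (by
      rw [map_sub, res_smul, ← appLin_res, hy, LinearMap.map_smul, hm, map_pow, sub_self])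
    refine ⟨l + k, f ^ l • y, ?_⟩
    rw [smul_sub, sub_eq_zero] at hl
    rw [LinearMap.map_smul, ← hl, smul_smul, ← pow_add]
  have htop : I = ⊤ := by
    rw [← Ideal.span_eq I, ← hV.iSup_basicOpen_eq_self_iff]
    refine le_antisymm (iSup_le fun i => X.basicOpen_le _) fun p hp => ?_
    obtain ⟨f, hpf, m, hm⟩ := hcover s p hp
    obtain ⟨N, hN⟩ := hI f m hm
    -- The exponent is raised to `N + 1` because `D(f^m) = D(f)` needs `m > 0`.
    refine Opens.mem_iSup.mpr ⟨⟨f ^ (N + 1), pow_succ' f N ▸ I.mul_mem_left f hN⟩, ?_⟩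
    rwa [Scheme.basicOpen_pow _ _ N.succ_pos]
  obtain ⟨y, hy⟩ := (I.eq_top_iff_one.mp htop : (1 : Γ(X, V)) • s ∈ LinearMap.range (appLin S.g V))
  exact ⟨y, by rw [hy, one_smul]⟩

end AffineSections
end AlgebraicGeometry.Scheme.Modules

namespace AlgebraicGeometry.Scheme.Modules

/-! ### The characteristic morphism in a spectral chart. -/

section SpectralChart
variable {B X : Scheme.{u}} {K : B.Modules} {π : X ⟶ B} {τ : Γ((pullback π).obj K, ⊤)}
  {U : B.Opens}

/-- An affine open `U` of `B` with a frame `k` of `K|_U` and a fibre coordinate `t` such that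
`τ = t k` and `Γ(B, U)[t] = Γ(X, π⁻¹ U)`. -/
structure SpectralChart (π : X ⟶ B) (τ : Γ((pullback π).obj K, ⊤)) (U : B.Opens) where
  k : Γ(K, U)
  t : Γ(X, π ⁻¹ᵁ U)
  isAffineOpen : IsAffineOpen U
  isFrame : IsFrame k
  res_eq : res _ le_top τ = t • pullbackSection π k
  bijective : Function.Bijective (Polynomial.eval₂ (π.app U).hom t)

namespace SpectralChart
variable (c : SpectralChart π τ U) (P : HiggsPair K)

lemma appLin_mulSection (F : X.Modules) (x : Γ(F, π ⁻¹ᵁ U)) :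
    appLin (mulSection F τ) (π ⁻¹ᵁ U) x = c.t • tmul x (pullbackSection π c.k) := by
  change tmul x (res _ le_top τ) = _
  rw [c.res_eq, tmul_smul]

/-- The endomorphism `φ_k` of `E|_U`, with `φ(e) = φ_k(e) ⊗ k`. -/
noncomputable def endo : LocalHom P.E P.E U := coefHom P.φ c.isFrame

lemma tmul_endo (e : Γ(P.E, U)) : tmul ((c.endo P).app U le_rfl e) c.k = appLin P.φ U e := by
  have := tmul_coefHom P.φ c.isFrame le_rfl e
  rwa [res_self] at this

lemma appLin_charMap (e : Γ(P.E, U)) :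
    appLin (P.charMap π τ) (π ⁻¹ᵁ U) (pullbackSection π e) =
      tmul (pullbackSection π ((c.endo P).app U le_rfl e) - c.t • pullbackSection π e)
        (pullbackSection π c.k) := by
  have h1 : appLin ((pullback π).map P.φ ≫ pullbackTensor π P.E K) (π ⁻¹ᵁ U)
      (pullbackSection π e) =
        tmul (pullbackSection π ((c.endo P).app U le_rfl e)) (pullbackSection π c.k) := by
    rw [appLin_comp, LinearMap.comp_apply, pullback_map_pullbackSection, ← c.tmul_endo P,
      pullbackTensor_pullbackSection]
  have h2 := c.appLin_mulSection _ (pullbackSection π e)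
  rw [← smul_tmul] at h2
  have h3 : appLin (P.charMap π τ) (π ⁻¹ᵁ U) (pullbackSection π e) =
      appLin ((pullback π).map P.φ ≫ pullbackTensor π P.E K) (π ⁻¹ᵁ U) (pullbackSection π e) -
        appLin (mulSection _ τ) (π ⁻¹ᵁ U) (pullbackSection π e) := rfl
  rw [h3, h1, h2]
  exact (LinearMap.map_sub₂ ((tmulBilin _ _).app _) _ _ _).symm

/-- `π^*φ - τ : π^* E ⊗ (π^* K)^* ⟶ π^* E`. -/
noncomputable abbrev _root_.AlgebraicGeometry.Scheme.Modules.HiggsPair.charHom (π : X ⟶ B)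
    (τ : Γ((pullback π).obj K, ⊤)) :
    tensor ((pullback π).obj P.E) (Modules.dual ((pullback π).obj K)) ⟶ (pullback π).obj P.E :=
  untwist (P.charMap π τ)

lemma appLin_charHom {κ : Γ(Modules.dual ((pullback π).obj K), π ⁻¹ᵁ U)}
    (hκ : pair κ (pullbackSection π c.k) = 1) (e : Γ(P.E, U)) :
    appLin (P.charHom π τ) (π ⁻¹ᵁ U) (tmul (pullbackSection π e) κ) =
      pullbackSection π ((c.endo P).app U le_rfl e) - c.t • pullbackSection π e := by
  rw [appLin_untwist, c.appLin_charMap, evalAt_contractRight, hκ, one_smul]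

/-- The matrix of `φ_k` with respect to a frame. -/
noncomputable def matrix {n : ℕ} {e : Fin n → Γ(P.E, U)} (he : IsFrameFam e) :
    Matrix (Fin n) (Fin n) Γ(B, U) :=
  Matrix.of fun i j => (he.equiv le_rfl).symm ((c.endo P).app U le_rfl (e j)) i

lemma endo_frame {n : ℕ} {e : Fin n → Γ(P.E, U)} (he : IsFrameFam e) (j : Fin n) :
    (c.endo P).app U le_rfl (e j) = ∑ i, c.matrix P he i j • e i := by
  have := (he.equiv le_rfl).apply_symm_apply ((c.endo P).app U le_rfl (e j))
  simp only [IsFrameFam.equiv_apply, res_self] at this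
  exact this.symm

/-- The bridge to matrices: in the frames `eⱼ ⊗ κ` and `eᵢ` the characteristic morphism is `Φ - t`.
-/
lemma appLin_charHom_sum {κ : Γ(Modules.dual ((pullback π).obj K), π ⁻¹ᵁ U)}
    (hκ : pair κ (pullbackSection π c.k) = 1) {n : ℕ} {e : Fin n → Γ(P.E, U)} (he : IsFrameFam e)
    (a : Fin n → Γ(X, π ⁻¹ᵁ U)) :
    appLin (P.charHom π τ) (π ⁻¹ᵁ U) (∑ j, a j • tmul (pullbackSection π (e j)) κ) =
      ∑ i, (((c.matrix P he).map (π.app U).hom - Matrix.scalar (Fin n) c.t).mulVec a) i •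
        pullbackSection π (e i) := by
  simp only [map_sum, LinearMap.map_smul, c.appLin_charHom P hκ, c.endo_frame P he,
    pullbackSection_sum, pullbackSection_smul, sub_scalar_mulVec]
  simp only [smul_sub, Finset.sum_sub_distrib, Pi.sub_apply, sub_smul, Pi.smul_apply, smul_smul,
    smul_eq_mul, Matrix.mulVec, dotProduct, Matrix.map_apply, Finset.sum_smul, Finset.smul_sum]
  rw [Finset.sum_comm]
  simp only [mul_comm]

lemma exists_dualFrame (c : SpectralChart π τ U) : ∃ κ : Γ(Modules.dual ((pullback π).obj K), π ⁻¹ᵁ U),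
    IsFrame κ ∧ pair κ (pullbackSection π c.k) = 1 :=
  exists_dual_frame (c.isFrame.pullback π)

variable {P}

lemma injective_charHom (c : SpectralChart π τ U) (hE : HasFrame P.E U) :
    Function.Injective (appLin (P.charHom π τ) (π ⁻¹ᵁ U)) := by
  obtain ⟨n, e, he⟩ := hE
  obtain ⟨κ, hκ, hκ1⟩ := c.exists_dualFrame
  rw [injective_iff_map_eq_zero]
  intro x hx
  obtain ⟨a, rfl⟩ := (((he.pullback π).tmul hκ).equiv le_rfl).surjective x
  simp only [IsFrameFam.equiv_apply, res_self] at hx ⊢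
  rw [c.appLin_charHom_sum P hκ1 he] at hx
  have h0 : ((c.matrix P he).map (π.app U).hom - Matrix.scalar (Fin n) c.t).mulVec a = 0 :=
    (he.pullback π _ le_rfl).1 (by simpa using hx)
  simp [eq_zero_of_mulVec_eq_zero _ c.bijective h0]

end SpectralChart

/-- The affine opens of `B` with a spectral chart form a basis. -/
def HasSpectralCharts (π : X ⟶ B) (τ : Γ((pullback π).obj K, ⊤)) : Prop :=
  IsNhdBasis fun U : B.Opens => Nonempty (SpectralChart π τ U)

lemma HasSpectralCharts.isLineBundle (h : HasSpectralCharts π τ) : IsLineBundle K := fun x => by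
  obtain ⟨U, ⟨c⟩, hx, -⟩ := h ⊤ x trivial
  exact ⟨U, hx, c.k, c.isFrame⟩

lemma IsNhdBasis.preimage {Q : B.Opens → Prop} (hQ : IsNhdBasis Q) (f : X ⟶ B) :
    IsNhdBasis fun W : X.Opens => ∃ U, Q U ∧ W ≤ f ⁻¹ᵁ U := fun V p hp => by
  obtain ⟨U, hU, hpU, -⟩ := hQ ⊤ (f p) trivial
  exact ⟨V ⊓ f ⁻¹ᵁ U, ⟨U, hU, inf_le_right⟩, ⟨hp, hpU⟩, inf_le_left⟩

/-- The characteristic polynomial gives injectivity only over the opens `π⁻¹U`, which are no basis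
of `X`. They are affine, so their basic opens form a basis, and injectivity passes to basic opens.
-/
theorem HasSpectralCharts.mono_charHom [IsAffineHom π] (h : HasSpectralCharts π τ) {P : HiggsPair K}
    (hE : IsVectorBundle P.E) : Mono (P.charHom π τ) := by
  have hb := hE.isNhdBasis_and h
  have hb' : IsNhdBasis fun W : X.Opens => ∃ U, (Nonempty (SpectralChart π τ U) ∧ HasFrame P.E U) ∧
      ∃ f : Γ(X, π ⁻¹ᵁ U), W = X.basicOpen f := fun V p hp => by
    obtain ⟨U, ⟨⟨c⟩, hU⟩, hpU, -⟩ := hb ⊤ (π p) trivial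
    obtain ⟨f, hf, hpf⟩ := (c.isAffineOpen.preimage π).exists_basicOpen_le (V := V) ⟨p, hp⟩ hpU
    exact ⟨_, ⟨U, ⟨⟨c⟩, hU⟩, f, rfl⟩, hpf, hf⟩
  refine mono_of_injective _ (injective_of_basis hb' _ ?_)
  rintro _ ⟨U, ⟨⟨c⟩, hU⟩, f, rfl⟩
  obtain ⟨n, e, he⟩ := hU
  obtain ⟨κ, hκ, -⟩ := c.exists_dualFrame
  exact injective_basicOpen (c.isAffineOpen.preimage π) ((he.pullback π).tmul hκ) (he.pullback π) _
    (c.injective_charHom ⟨n, e, he⟩) f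

end SpectralChart
end AlgebraicGeometry.Scheme.Modules

namespace AlgebraicGeometry.Scheme.Modules

/-! ### Pulling the spectral sheaf back along `σ`. -/

section Negation
variable {B X : Scheme.{u}} {K : B.Modules} {π : X ⟶ B} {τ : Γ((pullback π).obj K, ⊤)}
  {U : B.Opens} {P : HiggsPair K}

/-- A map that kills `φ_k - t` makes `t` act as `φ_k`. This relation is the local form in which
cokernels of the characteristic morphism are handled. -/
lemma SpectralChart.apply_endo (c : SpectralChart π τ U) {N : X.Modules}
    {g : (pullback π).obj P.E ⟶ N} (hg : P.charHom π τ ≫ g = 0) (e : Γ(P.E, U)) :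
    appLin g (π ⁻¹ᵁ U) (pullbackSection π ((c.endo P).app U le_rfl e)) =
      c.t • appLin g (π ⁻¹ᵁ U) (pullbackSection π e) := by
  obtain ⟨κ, -, hκ⟩ := c.exists_dualFrame
  have := LinearMap.congr_fun (congrArg (appLin · (π ⁻¹ᵁ U)) hg) (tmul (pullbackSection π e) κ)
  rw [appLin_comp, LinearMap.comp_apply, c.appLin_charHom P hκ, map_sub, LinearMap.map_smul] at this
  exact sub_eq_zero.mp this

/-- The converse of `SpectralChart.apply_endo`: vanishing can be tested on the frames `eᵢ ⊗ κ` of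
charts. -/
lemma charHom_comp_eq_zero (hE : IsVectorBundle P.E) {N : X.Modules} (g : (pullback π).obj P.E ⟶ N)
    (h : IsNhdBasis fun U : B.Opens => ∃ c : SpectralChart π τ U, ∀ e : Γ(P.E, U),
      appLin g (π ⁻¹ᵁ U) (pullbackSection π ((c.endo P).app U le_rfl e)) =
        c.t • appLin g (π ⁻¹ᵁ U) (pullbackSection π e)) :
    P.charHom π τ ≫ g = 0 := by
  refine hom_ext_basis ((hE.isNhdBasis_and h).preimage π) ?_
  rintro W ⟨U, ⟨⟨c, hc⟩, n, e, he⟩, hW⟩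
  obtain ⟨κ, hκ, hκ1⟩ := c.exists_dualFrame
  refine appLin_eq_of_frame ((he.pullback π).tmul hκ) (fun i => ?_) hW
  rw [appLin_comp, LinearMap.comp_apply, c.appLin_charHom P hκ1, map_sub, LinearMap.map_smul, hc,
    sub_self]
  rfl

variable (π τ P) in
/-- The projection `π^* E ⟶ E_φ` to the spectral sheaf. -/
noncomputable def _root_.AlgebraicGeometry.Scheme.Modules.HiggsPair.toSpectralSheaf :
    (pullback π).obj P.E ⟶ P.spectralSheaf π τ := cokernel.π (P.charHom π τ)

lemma charHom_comp_toSpectralSheaf : P.charHom π τ ≫ P.toSpectralSheaf π τ = 0 :=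
  cokernel.condition _

instance : Epi (P.toSpectralSheaf π τ) := inferInstanceAs (Epi (cokernel.π (P.charHom π τ)))

lemma exists_toSpectralSheaf_comp_eq {N : X.Modules} (g : (pullback π).obj P.E ⟶ N)
    (hg : P.charHom π τ ≫ g = 0) : ∃ l, P.toSpectralSheaf π τ ≫ l = g :=
  ⟨cokernel.desc _ g hg, cokernel.π_desc _ _ _⟩

variable {σ : X ⟶ X} (hσ : σ ≫ π = π)

/-- `σ^* t = -t` for the fibre coordinate `t`. -/
def SpectralChart.IsNegatedBy (c : SpectralChart π τ U) (hσ : σ ≫ π = π) : Prop :=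
  (σ.app (π ⁻¹ᵁ U)).hom c.t = -resO X (by rw [← Scheme.Hom.comp_preimage, hσ]) c.t

/-- `(E, -φ)`. -/
noncomputable abbrev _root_.AlgebraicGeometry.Scheme.Modules.HiggsPair.neg (P : HiggsPair K) :
    HiggsPair K := ⟨P.E, -P.φ⟩

lemma SpectralChart.endo_neg (c : SpectralChart π τ U) (e : Γ(P.E, U)) :
    (c.endo P.neg).app U le_rfl e = -(c.endo P).app U le_rfl e :=
  coefHom_neg P.φ c.isFrame le_rfl e

/-- `π^* E ≅ σ^* π^* E`. -/
noncomputable def pullbackIso (E : B.Modules) :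
    (pullback π).obj E ≅ (pullback σ).obj ((pullback π).obj E) :=
  ((pullbackComp σ π).app E ≪≫ (pullbackCongr hσ).app E).symm

lemma pullbackIso_inv (E : B.Modules) (e : Γ(E, U)) :
    appLin (pullbackIso hσ E).inv (σ ⁻¹ᵁ π ⁻¹ᵁ U) (pullbackSection σ (pullbackSection π e)) =
      res _ (by rw [← Scheme.Hom.comp_preimage, hσ]) (pullbackSection π e) := by
  rw [pullbackIso, Iso.symm_inv, Iso.trans_hom, appLin_comp, LinearMap.comp_apply, Iso.app_hom,
    Iso.app_hom, pullbackComp_pullbackSection]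
  exact pullbackCongr_pullbackSection hσ e

lemma pullbackIso_hom (E : B.Modules) (e : Γ(E, U)) :
    appLin (pullbackIso hσ E).hom (π ⁻¹ᵁ U) (pullbackSection π e) =
      res _ (by rw [← Scheme.Hom.comp_preimage, hσ])
        (pullbackSection σ (pullbackSection π e)) := by
  apply (bijective_of_isIso (pullbackIso hσ E).inv _).1
  rw [appLin_res, pullbackIso_inv, res_res, res_self, ← LinearMap.comp_apply, ← appLin_comp,
    Iso.hom_inv_id]
  rfl

/-- The sign of `-φ_k` is absorbed by `σ^*t = -t`: the relation `φ_k = t` pulls back to `-φ_k = t`.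
-/
lemma charHom_neg_comp_eq_zero (hE : IsVectorBundle P.E)
    (h : IsNhdBasis fun U : B.Opens => ∃ c : SpectralChart π τ U, c.IsNegatedBy hσ)
    {N : X.Modules} {q : (pullback π).obj P.E ⟶ N} (hq : P.charHom π τ ≫ q = 0) :
    P.neg.charHom π τ ≫ (pullbackIso hσ P.E).hom ≫ (pullback σ).map q = 0 := by
  refine charHom_comp_eq_zero (P := P.neg) hE _ fun V p hp => ?_
  obtain ⟨U, ⟨c, hc⟩, hpU, hU⟩ := h V p hp
  refine ⟨U, ⟨c, fun e => ?_⟩, hpU, hU⟩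
  have key (e : Γ(P.E, U)) : appLin ((pullbackIso hσ P.E).hom ≫ (pullback σ).map q) (π ⁻¹ᵁ U)
      (pullbackSection π e) = res _ (by rw [← Scheme.Hom.comp_preimage, hσ])
        (pullbackSection σ (appLin q _ (pullbackSection π e))) := by
    rw [appLin_comp, LinearMap.comp_apply, pullbackIso_hom, appLin_res,
      pullback_map_pullbackSection]
  rw [key, key, c.endo_neg]
  have h1 : pullbackSection π (-(c.endo P).app U le_rfl e) =
      -pullbackSection π ((c.endo P).app U le_rfl e) := (appLin (pullbackUnit π P.E) U).map_neg _
  have h2 (x : Γ(N, π ⁻¹ᵁ U)) : pullbackSection σ (-x) = -pullbackSection σ x :=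
    (appLin (pullbackUnit σ N) _).map_neg _
  rw [h1, map_neg, c.apply_endo hq, h2, pullbackSection_smul, hc, neg_smul, neg_neg, res_smul,
    resO_resO, resO_self]

/-- The same sign exchange for the adjoint map to `σ_* N`, on which `t` acts through `σ^*t`. -/
lemma charHom_comp_homEquiv_eq_zero (hE : IsVectorBundle P.E)
    (h : IsNhdBasis fun U : B.Opens => ∃ c : SpectralChart π τ U, c.IsNegatedBy hσ)
    {N : X.Modules} {g : (pullback π).obj P.E ⟶ N} (hg : P.neg.charHom π τ ≫ g = 0) :
    P.charHom π τ ≫ (pullbackPushforwardAdjunction σ).homEquiv _ _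
      ((pullbackIso hσ P.E).inv ≫ g) = 0 := by
  refine charHom_comp_eq_zero hE _ fun V p hp => ?_
  obtain ⟨U, ⟨c, hc⟩, hpU, hU⟩ := h V p hp
  refine ⟨U, ⟨c, fun e => ?_⟩, hpU, hU⟩
  have key (e : Γ(P.E, U)) : appLin ((pullbackPushforwardAdjunction σ).homEquiv _ _
      ((pullbackIso hσ P.E).inv ≫ g)) (π ⁻¹ᵁ U) (pullbackSection π e) =
        res N (show σ ⁻¹ᵁ π ⁻¹ᵁ U ≤ π ⁻¹ᵁ U by rw [← Scheme.Hom.comp_preimage, hσ])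
          (appLin g _ (pullbackSection π e)) := by
    rw [← homEquiv_apply_pullbackSection, appLin_comp, LinearMap.comp_apply, pullbackIso_inv,
      appLin_res]
  rw [key, key]
  have h1 := c.apply_endo hg e
  rw [c.endo_neg] at h1
  have h2 : pullbackSection π (-(c.endo P).app U le_rfl e) =
      -pullbackSection π ((c.endo P).app U le_rfl e) := (appLin (pullbackUnit π P.E) U).map_neg _
  rw [h2, map_neg, neg_eq_iff_eq_neg] at h1
  refine (congrArg _ h1).trans ?_
  rw [map_neg, res_smul]
  have h3 : -resO X (show σ ⁻¹ᵁ π ⁻¹ᵁ U ≤ π ⁻¹ᵁ U by rw [← Scheme.Hom.comp_preimage, hσ]) c.t =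
    (σ.app (π ⁻¹ᵁ U)).hom c.t := hc.symm
  rw [← neg_smul, h3]
  rfl

/-- A morphism out of `σ^*E_φ` is a morphism from `E_φ` to `σ_* N`, and the latter is given by a
morphism that kills the characteristic morphism of `(E, φ)`. -/
lemma exists_comp_eq (hE : IsVectorBundle P.E)
    (h : IsNhdBasis fun U : B.Opens => ∃ c : SpectralChart π τ U, c.IsNegatedBy hσ)
    {N : X.Modules} (g : (pullback π).obj P.E ⟶ N) (hg : P.neg.charHom π τ ≫ g = 0) :
    ∃ l : (pullback σ).obj (P.spectralSheaf π τ) ⟶ N,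
      ((pullbackIso hσ P.E).hom ≫ (pullback σ).map (P.toSpectralSheaf π τ)) ≫ l = g := by
  obtain ⟨l, hl⟩ := exists_toSpectralSheaf_comp_eq _ (charHom_comp_homEquiv_eq_zero hσ hE h hg)
  refine ⟨((pullbackPushforwardAdjunction σ).homEquiv _ _).symm l, ?_⟩
  rw [Category.assoc, ← Adjunction.homEquiv_naturality_left_symm, hl, Equiv.symm_apply_apply,
    Iso.hom_inv_id_assoc]

/-- A resolution of `σ^*` of the spectral sheaf of `(E, φ)`. -/
theorem exists_shortExact [IsAffineHom π] (hE : IsVectorBundle P.E)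
    (h : IsNhdBasis fun U : B.Opens => ∃ c : SpectralChart π τ U, c.IsNegatedBy hσ) :
    ∃ (g : (pullback π).obj P.E ⟶ (pullback σ).obj (P.spectralSheaf π τ))
      (w : P.neg.charHom π τ ≫ g = 0), (ShortComplex.mk _ _ w).ShortExact := by
  have hc : HasSpectralCharts π τ := fun V p hp => by
    obtain ⟨U, ⟨c, -⟩, hU⟩ := h V p hp
    exact ⟨U, ⟨c⟩, hU⟩
  -- Injectivity on the left comes from the characteristic polynomial of `-φ`, so only right
  -- exactness of `σ^*` enters.
  have hm : Mono (P.neg.charHom π τ) := hc.mono_charHom (P := P.neg) hE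
  have : (pullback σ).IsLeftAdjoint := (pullbackPushforwardAdjunction σ).isLeftAdjoint
  have : Epi ((pullback σ).map (P.toSpectralSheaf π τ)) := inferInstance
  have : IsIso (pullbackIso hσ P.E).hom := inferInstance
  let g : (pullback π).obj P.E ⟶ (pullback σ).obj (P.spectralSheaf π τ) :=
    (pullbackIso hσ P.E).hom ≫ (pullback σ).map (P.toSpectralSheaf π τ)
  have hg : Epi g := epi_comp' inferInstance inferInstance
  have w : P.neg.charHom π τ ≫ g = 0 := 
    charHom_neg_comp_eq_zero hσ hE h charHom_comp_toSpectralSheaf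
  refine ⟨g, w, { exact := ?_, mono_f := hm, epi_g := hg }⟩
  choose l hl using fun (N : X.Modules) (a : (pullback π).obj P.E ⟶ N) =>
    exists_comp_eq (P := P) hσ hE h a
  exact ShortComplex.exact_of_g_is_cokernel _ (CokernelCofork.IsColimit.ofπ _ _
    (fun {N} a ha => l N a ha) (fun {N} a ha => hl N a ha)
    (fun {N} a ha m hm => (cancel_epi g).mp (hm.trans (hl N a ha).symm)))

end Negation
end AlgebraicGeometry.Scheme.Modules

namespace AlgebraicGeometry.Scheme.Modules

/-! ### The spectral correspondence: recovering `(E, φ)` by direct image. -/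

section DirectImage
variable {B X : Scheme.{u}} {K : B.Modules} {π : X ⟶ B} {τ : Γ((pullback π).obj K, ⊤)}
  {U : B.Opens} {P Q : HiggsPair K} {F F' : X.Modules}

/-- `α` on sections, with values in the sections of `F`. -/
noncomputable def toSections {M : B.Modules} (α : M ⟶ (pushforward π).obj F) (U : B.Opens)
    (m : Γ(M, U)) : Γ(F, π ⁻¹ᵁ U) := appLin α U m

lemma appLin_projectionMap {M : B.Modules} (α : M ⟶ (pushforward π).obj F) (m : Γ(M, U))
    (k : Γ(K, U)) : toSections (tensorMap α (𝟙 K) ≫ projectionMap π F K) U (tmul m k) =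
      tmul (toSections α U m) (pullbackSection π k) := by
  rw [toSections, appLin_comp, LinearMap.comp_apply, appLin_tensorMap, projectionMap,
    tensorLift_tmul]
  rfl

/-- Both sides are a section tensored with the frame `k`. Cancelling `k`, compatibility with `τ`
says that `t` acts as `φ_k`. -/
lemma SpectralChart.eq_iff (c : SpectralChart π τ U) (α : P.E ⟶ (pushforward π).obj F)
    (e : Γ(P.E, U)) :
    appLin (P.φ ≫ tensorMap α (𝟙 K) ≫ projectionMap π F K) U e =
        appLin (α ≫ (pushforward π).map (mulSection F τ)) U e ↔
      toSections α U ((c.endo P).app U le_rfl e) = c.t • toSections α U e := by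
  have h1 : appLin (P.φ ≫ tensorMap α (𝟙 K) ≫ projectionMap π F K) U e =
      (tmul (toSections α U ((c.endo P).app U le_rfl e)) (pullbackSection π c.k) :
        Γ(tensor F ((pullback π).obj K), π ⁻¹ᵁ U)) := by
    rw [appLin_comp, LinearMap.comp_apply, ← c.tmul_endo P]
    exact appLin_projectionMap α _ _
  have h2 : appLin (α ≫ (pushforward π).map (mulSection F τ)) U e =
      (tmul (c.t • toSections α U e) (pullbackSection π c.k) :
        Γ(tensor F ((pullback π).obj K), π ⁻¹ᵁ U)) :=
    (c.appLin_mulSection F (toSections α U e)).trans (smul_tmul _ _ _).symm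
  rw [h1, h2]
  have := (bijective_tmul (M := F) (c.isFrame.pullback π) le_rfl).1
  rw [res_self] at this
  exact this.eq_iff

lemma HasSpectralCharts.eq_iff (h : HasSpectralCharts π τ) (α : P.E ⟶ (pushforward π).obj F) :
    P.φ ≫ tensorMap α (𝟙 K) ≫ projectionMap π F K =
        α ≫ (pushforward π).map (mulSection F τ) ↔
      ∀ (U : B.Opens) (c : SpectralChart π τ U) (e : Γ(P.E, U)),
        toSections α U ((c.endo P).app U le_rfl e) = c.t • toSections α U e := by
  refine ⟨fun H U c e => (c.eq_iff α e).mp (by rw [H]), fun H => hom_ext_basis h ?_⟩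
  rintro U ⟨c⟩
  exact LinearMap.ext fun e => (c.eq_iff α e).mpr (H U c e)

/-- The direct image description only depends on the isomorphism class of the sheaf. -/
theorem HasSpectralCharts.isDirectImage_of_iso (h : HasSpectralCharts π τ)
    (hF : P.IsDirectImage π τ F) (i : F ≅ F') : P.IsDirectImage π τ F' := by
  obtain ⟨β, hβ⟩ := hF
  rw [h.eq_iff] at hβ
  refine ⟨β ≪≫ (pushforward π).mapIso i, (h.eq_iff _).mpr fun U c e => ?_⟩
  have key (e : Γ(P.E, U)) : toSections (β ≪≫ (pushforward π).mapIso i).hom U e =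
      appLin i.hom (π ⁻¹ᵁ U) (toSections β.hom U e) := rfl
  rw [key, key, hβ, LinearMap.map_smul]

/-- A Higgs pair is determined by the sheaf of which it is the direct image. -/
theorem HasSpectralCharts.isIsomorphic (h : HasSpectralCharts π τ) (hP : P.IsDirectImage π τ F)
    (hQ : Q.IsDirectImage π τ F) : P.IsIsomorphic Q := by
  obtain ⟨α, hα⟩ := hP
  obtain ⟨β, hβ⟩ := hQ
  rw [h.eq_iff] at hα hβ
  refine ⟨α ≪≫ β.symm, hom_ext_basis h ?_⟩
  rintro U ⟨c⟩
  refine LinearMap.ext fun e => ?_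
  have key (e : Γ(P.E, U)) : toSections β.hom U (appLin (α ≪≫ β.symm).hom U e) =
      toSections α.hom U e :=
    LinearMap.congr_fun (congrArg (appLin · U) (show (α ≪≫ β.symm).hom ≫ β.hom = α.hom by simp)) e
  have hi : Function.Injective (toSections β.hom U) := (bijective_of_isIso β.hom U).1
  have h1 : appLin (α ≪≫ β.symm).hom U ((c.endo P).app U le_rfl e) =
      (c.endo Q).app U le_rfl (appLin (α ≪≫ β.symm).hom U e) :=
    hi (by rw [key, hα, hβ, key])
  rw [appLin_comp, appLin_comp, LinearMap.comp_apply, LinearMap.comp_apply, ← c.tmul_endo,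
    ← c.tmul_endo, appLin_tensorMap, h1]
  rfl

/-- Over `π⁻¹U` the sections of the spectral sheaf are the cokernel of `Φ - t` on `R[t]ⁿ`, of which
the constant vectors `Rⁿ` are a complete and irredundant set of representatives. -/
lemma SpectralChart.bijective_toSections [IsAffineHom π] (h : HasSpectralCharts π τ)
    (hE : IsVectorBundle P.E) (c : SpectralChart π τ U) (hU : HasFrame P.E U) :
    Function.Bijective (fun e : Γ(P.E, U) =>
      appLin (P.toSpectralSheaf π τ) (π ⁻¹ᵁ U) (pullbackSection π e)) := by
  have hm : Mono (P.charHom π τ) := h.mono_charHom hE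
  let S : ShortComplex X.Modules :=
    ShortComplex.mk (P.charHom π τ) (P.toSpectralSheaf π τ) charHom_comp_toSpectralSheaf
  have hmS : Mono S.f := hm
  have hS : S.ShortExact :=
    { exact := ShortComplex.exact_of_g_is_cokernel _ (cokernelIsCokernel (P.charHom π τ))
      epi_g := inferInstanceAs (Epi (P.toSpectralSheaf π τ)) }
  obtain ⟨n, e, he⟩ := hU
  obtain ⟨κ, hκ, hκ1⟩ := c.exists_dualFrame
  have heX : IsFrameFam (fun i => pullbackSection π (e i)) := he.pullback π
  have heκ := heX.tmul hκ
  let f : Γ(P.E, U) →+ Γ(P.spectralSheaf π τ, π ⁻¹ᵁ U) :=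
    { toFun := fun e => appLin (P.toSpectralSheaf π τ) (π ⁻¹ᵁ U) (pullbackSection π e)
      map_zero' := by rw [← map_zero (appLin (P.toSpectralSheaf π τ) (π ⁻¹ᵁ U))]; congr 1; exact map_zero (appLin (pullbackUnit π P.E) U)
      map_add' := fun x y => by rw [pullbackSection_add, map_add] }
  refine ⟨(injective_iff_map_eq_zero f).mpr fun x hx => ?_, fun y => ?_⟩
  · obtain ⟨r, rfl⟩ := (he.equiv le_rfl).surjective x
    -- A constant vector that dies in the spectral sheaf is of the form `(Φ - t) a`, hence is zero.
    obtain ⟨z, hz⟩ := exists_of_exact_of_mono hS.exact (pullbackSection π (he.equiv le_rfl r)) hx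
    obtain ⟨a, rfl⟩ := (heκ.equiv le_rfl).surjective z
    simp only [IsFrameFam.equiv_apply, res_self] at hz
    have hz' := (c.appLin_charHom_sum P hκ1 he a).symm.trans hz
    rw [pullbackSection_sum] at hz'
    simp only [pullbackSection_smul] at hz'
    have := (heX _ le_rfl).1 (by simpa only [res_self] using hz'.symm)
    rw [eq_zero_of_mulVec_eq _ c.bijective this, map_zero]
  -- Sections of the cokernel lift over the whole affine open `π⁻¹U`; the lift is then reduced to a
  -- constant vector modulo the image.
  · obtain ⟨m, rfl⟩ := surjective_of_isAffineOpen hS (c.isAffineOpen.preimage π) ⟨n, _, heκ⟩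
      ⟨n, _, heX⟩ y
    obtain ⟨a, rfl⟩ := (heX.equiv le_rfl).surjective m
    obtain ⟨r, b, hrb⟩ := exists_add_mulVec (c.matrix P he) c.bijective.2 a
    refine ⟨∑ i, r i • e i, ?_⟩
    have h1 : heX.equiv le_rfl a = pullbackSection π (∑ i, r i • e i) +
        appLin (P.charHom π τ) (π ⁻¹ᵁ U) (∑ j, b j • tmul (pullbackSection π (e j)) κ) := by
      rw [c.appLin_charHom_sum P hκ1 he, pullbackSection_sum, ← Finset.sum_add_distrib]
      simp only [pullbackSection_smul, IsFrameFam.equiv_apply, res_self, ← add_smul]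
      exact Finset.sum_congr rfl fun i _ => congrArg (· • _) (congrFun hrb i)
    have h2 (x) : appLin (P.toSpectralSheaf π τ) (π ⁻¹ᵁ U) (appLin (P.charHom π τ) (π ⁻¹ᵁ U) x) = 0 :=
      LinearMap.congr_fun (congrArg (appLin · (π ⁻¹ᵁ U)) charHom_comp_toSpectralSheaf) x
    change _ = appLin (P.toSpectralSheaf π τ) (π ⁻¹ᵁ U) (heX.equiv le_rfl a)
    rw [h1, map_add, h2, add_zero]

/-- The spectral correspondence: `(E, φ)` is the direct image of its spectral sheaf. -/
theorem HasSpectralCharts.isDirectImage_spectralSheaf [IsAffineHom π] (h : HasSpectralCharts π τ)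
    (hE : IsVectorBundle P.E) : P.IsDirectImage π τ (P.spectralSheaf π τ) := by
  let α : P.E ⟶ (pushforward π).obj (P.spectralSheaf π τ) :=
    (pullbackPushforwardAdjunction π).homEquiv _ _ (P.toSpectralSheaf π τ)
  have hα (U : B.Opens) (e : Γ(P.E, U)) : toSections α U e =
      appLin (P.toSpectralSheaf π τ) (π ⁻¹ᵁ U) (pullbackSection π e) :=
    (homEquiv_apply_pullbackSection π _ e).symm
  have : IsIso α := isIso_of_basis (hE.isNhdBasis_and h) α fun U ⟨⟨c⟩, hU⟩ => by
    have := c.bijective_toSections h hE hU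
    simp only [← hα] at this
    exact this
  refine ⟨asIso α, (h.eq_iff α).mpr fun U c e => ?_⟩
  rw [hα, hα, c.apply_endo charHom_comp_toSpectralSheaf]

end DirectImage
end AlgebraicGeometry.Scheme.Modules

namespace AlgebraicGeometry.Scheme.Modules

/-! ### Pullback commutes with duals of vector bundles. -/

section PullbackDual
variable {X Y : Scheme.{u}} (f : X ⟶ Y) {E : Y.Modules} {U : Y.Opens}

/-- The pullback of a local functional. -/
noncomputable def pullbackFunctional (l : Γ(dual E, U)) :
    LocalHom ((pullback f).obj E) (structureSheaf X) (f ⁻¹ᵁ U) :=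
  ((show LocalHom E (structureSheaf Y) U from l).toPushforward f).pullbackLift f

lemma pullbackFunctional_apply (l : Γ(dual E, U)) {V : Y.Opens} (hV : V ≤ U) (e : Γ(E, V)) :
    (pullbackFunctional f l).functional (preimage_mono' f hV) (pullbackSection f e) =
      (f.app V).hom (pair (res _ hV l) e) :=
  LocalHom.pullbackLift_pullbackSection f _ hV e

lemma pullback_functional_ext {g g' : LocalHom ((pullback f).obj E) (structureSheaf X) (f ⁻¹ᵁ U)}
    (h : ∀ (V : Y.Opens) (hV : V ≤ U) (e : Γ(E, V)),
      g.functional (preimage_mono' f hV) (pullbackSection f e) =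
        g'.functional (preimage_mono' f hV) (pullbackSection f e)) : g = g' :=
  LocalHom.pullback_ext f h

/-- The canonical morphism `f^*(E^*) ⟶ (f^* E)^*`. -/
noncomputable def pullbackDual (E : Y.Modules) :
    (pullback f).obj (dual E) ⟶ dual ((pullback f).obj E) :=
  ((pullbackPushforwardAdjunction f).homEquiv _ _).symm
    (homOfLin (M := dual E) (N := (pushforward f).obj (dual ((pullback f).obj E))) (fun U =>
      { toFun := fun l => pullbackFunctional f l
        map_add' := fun l l' => by
          refine pullback_functional_ext f fun V hV e => ?_
          refine (pullbackFunctional_apply f (l + l') hV e).trans ?_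
          refine Eq.trans ?_ (congrArg₂ (· + ·) (pullbackFunctional_apply f l hV e)
            (pullbackFunctional_apply f l' hV e)).symm
          rw [map_add, add_pair, map_add]
        map_smul' := fun r l => by
          refine pullback_functional_ext f fun V hV e => ?_
          refine (pullbackFunctional_apply f (r • l) hV e).trans ?_
          refine Eq.trans ?_ (congrArg (resO X (preimage_mono' f hV) ((f.app U).hom r) * ·)
            (pullbackFunctional_apply f l hV e)).symm
          rw [res_smul, smul_pair, map_mul, resO_app] })
      (fun U V h l => by
        refine pullback_functional_ext f fun W hW e => ?_
        refine (pullbackFunctional_apply f (res (dual E) h l) hW e).trans ?_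
        rw [res_res]
        exact (pullbackFunctional_apply f l (hW.trans h) e).symm))

lemma pair_pullbackDual (l : Γ(dual E, U)) (e : Γ(E, U)) :
    pair (appLin (pullbackDual f E) (f ⁻¹ᵁ U) (pullbackSection f l)) (pullbackSection f e) =
      (f.app U).hom (pair l e) := by
  rw [pullbackDual, homEquiv_symm_apply_pullbackSection]
  have := pullbackFunctional_apply f l le_rfl e
  rw [res_self] at this
  exact this

/-- The pulled back dual frame goes to the dual of the pulled back frame. -/
theorem isIso_pullbackDual (hE : IsVectorBundle E) : IsIso (pullbackDual f E) := by
  refine isIso_of_basis (hE.isNhdBasis.preimage f) _ ?_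
  rintro W ⟨U, ⟨n, e, he⟩, hW⟩
  refine bijective_of_isFrameFam (he.isFrameFam_dual.pullback f) (.ofGlobal _ (f ⁻¹ᵁ U)) ?_ hW
  convert (he.pullback f).isFrameFam_dual using 2 with i
  refine evalAt_eq (he.pullback f) fun j => ?_
  refine (pair_pullbackDual f _ _).trans ?_
  rw [he.pair_dual, apply_ite (f.app U).hom, map_one, map_zero]
  exact ((he.pullback f).pair_dual i j).symm

end PullbackDual

/-! ### The identification `M^* = Hom(M ⊗ L, L)` for a line bundle `L`. -/

section TensorHom
variable {X : Scheme.{u}} {M L : X.Modules} {U : X.Opens}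

/-- `M^* ⟶ Hom(M ⊗ L, L)`, `l ↦ (m ⊗ κ ↦ l(m) κ)`. -/
noncomputable def dualTensor (M L : X.Modules) : dual M ⟶ sheafHom (tensor M L) L :=
  ((evalBilin (dual M) L).pre (contractLeft M L) (𝟙 _)).flip.curry

lemma evalAt_dualTensor (l : Γ(dual M, U)) (m : Γ(M, U)) (κ : Γ(L, U)) :
    evalAt (appLin (dualTensor M L) U l) (tmul m κ) = pair l m • κ := by
  rw [dualTensor, Bilin.evalAt_curry]
  exact evalAt_contractLeft m κ l

/-- In the dual frame and evaluation at the frame `eⱼ ⊗ κ`, the map multiplies each coordinate by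
`κ`. -/
theorem isIso_dualTensor (hM : IsVectorBundle M) (hL : IsLineBundle L) :
    IsIso (dualTensor M L) := by
  refine isIso_of_basis (hM.isNhdBasis_and hL.isNhdBasis) _ ?_
  rintro U ⟨⟨κ, hκ⟩, n, e, he⟩
  rw [← Function.Bijective.of_comp_iff' (bijective_evalAt (N := L) (he.tmul hκ) le_rfl)]
  rw [← Function.Bijective.of_comp_iff _ (he.isFrameFam_dual U le_rfl)]
  convert bijective_smul_frame (n := n) hκ le_rfl using 1
  ext c j
  simp only [Function.comp]
  rw [res_tmul, evalAt_dualTensor, he.pair_dual_sum]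

lemma IsLineBundle.dual {K : X.Modules} (hK : IsLineBundle K) : IsLineBundle (Modules.dual K) :=
  fun x => by
    obtain ⟨U, hx, k, hk⟩ := hK x
    obtain ⟨κ, hκ, -⟩ := exists_dual_frame hk
    exact ⟨U, hx, κ, hκ⟩

theorem isIso_tensorMap_id (a : M ⟶ L) [IsIso a] (N : X.Modules) : IsIso (tensorMap a (𝟙 N)) := by
  refine ⟨tensorMap (inv a) (𝟙 N), tensor_hom_ext fun U m n => ?_, tensor_hom_ext fun U m n => ?_⟩
  · simp only [appLin_comp, LinearMap.comp_apply, appLin_tensorMap]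
    rw [← LinearMap.comp_apply, ← appLin_comp, IsIso.hom_inv_id]
    rfl
  · simp only [appLin_comp, LinearMap.comp_apply, appLin_tensorMap]
    rw [← LinearMap.comp_apply, ← appLin_comp, IsIso.inv_hom_id]
    rfl

end TensorHom

section PairSub
variable {X : Scheme.{u}} {M : X.Modules} {U : X.Opens}

lemma sub_pair (l l' : Γ(dual M, U)) (m : Γ(M, U)) : pair (l - l') m = pair l m - pair l' m :=
  LinearMap.congr_fun (((evalBilin M (structureSheaf X)).app U).map_sub l l') m

lemma pair_sub (l : Γ(dual M, U)) (m m' : Γ(M, U)) : pair l (m - m') = pair l m - pair l m' :=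
  ((evalBilin M (structureSheaf X)).app U l).map_sub m m'

lemma neg_pair (l : Γ(dual M, U)) (m : Γ(M, U)) : pair (-l) m = -pair l m :=
  LinearMap.congr_fun (((evalBilin M (structureSheaf X)).app U).map_neg l) m

lemma pair_neg (l : Γ(dual M, U)) (m : Γ(M, U)) : pair l (-m) = -pair l m :=
  ((evalBilin M (structureSheaf X)).app U l).map_neg m

end PairSub

/-! ### Duality of characteristic morphisms and of spectral sheaves. -/

section SpectralDuality
variable {B X : Scheme.{u}} {K : B.Modules} {π : X ⟶ B} {τ : Γ((pullback π).obj K, ⊤)}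
  {U : B.Opens} {P : HiggsPair K}

/-- The characteristic morphism of `(E^*, -φ^*)` is the dual of that of `(E, -φ)`. -/
lemma charHom_dual_comp (h : HasSpectralCharts π τ) (hE : IsVectorBundle P.E) :
    (HiggsPair.mk (dual P.E) (-transpose P.φ)).charHom π τ ≫ pullbackDual π P.E ≫ dualTensor _ (dual ((pullback π).obj K)) =
      tensorMap (pullbackDual π P.E) (𝟙 _) ≫ contractDual _ _ ≫
        (sheafHomPrecomp (P.neg.charHom π τ)).app (dual ((pullback π).obj K)) := by
  refine hom_ext_basis ((hE.isNhdBasis_and h).preimage π) ?_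
  rintro W ⟨U, ⟨⟨c⟩, n, e, he⟩, hW⟩
  obtain ⟨κ, hκ, hκ1⟩ := c.exists_dualFrame
  refine appLin_eq_of_frame ((he.isFrameFam_dual.pullback π).tmul hκ) (fun i => ?_) hW
  refine evalAt_eq ((he.pullback π).tmul hκ) fun j => ?_
  -- In the chart, `-φ^*` is the transpose of `-φ`.
  have hφ (l : Γ(dual P.E, U)) (e : Γ(P.E, U)) : pair ((c.endo (HiggsPair.mk (dual P.E) (-transpose P.φ))).app U le_rfl l) e =
      pair l ((c.endo P.neg).app U le_rfl e) := by
    have h1 := coefHom_transpose (isTranspose_transpose hE h.isLineBundle P.φ) c.isFrame le_rfl l e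
    have h2 : (c.endo (HiggsPair.mk (dual P.E) (-transpose P.φ))).app U le_rfl l =
      -(coefHom (transpose P.φ) c.isFrame).app U le_rfl l := coefHom_neg _ _ _ _
    rw [h2, c.endo_neg, neg_pair, pair_neg, h1]
    rfl
  let D := appLin (pullbackDual π P.E) (π ⁻¹ᵁ U)
  have h1 (x : Γ((pullback π).obj (dual P.E), π ⁻¹ᵁ U)) :
      evalAt (appLin (pullbackDual π P.E ≫ dualTensor _ (dual ((pullback π).obj K))) _ x)
        (tmul (pullbackSection π (e j)) κ) = pair (D x) (pullbackSection π (e j)) • κ :=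
    evalAt_dualTensor _ _ _
  have h2 (x : Γ((pullback π).obj P.E, π ⁻¹ᵁ U)) (l : Γ((pullback π).obj (dual P.E), π ⁻¹ᵁ U)) :
      evalAt (appLin (contractDual _ _) (π ⁻¹ᵁ U) (appLin (tensorMap (pullbackDual π P.E) (𝟙 _)) _
        (tmul l κ))) x = pair (D l) x • κ := by
    rw [appLin_tensorMap]
    exact evalAt_contractDual _ _ _
  rw [appLin_comp, LinearMap.comp_apply, c.appLin_charHom _ hκ1, h1]
  refine Eq.trans ?_ (h2 (appLin (P.neg.charHom π τ) _ (tmul (pullbackSection π (e j)) κ)) _).symm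
  -- With `l` and `e` the frame elements, both sides are now `(l(-φ_k e) - t l(e)) κ`; the term in
  -- `t` is symmetric in `l` and `e`.
  rw [c.appLin_charHom P.neg hκ1, map_sub, sub_pair, pair_sub, LinearMap.map_smul, smul_pair,
    pair_smul, pair_pullbackDual, pair_pullbackDual, hφ, pair_pullbackDual]

/-- Applying `Hom(-, L)` to the resolution of `σ^*E_φ` presents `Ext¹` as a cokernel, and
`charHom_dual_comp` is a commutative square of isomorphisms from the characteristic morphism of
`(E^*, -φ^*)` to that presentation. -/
theorem nonempty_spectralSheaf_dual_iso [IsAffineHom π] {σ : X ⟶ X} (hσ : σ ≫ π = π)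
    (h : IsNhdBasis fun U : B.Opens => ∃ c : SpectralChart π τ U, c.IsNegatedBy hσ)
    (hE : IsVectorBundle P.E) :
    Nonempty (P.dual.spectralSheaf π τ ≅ spectralDual K π σ (P.spectralSheaf π τ)) := by
  have hc : HasSpectralCharts π τ := fun V p hp => by
    obtain ⟨U, ⟨c, -⟩, hU⟩ := h V p hp
    exact ⟨U, ⟨c⟩, hU⟩
  obtain ⟨g, w, hS⟩ := exists_shortExact hσ hE h
  obtain ⟨i⟩ := nonempty_sheafExt_one_iso hS (hE.pullback π) (dual ((pullback π).obj K))
  have hL := (hc.isLineBundle.pullback π).dual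
  have := isIso_pullbackDual π hE
  have := isIso_dualTensor (hE.pullback π) hL
  have := isIso_contractDual (hE.pullback π) hL
  have := isIso_tensorMap_id (pullbackDual π P.E) (dual ((pullback π).obj K))
  have h1 : IsIso (tensorMap (pullbackDual π P.E) (𝟙 _) ≫
      contractDual _ (dual ((pullback π).obj K))) := IsIso.comp_isIso' ‹_› ‹_›
  have h2 : IsIso (pullbackDual π P.E ≫ dualTensor _ (dual ((pullback π).obj K))) :=
    IsIso.comp_isIso' ‹_› ‹_›
  exact ⟨cokernel.mapIso ((HiggsPair.mk (dual P.E) (-transpose P.φ)).charHom π τ)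
    ((sheafHomPrecomp (P.neg.charHom π τ)).app (dual ((pullback π).obj K)))
    (@asIso _ _ _ _ _ h1) (@asIso _ _ _ _ _ h2) ((charHom_dual_comp hc hE).trans
      (Category.assoc _ _ _).symm) ≪≫ i.symm⟩

end SpectralDuality
end AlgebraicGeometry.Scheme.Modules

/-- Polynomial rings are stable under base change: `S[X]` receives compatible maps from `A = R[t]`
and from `S`, and the induced map `δ` out of the pushout inverts evaluation at the image of `t`. -/
lemma CommRingCat.bijective_eval₂_of_isPushout {R A S T : CommRingCat.{u}} {a : R ⟶ A} {b : R ⟶ S}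
    {c : A ⟶ T} {d : S ⟶ T} (h : IsPushout a b c d) (t : A)
    (ht : Function.Bijective (Polynomial.eval₂ a.hom t)) :
    Function.Bijective (Polynomial.eval₂ d.hom (c.hom t)) := by
  let e : Polynomial R ≃+* A := RingEquiv.ofBijective (Polynomial.eval₂RingHom a.hom t) ht
  have he : ∀ p, e p = Polynomial.eval₂ a.hom t p := fun _ => rfl
  have ha (r : R) : e.symm (a.hom r) = Polynomial.C r := by
    rw [RingEquiv.symm_apply_eq, he, Polynomial.eval₂_C]
  have het : e.symm t = Polynomial.X := by
    rw [RingEquiv.symm_apply_eq, he, Polynomial.eval₂_X]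
  let i : A ⟶ .of (Polynomial S) :=
    CommRingCat.ofHom ((Polynomial.mapRingHom b.hom).comp e.symm.toRingHom)
  let j : S ⟶ .of (Polynomial S) := CommRingCat.ofHom Polynomial.C
  let ε : CommRingCat.of (Polynomial S) ⟶ T :=
    CommRingCat.ofHom (Polynomial.eval₂RingHom d.hom (c.hom t))
  have hij : a ≫ i = b ≫ j := by
    refine CommRingCat.hom_ext (RingHom.ext fun r => ?_)
    change Polynomial.map b.hom (e.symm (a.hom r)) = Polynomial.C (b.hom r)
    rw [ha, Polynomial.map_C]
  let δ := h.desc i j hij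
  have hjε : j ≫ ε = d := by
    ext x
    exact Polynomial.eval₂_C d.hom (c.hom t)
  have hiε : i ≫ ε = c := by
    ext x
    obtain ⟨p, rfl⟩ := e.surjective x
    change Polynomial.eval₂ d.hom (c.hom t) (Polynomial.map b.hom (e.symm (e p))) = c.hom (e p)
    rw [e.symm_apply_apply, he, Polynomial.eval₂_map, Polynomial.hom_eval₂]
    congr 1
    exact congrArg CommRingCat.Hom.hom h.w.symm
  have h1 : δ ≫ ε = 𝟙 T := h.hom_ext (by simp [δ, hiε]) (by simp [δ, hjε])
  have hδc (x : A) : δ.hom (c.hom x) = i.hom x := ConcreteCategory.congr_hom (h.inl_desc i j hij) x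
  have hδd (x : S) : δ.hom (d.hom x) = j.hom x := ConcreteCategory.congr_hom (h.inr_desc i j hij) x
  have h2 : δ.hom.comp ε.hom = RingHom.id _ := by
    refine Polynomial.ringHom_ext (fun r => ?_) ?_
    · change δ.hom (Polynomial.eval₂ d.hom (c.hom t) (Polynomial.C r)) = Polynomial.C r
      rw [Polynomial.eval₂_C, hδd]
      rfl
    · change δ.hom (Polynomial.eval₂ d.hom (c.hom t) Polynomial.X) = Polynomial.X
      rw [Polynomial.eval₂_X, hδc]
      change Polynomial.map b.hom (e.symm t) = Polynomial.X
      rw [het, Polynomial.map_X]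
  exact Function.bijective_iff_has_inverse.mpr ⟨δ.hom, fun p => RingHom.congr_fun h2 p,
    fun x => ConcreteCategory.congr_hom h1 x⟩

namespace AlgebraicGeometry.Scheme.Modules

/-! ### Existence and base change of spectral charts. -/

section Global
variable {B X Y : Scheme.{u}} {K : B.Modules} {π : X ⟶ B} {τ : Γ((pullback π).obj K, ⊤)}
  {U : B.Opens}

lemma preimage_le_of_comp_eq {π' : Y ⟶ B} {g : Y ⟶ X} (w : g ≫ π = π') :
    π' ⁻¹ᵁ U ≤ g ⁻¹ᵁ π ⁻¹ᵁ U := by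
  subst w; exact le_rfl

lemma preimage_le_of_commSq {B' : Scheme.{u}} {π' : Y ⟶ B'} {g : Y ⟶ X} {p : B' ⟶ B}
    (w : g ≫ π = π' ≫ p) {U' : B'.Opens} (h : U' ≤ p ⁻¹ᵁ U) : π' ⁻¹ᵁ U' ≤ g ⁻¹ᵁ π ⁻¹ᵁ U :=
  le_trans (fun _ hx => h hx) (preimage_le_of_comp_eq w)

/-- `g^* π^* K ⟶ (g ≫ π)^* K`. -/
noncomputable def pullbackCompHom (g : Y ⟶ X) (π : X ⟶ B) (K : B.Modules) :
    (pullback g).obj ((pullback π).obj K) ⟶ (pullback (g ≫ π)).obj K :=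
  (pullbackComp g π).hom.app K

instance (g : Y ⟶ X) (π : X ⟶ B) (K : B.Modules) : IsIso (pullbackCompHom g π K) :=
  inferInstanceAs (IsIso ((pullbackComp g π).hom.app K))

lemma pullbackCompHom_pullbackSection (g : Y ⟶ X) (k : Γ(K, U)) :
    appLin (pullbackCompHom g π K) (g ⁻¹ᵁ π ⁻¹ᵁ U) (pullbackSection g (pullbackSection π k)) =
      pullbackSection (g ≫ π) k := pullbackComp_pullbackSection g π k

lemma res_pullbackGlobal {π' : Y ⟶ B} (g : Y ⟶ X) (w : g ≫ π = π') {k : Γ(K, U)}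
    {t : Γ(X, π ⁻¹ᵁ U)} (h : res _ le_top τ = t • pullbackSection π k) :
    res _ le_top (pullbackGlobal g w τ) =
      (g.appLE (π ⁻¹ᵁ U) (π' ⁻¹ᵁ U) (preimage_le_of_comp_eq w)).hom t • pullbackSection π' k := by
  subst w
  have h1 : pullbackGlobal g rfl τ =
      appLin (pullbackCompHom g π K) (g ⁻¹ᵁ ⊤) (pullbackSection g τ) := by
    change appLin ((pullbackCongr (rfl : g ≫ π = g ≫ π)).hom.app K) ⊤ _ = _
    simp only [pullbackCongr, eqToIso_refl, Iso.refl_hom]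
    rfl
  have h2 : res _ le_top (pullbackGlobal g rfl τ) =
      appLin (pullbackCompHom g π K) (g ⁻¹ᵁ π ⁻¹ᵁ U) (pullbackSection g (res _ le_top τ)) := by
    rw [pullbackSection_res, appLin_res, ← h1]
    rfl
  refine h2.trans ?_
  rw [h, pullbackSection_smul, LinearMap.map_smul, pullbackCompHom_pullbackSection,
    Scheme.Hom.app_eq_appLE]
  rfl

lemma SpectralChart.isNegatedBy_iff {σ : X ⟶ X} {hσ : σ ≫ π = π} (c : SpectralChart π τ U) :
    c.IsNegatedBy hσ ↔ (σ.appLE (π ⁻¹ᵁ U) (π ⁻¹ᵁ U)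
      (preimage_le_of_comp_eq hσ)).hom c.t = -c.t := by
  have h1 : (σ.appLE (π ⁻¹ᵁ U) (π ⁻¹ᵁ U) (preimage_le_of_comp_eq hσ)).hom c.t =
      resO X (preimage_le_of_comp_eq hσ) ((σ.app (π ⁻¹ᵁ U)).hom c.t) := rfl
  rw [h1, IsNegatedBy]
  constructor
  · intro h
    rw [h, map_neg, resO_resO, resO_self]
  · intro h
    have := congrArg (resO X (show σ ⁻¹ᵁ π ⁻¹ᵁ U ≤ π ⁻¹ᵁ U by rw [← Scheme.Hom.comp_preimage, hσ])) h
    rwa [resO_resO, resO_self, map_neg] at this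

/-- Write `τ = t k`. Since `k` comes from the base, it is unchanged by `σ^*`, and cancelling it from
`σ^*τ = -τ` leaves `σ^*t = -t`. -/
lemma SpectralChart.isNegatedBy {σ : X ⟶ X} (hσ : σ ≫ π = π) (hτ : pullbackGlobal σ hσ τ = -τ)
    (c : SpectralChart π τ U) : c.IsNegatedBy hσ := by
  rw [isNegatedBy_iff]
  have h := res_pullbackGlobal σ hσ c.res_eq
  rw [hτ, map_neg, c.res_eq, ← neg_smul] at h
  have := (c.isFrame.pullback π _ le_rfl).1
  simp only [res_self] at this
  exact (this h).symm

/-- The charts of the total space of a line bundle. -/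
noncomputable def TotalSpace.spectralChart (V : TotalSpace K) (hU : IsAffineOpen U) {k : Γ(K, U)}
    (hk : IsFrame k) : SpectralChart V.π V.τ U where
  k := k
  t := (V.chart U hU k hk).choose
  isAffineOpen := hU
  isFrame := hk
  res_eq := (V.chart U hU k hk).choose_spec.1
  bijective := (V.chart U hU k hk).choose_spec.2

lemma isNhdBasis_isAffineOpen : IsNhdBasis fun U : X.Opens => IsAffineOpen U := fun U p hp => by
  obtain ⟨_, ⟨V, hV, rfl⟩, hpV, hVU⟩ :=
    X.isBasis_affineOpens.exists_subset_of_mem_open hp U.isOpen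
  exact ⟨V, hV, hpV, hVU⟩

theorem TotalSpace.isNhdBasis (V : TotalSpace K) (hK : IsLineBundle K) {σ : V.X ⟶ V.X}
    (hσ : V.IsNegation σ) :
    IsNhdBasis fun U => ∃ c : SpectralChart V.π V.τ U, c.IsNegatedBy hσ.comp_π := fun U p hp => by
  obtain ⟨W, ⟨k, hk⟩, hpW, hW⟩ := hK.isNhdBasis U p hp
  obtain ⟨W', hW', hpW', hW'W⟩ := isNhdBasis_isAffineOpen W p hpW
  exact ⟨W', ⟨V.spectralChart hW' (hk.res hW'W), SpectralChart.isNegatedBy _ hσ.pullback_τ _⟩,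
    hpW', hW'W.trans hW⟩

variable {X' B' : Scheme.{u}} {π' : X' ⟶ B'} {p : B' ⟶ B} {q : X' ⟶ X}
  {τ' : Γ((pullback π').obj ((pullback p).obj K), ⊤)} {U' : B'.Opens}

/-- The base change of a spectral chart. -/
noncomputable def SpectralChart.baseChange (c : SpectralChart π τ U) (h : IsPullback q π' π p)
    (hτ : appLin (pullbackCompHom π' p K) ⊤ τ' = pullbackGlobal q h.w τ)
    (hU' : IsAffineOpen U') (hle : U' ≤ p ⁻¹ᵁ U) [IsAffineHom π] : SpectralChart π' τ' U' where
  k := res _ hle (pullbackSection p c.k)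
  t := (q.appLE (π ⁻¹ᵁ U) (π' ⁻¹ᵁ U')
    (preimage_le_of_commSq h.w hle)).hom c.t
  isAffineOpen := hU'
  isFrame := (c.isFrame.pullback p).res hle
  res_eq := by
    apply (bijective_of_isIso (pullbackCompHom π' p K) _).1
    rw [appLin_res, hτ, LinearMap.map_smul, pullbackSection_res, appLin_res,
      pullbackCompHom_pullbackSection]
    have hl : π' ⁻¹ᵁ U' ≤ (π' ≫ p) ⁻¹ᵁ U := fun _ hx => hle hx
    have := congrArg (res _ hl) (res_pullbackGlobal q h.w c.res_eq)
    rw [res_res, res_smul] at this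
    refine this.trans (congrArg (· • _) ?_)
    exact ConcreteCategory.congr_hom (q.appLE_map (preimage_le_of_comp_eq h.w) (homOfLE hl).op) c.t
  bijective := by
    -- All the opens are affine and `π'⁻¹U'` is the fibre product of `π⁻¹U` and `U'` over `U`, so
    -- its ring of functions is the pushout of theirs.
    have e : π' ⁻¹ᵁ U' = q ⁻¹ᵁ π ⁻¹ᵁ U ⊓ π' ⁻¹ᵁ U' :=
      (inf_eq_right.mpr (preimage_le_of_commSq h.w hle)).symm
    have hp := (isIso_pushoutSection_iff h hle le_rfl e).mp
      (isIso_pushoutSection_of_isAffineOpen h hle le_rfl e c.isAffineOpen hU'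
        (c.isAffineOpen.preimage π))
    have := CommRingCat.bijective_eval₂_of_isPushout hp c.t (by
      rw [← Scheme.Hom.app_eq_appLE]; exact c.bijective)
    rwa [← Scheme.Hom.app_eq_appLE] at this

lemma SpectralChart.isNegatedBy_baseChange (c : SpectralChart π τ U) (h : IsPullback q π' π p)
    (hτ : appLin (pullbackCompHom π' p K) ⊤ τ' = pullbackGlobal q h.w τ)
    (hU' : IsAffineOpen U') (hle : U' ≤ p ⁻¹ᵁ U) [IsAffineHom π] {σ : X ⟶ X} {hσ : σ ≫ π = π}
    (hc : c.IsNegatedBy hσ) {σ' : X' ⟶ X'} (hσ' : σ' ≫ π' = π') (hq : σ' ≫ q = q ≫ σ) :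
    (c.baseChange h hτ hU' hle).IsNegatedBy hσ' := by
  rw [isNegatedBy_iff] at hc ⊢
  have e1 : π' ⁻¹ᵁ U' ≤ q ⁻¹ᵁ π ⁻¹ᵁ U := preimage_le_of_commSq h.w hle
  have e2 : π ⁻¹ᵁ U ≤ σ ⁻¹ᵁ π ⁻¹ᵁ U := preimage_le_of_comp_eq hσ
  have e3 : π' ⁻¹ᵁ U' ≤ σ' ⁻¹ᵁ π' ⁻¹ᵁ U' := preimage_le_of_comp_eq hσ'
  have key : q.appLE (π ⁻¹ᵁ U) (π' ⁻¹ᵁ U') e1 ≫ σ'.appLE (π' ⁻¹ᵁ U') (π' ⁻¹ᵁ U') e3 =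
      σ.appLE (π ⁻¹ᵁ U) (π ⁻¹ᵁ U) e2 ≫ q.appLE (π ⁻¹ᵁ U) (π' ⁻¹ᵁ U') e1 := by
    rw [Scheme.Hom.appLE_comp_appLE, Scheme.Hom.appLE_comp_appLE]
    simp only [hq]
  have := ConcreteCategory.congr_hom key c.t
  refine this.trans ?_
  change (q.appLE _ _ e1).hom ((σ.appLE _ _ e2).hom c.t) = _
  rw [hc, map_neg]
  rfl

end Global
end AlgebraicGeometry.Scheme.Modules

namespace AlgebraicGeometry.Scheme.Modules

/-! ### Invariance of `Ext` under isomorphism, and the duality theorem. -/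

section ExtIso
variable {X : Scheme.{u}}

/-- An isomorphism in the first variable induces an isomorphism of the sheaves of homomorphisms. -/
noncomputable def sheafHomIso {M M' : X.Modules} (i : M ≅ M') :
    sheafHomFunctor M ≅ sheafHomFunctor M' where
  hom := sheafHomPrecomp i.inv
  inv := sheafHomPrecomp i.hom
  hom_inv_id := by
    ext N : 2
    refine sheafHom_hom_ext fun U f m => ?_
    have h : appLin i.inv U (appLin i.hom U m) = m :=
      LinearMap.congr_fun (congrArg (appLin · U) i.hom_inv_id) m
    exact congrArg (evalAt f) h
  inv_hom_id := by
    ext N : 2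
    refine sheafHom_hom_ext fun U f m => ?_
    have h : appLin i.hom U (appLin i.inv U m) = m :=
      LinearMap.congr_fun (congrArg (appLin · U) i.inv_hom_id) m
    exact congrArg (evalAt f) h

/-- An isomorphism of functors induces an isomorphism of the right derived functors. -/
noncomputable def rightDerivedIso {F G : X.Modules ⥤ X.Modules} [F.Additive] [G.Additive]
    (i : F ≅ G) (n : ℕ) : F.rightDerived n ≅ G.rightDerived n where
  hom := NatTrans.rightDerived i.hom n
  inv := NatTrans.rightDerived i.inv n
  hom_inv_id := by rw [← NatTrans.rightDerived_comp, i.hom_inv_id, NatTrans.rightDerived_id]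
  inv_hom_id := by rw [← NatTrans.rightDerived_comp, i.inv_hom_id, NatTrans.rightDerived_id]

/-- `Ext` preserves isomorphisms in the first variable. -/
noncomputable def sheafExtIso (n : ℕ) {M M' : X.Modules} (i : M ≅ M') (N : X.Modules) :
    sheafExt n M N ≅ sheafExt n M' N :=
  (rightDerivedIso (sheafHomIso i) n).app N

end ExtIso

section Duality
variable {B X : Scheme.{u}} {K : B.Modules} {π : X ⟶ B} {τ : Γ((pullback π).obj K, ⊤)}
  {P : HiggsPair K}

/-- The dual of the spectral sheaf is the spectral sheaf of the dual Higgs bundle. -/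
theorem spectral_duality [IsAffineHom π] {σ : X ⟶ X} (hσ : σ ≫ π = π)
    (h : IsNhdBasis fun U : B.Opens => ∃ c : SpectralChart π τ U, c.IsNegatedBy hσ)
    (hE : IsVectorBundle P.E) :
    (∃! ψ, IsTranspose P.φ ψ) ∧
      Nonempty (P.dual.spectralSheaf π τ ≅ spectralDual K π σ (P.spectralSheaf π τ)) ∧
      P.dual.IsDirectImage π τ (spectralDual K π σ (P.spectralSheaf π τ)) := by
  have hc : HasSpectralCharts π τ := fun V p hp => by
    obtain ⟨U, ⟨c, -⟩, hU⟩ := h V p hp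
    exact ⟨U, ⟨c⟩, hU⟩
  obtain ⟨i⟩ := nonempty_spectralSheaf_dual_iso hσ h hE
  exact ⟨existsUnique_isTranspose hE hc.isLineBundle P.φ, ⟨i⟩,
    hc.isDirectImage_of_iso (hc.isDirectImage_spectralSheaf (P := P.dual) hE.dual) i⟩

/-- `F ↦ Ext¹(σ^* F, (π^* K)^*)` preserves isomorphisms. -/
noncomputable def spectralDualIso (K : B.Modules) (π : X ⟶ B) (σ : X ⟶ X) {F F' : X.Modules}
    (i : F ≅ F') : spectralDual K π σ F ≅ spectralDual K π σ F' :=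
  sheafExtIso 1 ((pullback σ).mapIso i) _

/-- A Higgs bundle is determined by its spectral sheaf. -/
theorem isIsomorphic_of_spectralSheaf_iso [IsAffineHom π] (h : HasSpectralCharts π τ)
    {Q : HiggsPair K} (hP : IsVectorBundle P.E) (hQ : IsVectorBundle Q.E)
    (i : P.spectralSheaf π τ ≅ Q.spectralSheaf π τ) : P.IsIsomorphic Q :=
  h.isIsomorphic (h.isDirectImage_of_iso (h.isDirectImage_spectralSheaf hP) i)
    (h.isDirectImage_spectralSheaf hQ)

end Duality

/-! ### Spectral charts on `X × T`. -/

section Product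
variable {C S T : Scheme.{u}} {s : S ⟶ C} (t : T ⟶ C) {K : S.Modules} (V : TotalSpace K)

instance : IsAffineHom V.π := V.isAffineHom

lemma TotalSpace.prodπ_fst : V.prodπ (s := s) t ≫ Limits.pullback.fst s t =
    Limits.pullback.fst (V.π ≫ s) t ≫ V.π := Limits.pullback.lift_fst _ _ _

lemma TotalSpace.prodπ_snd : V.prodπ (s := s) t ≫ Limits.pullback.snd s t =
    Limits.pullback.snd (V.π ≫ s) t := Limits.pullback.lift_snd _ _ _

lemma TotalSpace.prodσ_fst {σ : V.X ⟶ V.X} (hσ : V.IsNegation σ) :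
    TotalSpace.prodσ (s := s) t hσ ≫ Limits.pullback.fst (V.π ≫ s) t =
      Limits.pullback.fst (V.π ≫ s) t ≫ σ := Limits.pullback.lift_fst _ _ _

lemma TotalSpace.prodσ_snd {σ : V.X ⟶ V.X} (hσ : V.IsNegation σ) :
    TotalSpace.prodσ (s := s) t hσ ≫ Limits.pullback.snd (V.π ≫ s) t =
      Limits.pullback.snd (V.π ≫ s) t := Limits.pullback.lift_snd _ _ _

/-- Pasting of cartesian squares: the squares of `S × T` and of `X × T` over the base are cartesian.
-/
lemma TotalSpace.isPullback_prodπ :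
    IsPullback (Limits.pullback.fst (V.π ≫ s) t) (V.prodπ t) V.π (Limits.pullback.fst s t) := by
  refine (IsPullback.of_right (h₁₂ := Limits.pullback.snd s t) (h₂₂ := s) (v₁₃ := t) ?_
    (V.prodπ_fst t) (IsPullback.of_hasPullback s t).flip).flip
  rw [V.prodπ_snd]
  exact (IsPullback.of_hasPullback (V.π ≫ s) t).flip

instance : IsAffineHom (V.prodπ (s := s) t) :=
  MorphismProperty.of_isPullback (P := @IsAffineHom) (V.isPullback_prodπ t) inferInstance

lemma TotalSpace.prodσ_comp_prodπ {σ : V.X ⟶ V.X} (hσ : V.IsNegation σ) :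
    TotalSpace.prodσ (s := s) t hσ ≫ V.prodπ t = V.prodπ t := by
  apply Limits.pullback.hom_ext
  · rw [Category.assoc, prodπ_fst, ← Category.assoc, prodσ_fst, Category.assoc, hσ.comp_π]
  · rw [Category.assoc, prodπ_snd, prodσ_snd]

/-- A chart near the projection of `x` to `S` is base changed to an affine open of `S × T` inside
`W` that lies over it. -/
theorem TotalSpace.isNhdBasis_prod (hK : IsLineBundle K) {σ : V.X ⟶ V.X} (hσ : V.IsNegation σ) :
    IsNhdBasis fun U => ∃ c : SpectralChart (K := prodK s t K) (V.prodπ t) (V.prodτ t) U,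
      c.IsNegatedBy (V.prodσ_comp_prodπ t hσ) := fun W x hx => by
  obtain ⟨U, ⟨c, hc⟩, hxU, -⟩ := V.isNhdBasis hK hσ ⊤ (Limits.pullback.fst s t x) trivial
  obtain ⟨U', hU', hxU', hle⟩ :=
    isNhdBasis_isAffineOpen (W ⊓ Limits.pullback.fst s t ⁻¹ᵁ U) x ⟨hx, hxU⟩
  have hτ : appLin (pullbackCompHom (V.prodπ t) (Limits.pullback.fst s t) K) ⊤ (V.prodτ t) =
      pullbackGlobal (Limits.pullback.fst (V.π ≫ s) t) (V.isPullback_prodπ t).w V.τ := by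
    exact LinearMap.congr_fun (congrArg (appLin · ⊤)
      ((pullbackComp (V.prodπ t) (Limits.pullback.fst s t)).app K).inv_hom_id) _
  exact ⟨U', ⟨c.baseChange (V.isPullback_prodπ t) hτ hU' (hle.trans inf_le_right),
    c.isNegatedBy_baseChange _ _ _ _ hc _ (V.prodσ_fst t hσ)⟩, hxU',
    hle.trans inf_le_left⟩

end Product
end AlgebraicGeometry.Scheme.Modules

/-! ### Kähler differentials and top exterior powers. -/

section
variable {R A B : CommRingCat.{u}} {f : R ⟶ A} {f' : R ⟶ B} {g' : A ⟶ B}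

lemma CommRingCat.KaehlerDifferential.exists_basis_of_isLocalization
    (fac : 𝟙 R ≫ f' = f ≫ g') (M : Submonoid A)
    (hM : letI := g'.hom.toAlgebra; IsLocalization M B) {n : ℕ}
    (b : Module.Basis (Fin n) A (CommRingCat.KaehlerDifferential f)) :
    ∃ b' : Module.Basis (Fin n) B (CommRingCat.KaehlerDifferential f'),
      ∀ i, b' i = CommRingCat.KaehlerDifferential.map fac (b i) := by
  let := f.hom.toAlgebra
  let := f'.hom.toAlgebra
  let := g'.hom.toAlgebra
  have : IsScalarTower R A B := IsScalarTower.of_algebraMap_eq' (congrArg Hom.hom fac)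
  have : IsLocalization M B := hM
  let b₀ : Module.Basis (Fin n) A (_root_.KaehlerDifferential R A) := b
  let b₁ : Module.Basis (Fin n) B (_root_.KaehlerDifferential R B) :=
    b₀.ofIsLocalizedModule B M (_root_.KaehlerDifferential.map R R A B)
  refine ⟨b₁, fun i => ?_⟩
  exact b₀.ofIsLocalizedModule_apply B M (_root_.KaehlerDifferential.map R R A B) i

lemma CommRingCat.KaehlerDifferential.exists_basis_of_isStandardSmooth (n : ℕ) [Nontrivial A]
    (hf : f.hom.IsStandardSmoothOfRelativeDimension n) :
    Nonempty (Module.Basis (Fin n) A (CommRingCat.KaehlerDifferential f)) := by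
  let := f.hom.toAlgebra
  have : Algebra.IsStandardSmoothOfRelativeDimension n R A := hf
  have : Algebra.IsStandardSmooth R A :=
    Algebra.IsStandardSmoothOfRelativeDimension.isStandardSmooth n
  have h := Algebra.IsStandardSmoothOfRelativeDimension.rank_kaehlerDifferential
    (R := R) (S := A) n
  have hfin : Module.finrank A (_root_.KaehlerDifferential R A) = n :=
    Module.finrank_eq_of_rank_eq h
  have : Module.Finite A (_root_.KaehlerDifferential R A) := inferInstance
  exact ⟨(Module.finBasisOfFinrankEq A (_root_.KaehlerDifferential R A) hfin :)⟩
end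

/-- The exterior product of a basis generates the top exterior power freely. -/
lemma Module.Basis.bijective_smul_ιMulti {A M : Type*} [CommRing A] [AddCommGroup M] [Module A M]
    {n : ℕ} (b : Module.Basis (Fin n) A M) :
    Function.Bijective (fun c : A => c • exteriorPower.ιMulti A n b) := by
  -- The determinant form takes the value `1` on the basis and provides the inverse.
  let d := exteriorPower.alternatingMapLinearEquiv b.det
  have hd (m) : d (exteriorPower.ιMulti A n m) = b.det m :=
    exteriorPower.alternatingMapLinearEquiv_apply_ιMulti _ _
  refine Function.bijective_iff_has_inverse.mpr ⟨d, fun c => ?_, fun x => ?_⟩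
  · simp [hd, b.det_self]
  · let e : ⋀[A]^n M →ₗ[A] ⋀[A]^n M := d.smulRight (exteriorPower.ιMulti A n b)
    have : e = LinearMap.id := by
      -- An alternating map is determined by injective choices of basis vectors; these are
      -- permutations here, and both sides pick up the same sign.
      refine exteriorPower.linearMap_ext (b.ext_alternating fun v hv => ?_)
      obtain ⟨σ, rfl⟩ : ∃ σ : Equiv.Perm (Fin n), v = σ :=
        ⟨Equiv.ofBijective v (Finite.injective_iff_bijective.mp hv), rfl⟩
      simp only [LinearMap.compAlternatingMap_apply, e, LinearMap.smulRight_apply, hd,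
        LinearMap.id_apply]
      have h1 := b.det.map_perm b σ
      have h2 := (exteriorPower.ιMulti A n (M := M)).map_perm b σ
      rw [b.det_self] at h1
      change b.det (b ∘ σ) • _ = exteriorPower.ιMulti A n (b ∘ σ)
      rw [h1, h2]
      simp
    exact LinearMap.congr_fun this x

namespace AlgebraicGeometry.Scheme.Modules

/-! ### Frames of associated sheaves; the canonical sheaf is a line bundle. -/

section
variable {X : Scheme.{u}}

lemma presRes_presRes (P : X.PresheafOfModules) {U V W : X.Opens} (h : V ≤ U) (h' : W ≤ V)
    (x : secMod P U) : presRes P h' (presRes P h x) = presRes P (h'.trans h) x :=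
  (ConcreteCategory.congr_hom (P.presheaf.map_comp (homOfLE h).op (homOfLE h').op) x).symm

lemma presRes_smul (P : X.PresheafOfModules) {U V : X.Opens} (h : V ≤ U) (c : Γ(X, U))
    (x : secMod P U) : presRes P h (c • x) = resO X h c • presRes P h x :=
  (presheafMap P (homOfLE h).op).map_smulₛₗ c x

/-- A family of sections, as a section of the exterior power. -/
noncomputable def wedge (P : X.PresheafOfModules) {n : ℕ} {U : X.Opens}
    (m : Fin n → secMod P U) : secMod (exteriorPowerPresheaf P n) U :=
  exteriorPower.ιMulti Γ(X, U) n m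

lemma presRes_wedge (P : X.PresheafOfModules) {n : ℕ} {U V : X.Opens} (h : V ≤ U)
    (m : Fin n → secMod P U) :
    presRes (exteriorPowerPresheaf P n) h (wedge P m) = wedge P fun i => presRes P h (m i) :=
  exteriorPower.semiMap_ιMulti n (presheafMap P (homOfLE h).op) m

lemma bijective_smul_wedge (P : X.PresheafOfModules) {n : ℕ} {U : X.Opens}
    (b : Module.Basis (Fin n) Γ(X, U) (secMod P U)) :
    Function.Bijective (fun c : Γ(X, U) => c • wedge P b) :=
  b.bijective_smul_ιMulti

/-- A section of a presheaf of modules which freely generates it over each member of a basis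
becomes a frame of the associated sheaf. -/
theorem isFrame_toShf (P : X.PresheafOfModules) {U : X.Opens} (x : secMod P U)
    (h : ∀ W ≤ U, ∀ p ∈ W, ∃ (D : X.Opens) (hD : D ≤ U), p ∈ D ∧ D ≤ W ∧
      Function.Bijective (fun c : Γ(X, D) => c • presRes P hD x)) :
    IsFrame (toShf P U x) := by
  have hinj (V : X.Opens) (hV : V ≤ U) :
      Function.Injective (fun c : Γ(X, V) => c • res _ hV (toShf P U x)) := by
    intro c c' hc
    have h0 : toShf P V ((c - c') • presRes P hV x) = 0 := by
      rw [(toShf P V).map_smul, toShf_res, sub_smul]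
      exact sub_eq_zero.mpr hc
    refine eq_of_locally_eq (M := structureSheaf X) c c' fun p hp => ?_
    obtain ⟨W, hW, hpW, hz⟩ := locally_eq_zero_of_toShf_eq_zero _ _ h0 p hp
    obtain ⟨D, hD, hpD, hDW, hb⟩ := h W (hW.trans hV) p hpW
    refine ⟨D, hDW.trans hW, hpD, sub_eq_zero.mp (hb.1 ?_)⟩
    have h1 := congrArg (presRes P hDW) hz
    rw [presRes_presRes, presRes_smul, presRes_presRes, map_zero, map_sub] at h1
    exact h1.trans (zero_smul _ _).symm
  refine fun V hV => ⟨hinj V hV, fun y => ?_⟩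
  -- A section of the associated sheaf comes locally from the presheaf and so has local
  -- coefficients; injectivity makes them unique, and they glue.
  obtain ⟨c, hc⟩ := exists_glue (M := structureSheaf X) (U := V)
    (fun W hW (c : Γ(X, W)) => c • res _ (hW.trans hV) (toShf P U x) = res _ hW y)
    (fun W hW c c' e e' => hinj W _ (e.trans e'.symm))
    (fun W W' hW hW' c e => by
      have e' := (res_smul _ hW' _ _).symm.trans (congrArg (res _ hW') e)
      rw [res_res, res_res] at e'
      exact e')
    (fun p hp => by
      obtain ⟨W, hW, z, hpW, hz⟩ := locally_exists_toShf_eq P y p hp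
      obtain ⟨D, hD, hpD, hDW, hb⟩ := h W (hW.trans hV) p hpW
      obtain ⟨c, hc⟩ := hb.2 (presRes P hDW z)
      refine ⟨D, hDW.trans hW, c, hpD, ?_⟩
      have e := congrArg (toShf P D) hc
      dsimp only at e
      rw [(toShf P D).map_smul, toShf_res, toShf_res, hz, res_res] at e
      exact e)
  refine ⟨c, eq_of_locally_eq _ _ fun p hp => ?_⟩
  obtain ⟨W, hW, hpW, e⟩ := hc p hp
  refine ⟨W, hW, hpW, ?_⟩
  refine ((res_smul _ hW _ _).trans ?_).trans e
  rw [res_res]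
  rfl

end

/-- Over a standard smooth chart the differentials are free of rank two. The basis localises to all
basic opens, so its wedge freely generates the presheaf there, which is what `isFrame_toShf` asks
for. -/
theorem isLineBundle_canonicalSheaf {S : Scheme.{0}} (s : S ⟶ Spec (CommRingCat.of ℂ))
    [SmoothOfRelativeDimension 2 s] : IsLineBundle (canonicalSheaf s) := by
  intro x
  obtain ⟨U, hU, V, hV, hxV, e, hs⟩ :=
    SmoothOfRelativeDimension.exists_isStandardSmoothOfRelativeDimension (n := 2) (f := s) x
  -- `Spec ℂ` is a single point.
  obtain rfl : U = ⊤ := by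
    refine top_unique fun y _ => ?_
    have : Subsingleton (Spec (CommRingCat.of ℂ)) :=
      inferInstanceAs (Subsingleton (PrimeSpectrum ℂ))
    rw [Subsingleton.elim y (s x)]
    exact e hxV
  have : Nontrivial Γ(S, V) := by
    have : Nonempty V := ⟨⟨x, hxV⟩⟩
    infer_instance
  -- The ring map of the chart and `structureMap` differ by the isomorphism between `ℂ` and the
  -- functions on `Spec ℂ`.
  have hs' : ((structureMap s).app (op V)).hom.IsStandardSmoothOfRelativeDimension 2 :=
    RingHom.isStandardSmoothOfRelativeDimension_respectsIso.2 _
      (ΓSpecIso (CommRingCat.of ℂ)).symm.commRingCatIsoToRingEquiv hs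
  obtain ⟨b⟩ := CommRingCat.KaehlerDifferential.exists_basis_of_isStandardSmooth 2 hs'
  let b₀ : Module.Basis (Fin 2) Γ(S, V) (secMod (differentials s) V) := b
  refine ⟨V, hxV, toShf _ V (wedge _ b₀), isFrame_toShf _ _ fun W hW p hp => ?_⟩
  obtain ⟨g, hgW, hpg⟩ := hV.exists_basicOpen_le ⟨p, hp⟩ (hW hp)
  refine ⟨S.basicOpen g, S.basicOpen_le g, hpg, hgW, ?_⟩
  have hg := hV.isLocalization_basicOpen g
  obtain ⟨b', hb'⟩ := CommRingCat.KaehlerDifferential.exists_basis_of_isLocalization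
    ((structureMap s).naturality (homOfLE (S.basicOpen_le g)).op) (Submonoid.powers g) hg b
  let b₁ : Module.Basis (Fin 2) Γ(S, S.basicOpen g) (secMod (differentials s) (S.basicOpen g)) := b'
  have h₁ : (fun i => presRes (differentials s) (S.basicOpen_le g) (b₀ i)) = b₁ :=
    funext fun i => (hb' i).symm
  rw [presRes_wedge, h₁]
  exact bijective_smul_wedge _ b₁

end AlgebraicGeometry.Scheme.Modules

namespace AlgebraicGeometry.Scheme.Modules

/-! ### Involutions of moduli spaces. -/

section Involutions
variable {C S : Scheme.{u}} {s : S ⟶ C} {K : S.Modules} {V : TotalSpace K} {σ : V.X ⟶ V.X}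
  {𝓜 : ModuliProblem s K} {N : Scheme.{u}} {n : N ⟶ C} {c : Classifier 𝓜 n}

theorem hasSpectralCharts_prod (hK : IsLineBundle K) (hσ : V.IsNegation σ) {T : Scheme.{u}}
    (t : T ⟶ C) : HasSpectralCharts (K := prodK s t K) (V.prodπ t) (V.prodτ t) := fun W x hx => by
  obtain ⟨U, ⟨c, -⟩, hU⟩ := V.isNhdBasis_prod t hK hσ W x hx
  exact ⟨U, ⟨c⟩, hU⟩

/-- Families of Higgs bundles with isomorphic spectral sheaves are isomorphic. -/
theorem isIsomorphic_of_iso_spectralSheaf (hK : IsLineBundle K) (hσ : V.IsNegation σ)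
    {T : Scheme.{u}} (t : T ⟶ C) {P Q : HiggsPair (prodK s t K)}
    (hP : IsVectorBundle P.E) (hQ : IsVectorBundle Q.E)
    (i : P.spectralSheaf (V.prodπ t) (V.prodτ t) ≅ Q.spectralSheaf (V.prodπ t) (V.prodτ t)) :
    P.IsIsomorphic Q :=
  isIsomorphic_of_spectralSheaf_iso (hasSpectralCharts_prod hK hσ t) hP hQ i

/-- From Higgs pairs to sheaves this is spectral duality. Conversely, the dual sheaf is the spectral
sheaf of some family `Q` of the moduli problem as well as of `P.dual`; the spectral correspondence
gives `Q ≅ P.dual`, and both membership and classifying maps are invariant under isomorphism. -/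
theorem Classifier.isSpectralInvolution_iff (hK : IsLineBundle K) (hσ : V.IsNegation σ)
    (ι : N ⟶ N) : c.IsHiggsInvolution ι ↔ c.IsSpectralInvolution hσ ι := by
  refine and_congr_right fun _ => ⟨fun h T t ht F m => ?_, fun h T t ht P m => ?_⟩
  · rintro ⟨P, hP, ⟨i⟩, rfl⟩
    obtain ⟨hP', hm⟩ := h T t ht P _ ⟨hP, rfl⟩
    obtain ⟨-, ⟨j⟩, -⟩ := spectral_duality _ (V.isNhdBasis_prod t hK hσ) (𝓜.isVectorBundle t P hP)
    exact ⟨P.dual, hP', ⟨spectralDualIso _ _ _ i ≪≫ j.symm⟩, hm⟩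
  · rintro ⟨hP, rfl⟩
    have hE := 𝓜.isVectorBundle t P hP
    obtain ⟨Q, hQ, ⟨i⟩, hm⟩ := h T t ht _ _ ⟨P, hP, ⟨Iso.refl _⟩, rfl⟩
    obtain ⟨-, ⟨j⟩, -⟩ := spectral_duality _ (V.isNhdBasis_prod t hK hσ) hE
    have hQP : Q.IsIsomorphic P.dual := isIsomorphic_of_iso_spectralSheaf hK hσ t
      (𝓜.isVectorBundle t Q hQ) hE.dual (i.symm ≪≫ j.symm)
    have hP' := 𝓜.of_iso t Q P.dual hQP hQ
    exact ⟨hP', by rw [← hm, c.map_iso t Q P.dual hQ hP' hQP]⟩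

/-- The composition of a classifier with a morphism of targets. -/
noncomputable def Classifier.comp (c : Classifier 𝓜 n) (ι : N ⟶ N) (hι : ι ≫ n = n) :
    Classifier 𝓜 n where
  map t _ P h := c.map t P h ≫ ι
  map_comp t _ P h := by rw [Category.assoc, hι, c.map_comp]
  map_iso t _ P Q h h' i := by rw [c.map_iso t P Q h h' i]
  map_baseChange t _ t' _ b w P h := by rw [c.map_baseChange t t' b w P h, Category.assoc]

/-- Composing the universal classifying map with either `ι₁` or `ι₂` gives the classifying map of
`P.dual`. So both factor the same transformation through the moduli space, and such a factorisation
is unique. -/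
theorem Classifier.IsModuliSpace.involution_unique (hc : c.IsModuliSpace) {ι₁ ι₂ : N ⟶ N}
    (h₁ : c.IsHiggsInvolution ι₁) (h₂ : c.IsHiggsInvolution ι₂) : ι₁ = ι₂ := by
  refine (hc.2 N n hc.1 (c.comp ι₁ h₁.1)).unique ⟨h₁.1, fun _ _ _ _ _ => rfl⟩
    ⟨h₂.1, fun T t ht P h => ?_⟩
  obtain ⟨h', hm⟩ := h₁.2 T t ht P _ ⟨h, rfl⟩
  obtain ⟨h'', hm'⟩ := h₂.2 T t ht P _ ⟨h, rfl⟩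
  exact hm.symm.trans hm'

lemma TotalSpace.idProd_comp_prodπ {T T' : Scheme.{u}} {t : T ⟶ C} {t' : T' ⟶ C} (b : T' ⟶ T)
    (w : b ≫ t = t') :
    idProd (V.π ≫ s) b w ≫ V.prodπ t = V.prodπ t' ≫ idProd s b w := by
  have h1 : idProd (V.π ≫ s) b w ≫ Limits.pullback.fst _ t = Limits.pullback.fst _ t' :=
    Limits.pullback.lift_fst _ _ _
  have h2 : idProd s b w ≫ Limits.pullback.fst _ t = Limits.pullback.fst _ t' :=
    Limits.pullback.lift_fst _ _ _
  have h3 : idProd (V.π ≫ s) b w ≫ Limits.pullback.snd _ t = Limits.pullback.snd _ t' ≫ b :=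
    Limits.pullback.lift_snd _ _ _
  have h4 : idProd s b w ≫ Limits.pullback.snd _ t = Limits.pullback.snd _ t' ≫ b :=
    Limits.pullback.lift_snd _ _ _
  apply Limits.pullback.hom_ext
  · rw [Category.assoc, prodπ_fst, ← Category.assoc, h1, Category.assoc, h2, prodπ_fst]
  · rw [Category.assoc, prodπ_snd, h3, Category.assoc, h4, ← Category.assoc, prodπ_snd]

end Involutions
end AlgebraicGeometry.Scheme.Modules

open AlgebraicGeometry.Scheme.Modules in
theorem mainTheorem4 {S : Scheme.{0}} (s : S ⟶ Spec (CommRingCat.of ℂ))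
    [SmoothOfRelativeDimension 2 s]
    (V : TotalSpace (canonicalSheaf s)) (σ : V.X ⟶ V.X) (hσ : V.IsNegation σ) :
    (∀ P : HiggsPair (canonicalSheaf s), IsVectorBundle P.E →
      (∃! ψ, IsTranspose P.φ ψ) ∧
      Nonempty (P.dual.spectralSheaf V.π V.τ ≅
        spectralDual (canonicalSheaf s) V.π σ (P.spectralSheaf V.π V.τ)) ∧
      P.dual.IsDirectImage V.π V.τ
        (spectralDual (canonicalSheaf s) V.π σ (P.spectralSheaf V.π V.τ))) ∧
    (∀ (T : Scheme.{0}) (t : T ⟶ Spec (CommRingCat.of ℂ))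
      (P : HiggsPair (prodK s t (canonicalSheaf s))), IsVectorBundle P.E →
      (∃! ψ, IsTranspose P.φ ψ) ∧
      Nonempty (P.dual.spectralSheaf (V.prodπ t) (V.prodτ t) ≅
        spectralDual (prodK s t (canonicalSheaf s)) (V.prodπ t) (TotalSpace.prodσ t hσ)
          (P.spectralSheaf (V.prodπ t) (V.prodτ t))) ∧
      P.dual.IsDirectImage (V.prodπ t) (V.prodτ t)
        (spectralDual (prodK s t (canonicalSheaf s)) (V.prodπ t) (TotalSpace.prodσ t hσ)
          (P.spectralSheaf (V.prodπ t) (V.prodτ t)))) ∧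
    (∀ (𝓜 : ModuliProblem s (canonicalSheaf s)) (N : Scheme.{0})
      (n : N ⟶ Spec (CommRingCat.of ℂ)) (c : Classifier 𝓜 n), c.IsModuliSpace →
      (∀ ι : N ⟶ N, c.IsHiggsInvolution ι ↔ c.IsSpectralInvolution hσ ι) ∧
      (∀ ι₁ ι₂ : N ⟶ N, c.IsHiggsInvolution ι₁ → c.IsSpectralInvolution hσ ι₂ →
        ι₁ = ι₂ ∧ ∀ (w₁ : ι₁ ≫ n = n) (w₂ : ι₂ ≫ n = n),
          idProd (V.π ≫ s) ι₂ w₂ ≫ V.prodπ n = V.prodπ n ≫ idProd s ι₁ w₁)) := by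
  have hK := isLineBundle_canonicalSheaf s
  refine ⟨fun P hE => spectral_duality hσ.comp_π (V.isNhdBasis hK hσ) hE,
    fun T t P hE => spectral_duality _ (V.isNhdBasis_prod t hK hσ) hE,
    fun 𝓜 N n c hc => ⟨fun ι => c.isSpectralInvolution_iff hK hσ ι, fun ι₁ ι₂ h₁ h₂ => ?_⟩⟩
  -- After the equivalence both maps are involutions on Higgs pairs, so they coincide; the square
  -- then commutes for any morphism, as a check on the two projections shows.
  obtain rfl := hc.involution_unique h₁ ((c.isSpectralInvolution_iff hK hσ ι₂).mpr h₂)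
  exact ⟨rfl, fun w _ => TotalSpace.idProd_comp_prodπ ι₁ w⟩
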